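/- Let $(\Omega,\mathcal F,\mathsf P)$ be a probability space and let $\mu$ be a stochastic measure on the Borel $\sigma$-algebra of $[0,1]^d$: to each Borel set $A\subset[0,1]^d$ it assigns a real random variable $\mu(A)$ such that $\mu(A\cup B)=\mu(A)+\mu(B)$ a.s. for disjoint Borel sets $A,B$, and $\mu(A_n)\to 0$ in probability whenever $A_n\downarrow\emptyset$; nothing else is assumed, and a version of each $\mu(A)$ is fixed. For a simple function $g$ with values $v$, put $\int_A g\,d\mu=\sum_v v\,\mu(A\cap\{g=v\})$. A function $g:[0,1]^d\to\mathbb R$ is integrable with respect to $\mu$ if there are simple functions $g_n\to g$ pointwise such that $\int_A g_n\,d\mu$ converges in probability for every Borel set $A$; then $\int_{[0,1]^d} g\,d\mu$ is the limit in probability of $\int_{[0,1]^d}g_n\,d\mu$. Haar functions on $[0,1]$: $\chi_1=1$; for $n=2^j+i$, $j\ge 0$, $1\le i\le 2^j$, $\chi_n=2^{j/2}$ on $\bigl((i-1)2^{-j},(2i-1)2^{-j-1}\bigr)$, $\chi_n=-2^{j/2}$ on $\bigl((2i-1)2^{-j-1},i2^{-j}\bigr)$, $\chi_n=0$ outside $[(i-1)2^{-j},i2^{-j}]$,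 and at the remaining points $\chi_n(x)=(\chi_n(x-)+\chi_n(x+))/2$ if $0<x<1$, $\chi_n(0)=\chi_n(0+)$, $\chi_n(1)=\chi_n(1-)$. For $n=(n_1,\dots,n_d)$ let $\chi_n^{(d)}(x)=\prod_{s=1}^d\chi_{n_s}(x_s)$ and $$S^{(d)}_{2^k}(g,x)=\sum_{n\in\{1,\dots,2^k\}^d}\Bigl(\int_{[0,1]^d}g(t)\chi^{(d)}_n(t)\,dt\Bigr)\chi^{(d)}_n(x).$$ Theorem (continuity in the parameter). Let $Z$ be a metric space, $l\ge 0$ an integer, $\alpha>0$, $C_f>0$, and let $f:Z\times[0,1]^d\to\mathbb R$ be such that $f(\cdot,x)$ is continuous on $Z$ for each $x$, and $f(z,\cdot)$ is $l$ times continuously differentiable on $[0,1]^d$ for each $z$. Suppose that for all $z\in Z$, all $0\le r\le l$, all $s_1,s_2,\dots\in\{1,\dots,d\}$ and all $x,x^{(1)},x^{(2)}\in[0,1]^d$, $$\Bigl|\frac{\partial^r f(z,x)}{\partial x_{s_1}\dots\partial x_{s_r}}\Bigr|\le C_f,\qquad \Bigl|\frac{\partial^l f(z,x^{(1)})}{\partial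 x_{s_1}\dots\partial x_{s_l}}-\frac{\partial^l f(z,x^{(2)})}{\partial x_{s_1}\dots\partial x_{s_l}}\Bigr|\le C_f|x^{(1)}-x^{(2)}|^\alpha ,$$ where $C_f$ does not depend on $z$ and $|\cdot|$ on the right is the Euclidean norm. If $l+\alpha>d/2$, then each $f(z,\cdot)$ is integrable with respect to $\mu$, and the random function $\eta(z)=\int_{[0,1]^d}f(z,x)\,d\mu(x)$, $z\in Z$, has the version $$\tilde\eta(z)=\int_{[0,1]^d}S^{(d)}_1(f(z,\cdot),x)\,d\mu(x)+\sum_{k=1}^\infty\int_{[0,1]^d}\bigl(S^{(d)}_{2^k}(f(z,\cdot),x)-S^{(d)}_{2^{k-1}}(f(z,\cdot),x)\bigr)\,d\mu(x),$$ that is, $\tilde\eta(z)=\eta(z)$ a.s. for every $z\in Z$; and almost surely the series converges absolutely for all $z\in Z$ simultaneously and $z\mapsto\tilde\eta(z)$ is continuous on $Z$. -/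

import Mathlib

open MeasureTheory Filter Topology

/-- A stochastic measure on the measurable space `X`: a set function whose values are real random
variables on `(Ω, P)` and which is `σ`-additive in probability. A representative (version)
`μ A : Ω → ℝ` of each value is fixed once and for all, so additivity is an almost sure identity.
The values on non-measurable sets are irrelevant. -/
structure StochasticMeasure (X : Type*) [MeasurableSpace X] {Ω : Type*} [MeasurableSpace Ω]
    (P : Measure Ω) where
  /-- the (fixed version of the) value of the measure on a set -/
  val : Set X → Ω → ℝ
  aemeasurable : ∀ A, MeasurableSet A → AEMeasurable (val A) P
  add : ∀ A B, MeasurableSet A → MeasurableSet B → Disjoint A B →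
    ∀ᵐ ω ∂P, val (A ∪ B) ω = val A ω + val B ω
  tendsto_zero : ∀ A : ℕ → Set X, (∀ n, MeasurableSet (A n)) → Antitone A → (⋂ n, A n) = ∅ →
    TendstoInMeasure P (fun n => val (A n)) atTop (fun _ => 0)

namespace StochasticMeasure

variable {X Ω : Type*} [MeasurableSpace X] [MeasurableSpace Ω] {P : Measure Ω}

/-- `∫_A g dμ` for a simple function `g`: the linear combination `∑ v, v * μ (A ∩ {g = v})`,
`v` running over the values of `g`. -/
noncomputable def simpleIntegral (μ : StochasticMeasure X P) (A : Set X) (g : SimpleFunc X ℝ) :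
    Ω → ℝ :=
  fun ω => ∑ v ∈ g.range, v * μ.val (A ∩ g ⁻¹' {v}) ω

/-- The random variable `I` is (a version of) `∫_X f dμ`: there are simple functions `g n`
converging to `f` pointwise such that `∫_A g n dμ` converges in probability for every measurable
`A`, and `I` is the limit for `A = X`. -/
def HasIntegral (μ : StochasticMeasure X P) (f : X → ℝ) (I : Ω → ℝ) : Prop :=
  ∃ g : ℕ → SimpleFunc X ℝ,
    (∀ x, Tendsto (fun n => g n x) atTop (𝓝 (f x))) ∧
    (∀ A, MeasurableSet A →
      ∃ J : Ω → ℝ, TendstoInMeasure P (fun n => μ.simpleIntegral A (g n)) atTop J) ∧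
    TendstoInMeasure P (fun n => μ.simpleIntegral Set.univ (g n)) atTop I

/-- `f` is integrable with respect to `μ`. -/
def Integrable (μ : StochasticMeasure X P) (f : X → ℝ) : Prop :=
  ∃ I : Ω → ℝ, μ.HasIntegral f I

end StochasticMeasure

/-- The cube `[0,1]^d` in Euclidean space. -/
def unitCube (d : ℕ) : Set (EuclideanSpace ℝ (Fin d)) :=
  {x | ∀ s, x s ∈ Set.Icc (0 : ℝ) 1}

/-- The one-dimensional Haar function `χ_n`, `n ≥ 1`, on `[0,1]`. We have `χ_1 = 1`; for
`n = 2^j + i` with `j ≥ 0`, `1 ≤ i ≤ 2^j`, put `a = (i-1) 2^{-j}`, `b = i 2^{-j}` and let `m` be the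
midpoint of `[a,b]`; then `χ_n` is `2^{j/2}` on `(a,m)`, `-2^{j/2}` on `(m,b)`, `0` outside `[a,b]`,
and at `a`, `m`, `b` it is the mean of its one-sided limits, except that at the endpoints `0` and
`1` of the unit interval it is the one-sided limit from inside. -/
noncomputable def haar (n : ℕ) (x : ℝ) : ℝ :=
  if n ≤ 1 then 1 else
    let j : ℕ := Nat.log 2 (n - 1)
    let i : ℕ := n - 2 ^ j
    let a : ℝ := ((i : ℝ) - 1) / 2 ^ j
    let b : ℝ := (i : ℝ) / 2 ^ j
    let m : ℝ := (a + b) / 2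
    let h : ℝ := (2 : ℝ) ^ ((j : ℝ) / 2)
    if a < x ∧ x < m then h
    else if m < x ∧ x < b then -h
    else if x = a then (if a = 0 then h else h / 2)
    else if x = b then (if b = 1 then -h else -h / 2)
    else 0

theorem measurable_haar (n : ℕ) : Measurable (haar n) := by
  unfold haar
  by_cases hn : n ≤ 1
  · simp only [hn, if_true]; exact measurable_const
  · simp only [hn, if_false]
    refine Measurable.ite (measurableSet_Ioo) measurable_const ?_
    refine Measurable.ite (measurableSet_Ioo) measurable_const ?_
    refine Measurable.ite (measurableSet_singleton _) measurable_const ?_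
    exact Measurable.ite (measurableSet_singleton _) measurable_const measurable_const

theorem finite_range_haar (n : ℕ) : (Set.range (haar n)).Finite := by
  set h : ℝ := (2 : ℝ) ^ ((Nat.log 2 (n - 1) : ℝ) / 2) with hh
  refine Set.Finite.subset
    (Set.toFinite ({1, h, -h, h / 2, -h / 2, 0} : Set ℝ)) ?_
  rintro _ ⟨x, rfl⟩
  simp only [haar, ← hh]
  split_ifs <;> simp

/-- The multivariate Haar function `χ_{n_1}(x_1) ⋯ χ_{n_d}(x_d)` on the cube, as a simple
function. -/
noncomputable def haarProd {d : ℕ} (n : Fin d → ℕ) : SimpleFunc (unitCube d) ℝ where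
  toFun x := ∏ s, haar (n s) (x.1 s)
  measurableSet_fiber' v := by
    have h : Measurable (fun x : unitCube d => ∏ s, haar (n s) (x.1 s)) := by
      refine Finset.measurable_prod _ fun s _ => (measurable_haar _).comp ?_
      have : Measurable (fun y : EuclideanSpace ℝ (Fin d) => y s) := by fun_prop
      exact this.comp measurable_subtype_coe
    exact h (measurableSet_singleton v)
  finite_range' := by
    refine ((Set.Finite.pi' fun s => finite_range_haar (n s)).image
      (fun v : Fin d → ℝ => ∏ s, v s)).subset ?_
    rintro _ ⟨x, rfl⟩
    exact ⟨fun s => haar (n s) (x.1 s), fun s => ⟨_, rfl⟩, rfl⟩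

/-- The Fourier–Haar coefficient of `g` on the cube (integral with respect to Lebesgue measure). -/
noncomputable def haarCoeff {d : ℕ} (g : EuclideanSpace ℝ (Fin d) → ℝ) (n : Fin d → ℕ) : ℝ :=
  ∫ x in unitCube d, g x * ∏ s, haar (n s) (x s)

/-- The multivariate Fourier–Haar sum `S_{2^k}(g, ·)` over `n ∈ {1, …, 2^k}^d`, a simple function
on the cube. -/
noncomputable def haarSum {d : ℕ} (k : ℕ) (g : EuclideanSpace ℝ (Fin d) → ℝ) :
    SimpleFunc (unitCube d) ℝ :=
  ∑ n ∈ Fintype.piFinset (fun _ : Fin d => Finset.Icc 1 (2 ^ k)), haarCoeff g n • haarProd n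

/-- The `k`-th term (`k = 0, 1, …`) of the Fourier–Haar series of the stochastic integral:
`∫ (S_{2^(k+1)}(g, x) - S_{2^k}(g, x)) dμ(x)`. -/
noncomputable def haarSeriesTerm {d : ℕ} {Ω : Type*} [MeasurableSpace Ω] {P : Measure Ω}
    (μ : StochasticMeasure (unitCube d) P) (g : EuclideanSpace ℝ (Fin d) → ℝ) (k : ℕ) (ω : Ω) : ℝ :=
  μ.simpleIntegral Set.univ (haarSum (k + 1) g - haarSum k g) ω

/-- The Fourier–Haar series `∫ S_1(g, x) dμ(x) + ∑_{k ≥ 0} ∫ (S_{2^(k+1)} - S_{2^k})(g, x) dμ(x)`. -/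
noncomputable def haarSeries {d : ℕ} {Ω : Type*} [MeasurableSpace Ω] {P : Measure Ω}
    (μ : StochasticMeasure (unitCube d) P) (g : EuclideanSpace ℝ (Fin d) → ℝ) (ω : Ω) : ℝ :=
  μ.simpleIntegral Set.univ (haarSum 0 g) ω + ∑' k : ℕ, haarSeriesTerm μ g k ω

/-- The iterated partial derivative `∂^r g / ∂x_{s_1} ⋯ ∂x_{s_r}` at `x`, taken within the cube
(one-sided at its boundary); meant for `g` of class `C^r` on the cube. -/
noncomputable def cubePartial {d : ℕ} {r : ℕ} (g : EuclideanSpace ℝ (Fin d) → ℝ)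
    (s : Fin r → Fin d) (x : EuclideanSpace ℝ (Fin d)) : ℝ :=
  iteratedFDerivWithin ℝ r g (unitCube d) x (fun i => EuclideanSpace.single (s i) 1)

/-!
The terms of the Fourier–Haar series are shown to decay geometrically, almost surely and uniformly
over all functions of the given smoothness (`StochasticMeasure.ae_exists_haarSeriesTerm_bound`).
Since each term is a finite random combination of Fourier–Haar coefficients, which depend
continuously on the parameter, absolute convergence and continuity of the sum follow by uniform
convergence (`StochasticMeasure.continuous_haarSeries`). The probabilistic input is one inequality
about stochastic measures, and the analytic input is the decay of a multiscale decomposition.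

**Probability.** The values of a stochastic measure `μ` are bounded in probability
(`StochasticMeasure.boundedOn_univ`). Otherwise there is an event, the
`StochasticMeasure.unboundedPart`, on no part of which they are bounded in probability. On any part
of this event a single set makes `μ` large with conditional probability one third
(`exists_third_le_of_subset_unboundedPart`); splitting repeatedly by such sets gives a partition
with many large pieces (`exists_partition_count_le`). The union of a small random proportion of the
pieces is then still large with probability bounded below, while its removal hardly affects the
unbounded part (`exists_large_subset_unboundedPart_diff`). Iterating produces infinitely many
disjoint sets on which `μ` does not tend to zero in probability, against countable additivity
(`tendsto_val_of_pairwise_disjoint`). Writing coefficients as means of random signs, one concludes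
that the integrals of the simple functions bounded by `1` are bounded in probability
(`exists_simpleIntegral_bound`). If a family of simple functions is such that its signed sums are
uniformly bounded, then all signed sums of its integrals are bounded in probability, and the
Paley–Zygmund inequality (`le_subsetMean_lt_abs_signSum`) bounds the sum of the squares of the
integrals; this is `StochasticMeasure.exists_layer_bound`.

**Analysis.** The Haar kernel is nonnegative almost everywhere, of mean one and supported at
distance `2^{-k}`, so that `S_{2^k}(g, x)` is an average of values of `g` near `x`
(`abs_haarSum_sub_le`). A function `g` of smoothness `l + α` is decomposed along the chain of dyadic
cubes that contain a point by means of tensor product Lagrange interpolation of degree `l`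
(`cubeInterp_eq_sum_detailCoeff`). By Taylor's formula, the coefficients on the cubes of side
`2^{-j}` are `O(ρ ^ j)` with `ρ = 2^{-(l + α)}` (`exists_detailCoeff_bound`), while the increments of
level `j + i` of the basis functions of these cubes are `O(2^{-i})`
(`exists_sum_abs_basisIncr_le`). The integrals of these increments, which do not depend on `g`, are
square summable over the `2^{jd}` cubes by the probabilistic part, up to factors that grow
geometrically at an arbitrarily small rate. By the Cauchy–Schwarz inequality the contribution of the
level `j` is of the order `(ρ * 2^{d/2}) ^ j`, and `ρ * 2^{d/2} < 1` is the hypothesis `l + α > d /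
2`.

**Integrability.** The partial sums of the series are the integrals of the step functions
`S_{2^k}(g, ·)`, which converge to `g` pointwise; convergence of their integrals over a set `A` is
the same bound for the restriction of `μ` to `A` (`StochasticMeasure.hasIntegral_haarSeries`). That
any other approximating sequence leads to the same integral (`StochasticMeasure.HasIntegral.unique`)
is a consequence of Nikodym's theorem on uniform countable additivity
(`StochasticMeasure.exists_forall_truncMean_le_of_cauchy`).
-/

/-! ### Finite additivity and the elementary integral -/

theorem measureReal_le_of_ae {Ω : Type*} [MeasurableSpace Ω] {P : Measure Ω} [IsFiniteMeasure P]
    {s t : Set Ω} (h : ∀ᵐ ω ∂P, ω ∈ s → ω ∈ t) : P.real s ≤ P.real t :=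
  ENNReal.toReal_mono (measure_ne_top _ _) (measure_mono_ae h)

theorem measureReal_le_add_of_ae {Ω : Type*} [MeasurableSpace Ω] {P : Measure Ω}
    [IsFiniteMeasure P] {s t u : Set Ω} (h : ∀ᵐ ω ∂P, ω ∈ s → ω ∈ t ∨ ω ∈ u) :
    P.real s ≤ P.real t + P.real u :=
  (measureReal_le_of_ae h).trans (measureReal_union_le t u)

namespace StochasticMeasure

variable {X Ω : Type*} [MeasurableSpace X] [MeasurableSpace Ω] {P : Measure Ω}

theorem val_empty (μ : StochasticMeasure X P) : ∀ᵐ ω ∂P, μ.val ∅ ω = 0 := by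
  filter_upwards [μ.add ∅ ∅ .empty .empty (by simp)] with ω h
  simp only [Set.union_self] at h
  linarith

theorem val_inter_add_diff (μ : StochasticMeasure X P) {A B : Set X} (hA : MeasurableSet A)
    (hB : MeasurableSet B) : ∀ᵐ ω ∂P, μ.val A ω = μ.val (A ∩ B) ω + μ.val (A \ B) ω := by
  have h := μ.add (A ∩ B) (A \ B) (hA.inter hB) (hA.diff hB)
    (Set.disjoint_sdiff_right.mono_left Set.inter_subset_right)
  rwa [Set.inter_union_sdiff] at h

theorem val_inter_preimage_finset {ι : Type*} (μ : StochasticMeasure X P) {A : Set X}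
    (hA : MeasurableSet A) (h : X → ι) (hh : ∀ i, MeasurableSet (h ⁻¹' {i})) (T : Finset ι) :
    ∀ᵐ ω ∂P, μ.val (A ∩ h ⁻¹' T) ω = ∑ i ∈ T, μ.val (A ∩ h ⁻¹' {i}) ω := by
  classical
  have hT : ∀ T : Finset ι, MeasurableSet (h ⁻¹' (T : Set ι)) := fun T => by
    rw [← Set.biUnion_preimage_singleton]
    exact T.measurableSet_biUnion fun i _ => hh i
  induction T using Finset.induction_on with
  | empty => simpa using μ.val_empty
  | insert i T hi ih =>
    have hd : Disjoint (A ∩ h ⁻¹' {i}) (A ∩ h ⁻¹' (T : Set ι)) := by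
      rw [Set.disjoint_left]
      rintro x ⟨-, hx⟩ ⟨-, hx'⟩
      simp only [Set.mem_preimage, Set.mem_singleton_iff] at hx hx'
      exact hi (by simpa [hx] using hx')
    filter_upwards [ih, μ.add _ _ (hA.inter (hh i)) (hA.inter (hT T)) hd] with ω h1 h2
    rw [Finset.sum_insert hi, ← h1, ← h2, ← Set.inter_union_distrib_left, ← Set.preimage_union]
    rw [Finset.coe_insert, Set.insert_eq]

/-- Outside one null set, additivity holds on the whole finite algebra generated by `h`. -/
theorem val_inter_preimage_forall {ι : Type*} (μ : StochasticMeasure X P) {A : Set X}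
    (hA : MeasurableSet A) (h : X → ι) (hh : ∀ i, MeasurableSet (h ⁻¹' {i})) (S : Finset ι) :
    ∀ᵐ ω ∂P, ∀ T ⊆ S, μ.val (A ∩ h ⁻¹' T) ω = ∑ i ∈ T, μ.val (A ∩ h ⁻¹' {i}) ω := by
  have := (Finset.eventually_all S.powerset (l := ae P)).2
    fun T _ => μ.val_inter_preimage_finset hA h hh T
  simpa only [Finset.mem_powerset] using this

/-- Outside one null set, the integrals of all simple functions that factor through `G` are the
corresponding linear combinations of the values of the measure on the fibres of `G`. -/
theorem simpleIntegral_eq_sum {ι : Type*} (μ : StochasticMeasure X P) {A : Set X}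
    (hA : MeasurableSet A) (G : SimpleFunc X ι) :
    ∀ᵐ ω ∂P, ∀ (g : SimpleFunc X ℝ) (ψ : ι → ℝ), (∀ x, g x = ψ (G x)) →
      μ.simpleIntegral A g ω = ∑ e ∈ G.range, ψ e * μ.val (A ∩ G ⁻¹' {e}) ω := by
  classical
  filter_upwards [μ.val_inter_preimage_forall hA G G.measurableSet_fiber G.range] with ω hω g ψ hg
  have hmaps : ∀ e ∈ G.range, ψ e ∈ g.range := by
    intro e he
    obtain ⟨x, rfl⟩ := SimpleFunc.mem_range.1 he
    exact SimpleFunc.mem_range.2 ⟨x, hg x⟩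
  rw [← Finset.sum_fiberwise_of_maps_to hmaps, simpleIntegral]
  refine Finset.sum_congr rfl fun v _ => ?_
  have hset : A ∩ g ⁻¹' {v} = A ∩ G ⁻¹' ((G.range.filter fun e => ψ e = v : Finset ι) : Set ι) := by
    ext x
    simp [hg]
  rw [hset, hω _ (Finset.filter_subset _ _), Finset.mul_sum]
  refine Finset.sum_congr rfl fun e he => ?_
  rw [(Finset.mem_filter.1 he).2]

theorem simpleIntegral_add (μ : StochasticMeasure X P) {A : Set X} (hA : MeasurableSet A)
    (g h : SimpleFunc X ℝ) : ∀ᵐ ω ∂P,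
      μ.simpleIntegral A (g + h) ω = μ.simpleIntegral A g ω + μ.simpleIntegral A h ω := by
  filter_upwards [μ.simpleIntegral_eq_sum hA (g.pair h)] with ω hω
  rw [hω g Prod.fst fun x => rfl, hω h Prod.snd fun x => rfl,
    hω (g + h) (fun p => p.1 + p.2) fun x => rfl, ← Finset.sum_add_distrib]
  exact Finset.sum_congr rfl fun e _ => by ring

theorem simpleIntegral_smul (μ : StochasticMeasure X P) {A : Set X} (hA : MeasurableSet A)
    (c : ℝ) (g : SimpleFunc X ℝ) : ∀ᵐ ω ∂P,
      μ.simpleIntegral A (c • g) ω = c * μ.simpleIntegral A g ω := by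
  filter_upwards [μ.simpleIntegral_eq_sum hA g] with ω hω
  rw [hω g id fun x => rfl, hω (c • g) (fun v => c * v) fun x => rfl, Finset.mul_sum]
  exact Finset.sum_congr rfl fun e _ => by simp [mul_assoc]

theorem simpleIntegral_sub (μ : StochasticMeasure X P) {A : Set X} (hA : MeasurableSet A)
    (g h : SimpleFunc X ℝ) : ∀ᵐ ω ∂P,
      μ.simpleIntegral A (g - h) ω = μ.simpleIntegral A g ω - μ.simpleIntegral A h ω := by
  filter_upwards [μ.simpleIntegral_eq_sum hA (g.pair h)] with ω hω
  rw [hω g Prod.fst fun x => rfl, hω h Prod.snd fun x => rfl,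
    hω (g - h) (fun p => p.1 - p.2) fun x => rfl, ← Finset.sum_sub_distrib]
  exact Finset.sum_congr rfl fun e _ => by ring

theorem simpleIntegral_sum {ι : Type*} (μ : StochasticMeasure X P) {A : Set X}
    (hA : MeasurableSet A) (s : Finset ι) (c : ι → ℝ) (g : ι → SimpleFunc X ℝ) : ∀ᵐ ω ∂P,
      μ.simpleIntegral A (∑ i ∈ s, c i • g i) ω = ∑ i ∈ s, c i * μ.simpleIntegral A (g i) ω := by
  classical
  induction s using Finset.induction_on with
  | empty =>
    filter_upwards [μ.simpleIntegral_smul hA 0 0] with ω hω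
    simpa using hω
  | insert i s hi ih =>
    filter_upwards [ih, μ.simpleIntegral_add hA (c i • g i) (∑ i ∈ s, c i • g i),
      μ.simpleIntegral_smul hA (c i) (g i)] with ω h1 h2 h3
    rw [Finset.sum_insert hi, Finset.sum_insert hi, h2, h1, h3]

theorem aemeasurable_simpleIntegral (μ : StochasticMeasure X P) {A : Set X} (hA : MeasurableSet A)
    (g : SimpleFunc X ℝ) : AEMeasurable (μ.simpleIntegral A g) P := by
  unfold simpleIntegral
  exact Finset.aemeasurable_fun_sum _ fun v _ =>
    (μ.aemeasurable _ (hA.inter (g.measurableSet_fiber v))).const_mul v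

theorem nullMeasurableSet_lt_abs {ξ : Ω → ℝ} (hξ : AEMeasurable ξ P) (C : ℝ) :
    NullMeasurableSet {ω | C < |ξ ω|} P :=
  nullMeasurableSet_lt aemeasurable_const hξ.abs

theorem nullMeasurableSet_val (μ : StochasticMeasure X P) {B : Set X} (hB : MeasurableSet B)
    (C : ℝ) : NullMeasurableSet {ω | C < |μ.val B ω|} P :=
  nullMeasurableSet_lt_abs (μ.aemeasurable B hB) C

theorem tendstoInMeasure_zero_iff [IsFiniteMeasure P] {ξ : ℕ → Ω → ℝ} :
    TendstoInMeasure P ξ atTop (fun _ => 0) ↔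
      ∀ ε > 0, ∀ δ > 0, ∀ᶠ n in atTop, P.real {ω | ε < |ξ n ω|} < δ := by
  rw [tendstoInMeasure_iff_measureReal_norm]
  simp only [sub_zero, Real.norm_eq_abs]
  constructor
  · intro h ε hε δ hδ
    filter_upwards [(h ε hε).eventually_lt_const hδ] with n hn
    exact (measureReal_mono (μ := P) (s₂ := {x | ε ≤ |ξ n x|}) fun ω (hω : ε < |ξ n ω|) =>
      show ε ≤ |ξ n ω| from hω.le).trans_lt hn
  · intro h ε hε
    rw [Metric.tendsto_nhds]
    intro δ hδ
    filter_upwards [h (ε / 2) (by positivity) δ hδ] with n hn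
    rw [Real.dist_0_eq_abs, abs_of_nonneg measureReal_nonneg]
    refine (measureReal_mono (μ := P) (s₂ := {x | ε / 2 < |ξ n x|}) fun ω hω => ?_).trans_lt hn
    simp only [Set.mem_ofPred_eq] at hω ⊢
    linarith

/-- A stochastic measure is exhaustive: its values on disjoint sets tend to zero in probability. -/
theorem tendsto_val_of_pairwise_disjoint [IsFiniteMeasure P] (μ : StochasticMeasure X P)
    {D : ℕ → Set X} (hD : ∀ n, MeasurableSet (D n)) (hd : Pairwise fun i j => Disjoint (D i) (D j)) :
    TendstoInMeasure P (fun n => μ.val (D n)) atTop (fun _ => 0) := by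
  set A : ℕ → Set X := fun n => ⋃ k ≥ n, D k with hA
  have hAm : ∀ n, MeasurableSet (A n) := fun n =>
    .iUnion fun k => .iUnion fun _ => hD k
  have hanti : Antitone A := fun m n hmn =>
    Set.biUnion_subset_biUnion_left fun k (hk : n ≤ k) => hmn.trans hk
  have hemp : ⋂ n, A n = ∅ := by
    rw [Set.eq_empty_iff_forall_notMem]
    intro x hx
    rw [Set.mem_iInter] at hx
    obtain ⟨k, -, hk⟩ := Set.mem_iUnion₂.1 (hx 0)
    obtain ⟨m, hm, hm'⟩ := Set.mem_iUnion₂.1 (hx (k + 1))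
    exact Set.disjoint_left.1 (hd (show k ≠ m by simp only [ge_iff_le] at hm; omega)) hk hm'
  have h0 := tendstoInMeasure_zero_iff.1 (μ.tendsto_zero A hAm hanti hemp)
  rw [tendstoInMeasure_zero_iff]
  intro ε hε δ hδ
  have h1 := h0 (ε / 2) (by positivity) (δ / 2) (by positivity)
  filter_upwards [h1, (tendsto_add_atTop_nat 1).eventually h1] with n hn hn'
  have hsplit : D n ∪ A (n + 1) = A n := by
    ext x
    simp only [hA, Set.mem_union, Set.mem_iUnion]
    constructor
    · rintro (h | ⟨k, hk, h⟩)
      · exact ⟨n, le_rfl, h⟩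
      · exact ⟨k, by simp only [ge_iff_le] at hk ⊢; omega, h⟩
    · rintro ⟨k, hk, h⟩
      rcases hk.eq_or_lt with rfl | hk
      · exact .inl h
      · exact .inr ⟨k, hk, h⟩
  have hdis : Disjoint (D n) (A (n + 1)) := by
    rw [Set.disjoint_left]
    intro x hx hx'
    obtain ⟨m, hm, hm'⟩ := Set.mem_iUnion₂.1 hx'
    exact Set.disjoint_left.1 (hd (show n ≠ m by simp only [ge_iff_le] at hm; omega)) hx hm'
  have hadd := μ.add _ _ (hD n) (hAm (n + 1)) hdis
  rw [hsplit] at hadd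
  have : P.real {ω | ε < |μ.val (D n) ω|} ≤
      P.real {ω | ε / 2 < |μ.val (A n) ω|} + P.real {ω | ε / 2 < |μ.val (A (n + 1)) ω|} := by
    refine measureReal_le_add_of_ae ?_
    filter_upwards [hadd] with ω hω (h : ε < _)
    by_contra hcon
    rw [not_or] at hcon
    simp only [not_lt] at hcon
    have : μ.val (D n) ω = μ.val (A n) ω - μ.val (A (n + 1)) ω := by linarith
    rw [this] at h
    have := abs_sub (μ.val (A n) ω) (μ.val (A (n + 1)) ω)
    linarith [hcon.1, hcon.2]
  linarith

theorem simpleIntegral_union (μ : StochasticMeasure X P) {A B : Set X} (hA : MeasurableSet A)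
    (hB : MeasurableSet B) (hd : Disjoint A B) (g : SimpleFunc X ℝ) : ∀ᵐ ω ∂P,
      μ.simpleIntegral (A ∪ B) g ω = μ.simpleIntegral A g ω + μ.simpleIntegral B g ω := by
  have : ∀ᵐ ω ∂P, ∀ v ∈ g.range, μ.val ((A ∪ B) ∩ g ⁻¹' {v}) ω =
      μ.val (A ∩ g ⁻¹' {v}) ω + μ.val (B ∩ g ⁻¹' {v}) ω := by
    refine (Finset.eventually_all _).2 fun v _ => ?_
    rw [Set.union_inter_distrib_right]
    exact μ.add _ _ (hA.inter (g.measurableSet_fiber v)) (hB.inter (g.measurableSet_fiber v))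
      (hd.mono Set.inter_subset_left Set.inter_subset_left)
  filter_upwards [this] with ω hω
  simp only [simpleIntegral]
  rw [← Finset.sum_add_distrib]
  exact Finset.sum_congr rfl fun v hv => by rw [hω v hv]; ring

end StochasticMeasure

/-! ### Random subsets of a finite set -/

/-- The expectation of `F T`, where `T` is the random subset of `s` that contains each `i ∈ s`
with probability `p i`, independently. -/
noncomputable def subsetMean {ι : Type*} [DecidableEq ι] (s : Finset ι) (p : ι → ℝ)
    (F : Finset ι → ℝ) : ℝ :=
  ∑ T ∈ s.powerset, ((∏ i ∈ T, p i) * ∏ i ∈ s \ T, (1 - p i)) * F T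

section subsetMean

variable {ι : Type*} [DecidableEq ι] {s : Finset ι} {p : ι → ℝ}

theorem subsetMean_const (s : Finset ι) (p : ι → ℝ) (c : ℝ) : subsetMean s p (fun _ => c) = c := by
  rw [subsetMean, ← Finset.sum_mul, ← Finset.prod_add]
  simp

theorem subsetMean_add (F G : Finset ι → ℝ) :
    subsetMean s p (fun T => F T + G T) = subsetMean s p F + subsetMean s p G := by
  simp only [subsetMean, mul_add, Finset.sum_add_distrib]

theorem subsetMean_const_mul (c : ℝ) (F : Finset ι → ℝ) :
    subsetMean s p (fun T => c * F T) = c * subsetMean s p F := by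
  simp only [subsetMean, Finset.mul_sum]
  exact Finset.sum_congr rfl fun _ _ => by ring

theorem subsetMean_weight_nonneg (hp : ∀ i, 0 ≤ p i ∧ p i ≤ 1) (T : Finset ι) :
    0 ≤ (∏ i ∈ T, p i) * ∏ i ∈ s \ T, (1 - p i) :=
  mul_nonneg (Finset.prod_nonneg fun i _ => (hp i).1)
    (Finset.prod_nonneg fun i _ => by linarith [(hp i).2])

theorem subsetMean_mono (hp : ∀ i, 0 ≤ p i ∧ p i ≤ 1) {F G : Finset ι → ℝ}
    (h : ∀ T ⊆ s, F T ≤ G T) : subsetMean s p F ≤ subsetMean s p G :=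
  Finset.sum_le_sum fun T hT =>
    mul_le_mul_of_nonneg_left (h T (Finset.mem_powerset.1 hT)) (subsetMean_weight_nonneg hp T)

theorem subsetMean_congr {F G : Finset ι → ℝ} (h : ∀ T ⊆ s, F T = G T) :
    subsetMean s p F = subsetMean s p G :=
  Finset.sum_congr rfl fun T hT => by rw [h T (Finset.mem_powerset.1 hT)]

/-- Conditioning on whether the random subset contains `a`. -/
theorem subsetMean_insert {a : ι} (ha : a ∉ s) (F : Finset ι → ℝ) :
    subsetMean (insert a s) p F =
      (1 - p a) * subsetMean s p F + p a * subsetMean s p (fun T => F (insert a T)) := by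
  rw [subsetMean, Finset.sum_powerset_insert ha, subsetMean, subsetMean, Finset.mul_sum,
    Finset.mul_sum]
  congr 1 <;> refine Finset.sum_congr rfl fun T hT => ?_
  · have haT : a ∉ T := fun h => ha (Finset.mem_powerset.1 hT h)
    rw [Finset.insert_sdiff_of_notMem _ haT, Finset.prod_insert (by simp [ha])]
    ring
  · have haT : a ∉ T := fun h => ha (Finset.mem_powerset.1 hT h)
    have : insert a s \ insert a T = s \ T := by
      ext x; simp only [Finset.mem_sdiff, Finset.mem_insert]
      constructor
      · rintro ⟨rfl | h, h'⟩ <;> tauto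
      · rintro ⟨h, h'⟩
        exact ⟨.inr h, fun h'' => h''.elim (fun e => ha (e ▸ h)) h'⟩
    rw [Finset.prod_insert haT, this]
    ring

theorem exists_le_of_le_subsetMean {c : ℝ} (hp : ∀ i, 0 ≤ p i ∧ p i ≤ 1) {F : Finset ι → ℝ}
    (h : c ≤ subsetMean s p F) : ∃ T ⊆ s, c ≤ F T := by
  by_contra! hcon
  obtain ⟨b, hbc, hb⟩ : ∃ b < c, ∀ T ⊆ s, F T ≤ b := by
    obtain ⟨T₀, hT₀, hmax⟩ := s.powerset.exists_max_image F (Finset.powerset_nonempty s)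
    exact ⟨F T₀, hcon T₀ (Finset.mem_powerset.1 hT₀),
      fun T hT => hmax T (Finset.mem_powerset.2 hT)⟩
  have := subsetMean_mono hp hb
  rw [subsetMean_const] at this
  linarith

theorem subsetMean_notMem {a : ι} (ha : a ∈ s) :
    subsetMean s p (fun T => if a ∈ T then 0 else 1) = 1 - p a := by
  rw [← Finset.insert_erase ha, subsetMean_insert (by simp)]
  have h1 : subsetMean (s.erase a) p (fun T => if a ∈ T then (0 : ℝ) else 1) = 1 := by
    refine (subsetMean_congr fun T hT => if_neg fun h => ?_).trans
      (subsetMean_const (s.erase a) p 1)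
    exact absurd (hT h) (by simp)
  have h2 : subsetMean (s.erase a) p (fun T => if a ∈ insert a T then (0 : ℝ) else 1) = 0 := by
    simp [subsetMean]
  rw [h1, h2]
  ring

/-- Anti-concentration of a random subset sum with `N` large summands: conditionally on the other
summands, either choosing none of the large ones or choosing exactly one of them succeeds. -/
theorem le_subsetMean_lt_abs_sum {a : ι → ℝ} {C θ m : ℝ} (hθ0 : 0 ≤ θ) (hθ1 : θ ≤ 1)
    {B : Finset ι} (hBs : B ⊆ s) (hB : ∀ i ∈ B, 2 * C < |a i|) (h0 : m ≤ (1 - θ) ^ B.card)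
    (h1 : m ≤ B.card * (θ * (1 - θ) ^ (B.card - 1))) :
    m ≤ subsetMean s (fun _ => θ) (fun T => if C < |∑ i ∈ T, a i| then 1 else 0) := by
  have hp : ∀ i : ι, 0 ≤ (fun _ : ι => θ) i ∧ (fun _ : ι => θ) i ≤ 1 := fun i => ⟨hθ0, hθ1⟩
  have base : ∀ r : ℝ,
      m ≤ subsetMean B (fun _ => θ) (fun T => if C < |r + ∑ i ∈ T, a i| then 1 else 0) := by
    intro r
    set F : Finset ι → ℝ := fun T => if C < |r + ∑ i ∈ T, a i| then 1 else 0 with hF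
    have hF0 : ∀ T, 0 ≤ F T := fun T => by simp only [hF]; split_ifs <;> norm_num
    set w : Finset ι → ℝ := fun T => (∏ i ∈ T, θ) * ∏ i ∈ B \ T, (1 - θ) with hw
    have hw0 : ∀ T, 0 ≤ w T := fun T => subsetMean_weight_nonneg hp T
    -- the selections of at most one element of `B`
    have hsub : insert ∅ (B.image fun i => ({i} : Finset ι)) ⊆ B.powerset := by
      intro T hT
      rw [Finset.mem_insert, Finset.mem_image] at hT
      rw [Finset.mem_powerset]
      rcases hT with rfl | ⟨i, hi, rfl⟩
      · exact Finset.empty_subset _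
      · simpa using hi
    have hle : w ∅ * F ∅ + ∑ i ∈ B, w {i} * F {i} ≤ subsetMean B (fun _ => θ) F := by
      refine le_trans (le_of_eq ?_)
        (Finset.sum_le_sum_of_subset_of_nonneg hsub fun T _ _ => mul_nonneg (hw0 T) (hF0 T))
      rw [Finset.sum_insert, Finset.sum_image]
      · exact fun i _ j _ h => by simpa using h
      · simp
    refine le_trans ?_ hle
    have hw1 : w ∅ = (1 - θ) ^ B.card := by simp [hw]
    have hw2 : ∀ i ∈ B, w {i} = θ * (1 - θ) ^ (B.card - 1) := fun i hi => by
      simp [hw, Finset.card_sdiff_of_subset (Finset.singleton_subset_iff.2 hi)]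
    by_cases hr : C < |r|
    · have : F ∅ = 1 := by simp [hF, hr]
      have h2 : 0 ≤ ∑ i ∈ B, w {i} * F {i} :=
        Finset.sum_nonneg fun i _ => mul_nonneg (hw0 _) (hF0 _)
      rw [this, hw1]
      linarith
    · have h2 : ∑ i ∈ B, w {i} * F {i} = B.card * (θ * (1 - θ) ^ (B.card - 1)) := by
        rw [← nsmul_eq_mul, ← Finset.sum_const]
        refine Finset.sum_congr rfl fun i hi => ?_
        have : F {i} = 1 := by
          simp only [hF, Finset.sum_singleton]
          rw [if_pos]
          have h3 := hB i hi
          have h4 := abs_sub (r + a i) r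
          rw [add_sub_cancel_left] at h4
          linarith
        rw [this, hw2 i hi, mul_one]
      rw [h2]
      linarith [mul_nonneg (hw0 ∅) (hF0 ∅)]
  -- the summands outside `B` are added one at a time; the offset `r` absorbs the value of those
  -- already decided
  have key : ∀ R : Finset ι, Disjoint B R → ∀ r : ℝ, m ≤
      subsetMean (R ∪ B) (fun _ => θ) (fun T => if C < |r + ∑ i ∈ T, a i| then 1 else 0) := by
    intro R
    induction R using Finset.induction_on with
    | empty => intro _ r; simpa using base r
    | insert j R hj ih =>
      intro hd r
      rw [Finset.disjoint_insert_right] at hd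
      have hjR : j ∉ R ∪ B := by simp [hj, hd.1]
      rw [Finset.insert_union, subsetMean_insert hjR]
      have e1 := ih hd.2 r
      have e2 := ih hd.2 (r + a j)
      have e3 : subsetMean (R ∪ B) (fun _ => θ)
            (fun T => if C < |r + ∑ i ∈ insert j T, a i| then (1 : ℝ) else 0) =
          subsetMean (R ∪ B) (fun _ => θ)
            (fun T => if C < |r + a j + ∑ i ∈ T, a i| then (1 : ℝ) else 0) := by
        refine subsetMean_congr fun T hT => ?_
        rw [Finset.sum_insert fun h => hjR (hT h), add_assoc]
      rw [e3]
      nlinarith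
  have := key (s \ B) Finset.disjoint_sdiff 0
  rw [Finset.sdiff_union_of_subset hBs] at this
  simpa using this

/-- The sum of the centred signs `±1 - v i` with coefficients `a i`, the sign being `+1` on `T`. -/
noncomputable def centredSignSum (s : Finset ι) (v a : ι → ℝ) (T : Finset ι) : ℝ :=
  ∑ i ∈ s, ((if i ∈ T then 1 else -1) - v i) * a i

theorem centredSignSum_insert_of_subset {v a : ι → ℝ} {j : ι} (hj : j ∉ s) {T : Finset ι}
    (hT : T ⊆ s) :
    centredSignSum (insert j s) v a T = centredSignSum s v a T - (1 + v j) * a j := by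
  rw [centredSignSum, Finset.sum_insert hj, if_neg fun h => hj (hT h), centredSignSum]
  ring

theorem centredSignSum_insert_insert {v a : ι → ℝ} {j : ι} (hj : j ∉ s) {T : Finset ι} :
    centredSignSum (insert j s) v a (insert j T) = centredSignSum s v a T + (1 - v j) * a j := by
  rw [centredSignSum, Finset.sum_insert hj, if_pos (Finset.mem_insert_self _ _), centredSignSum,
    add_comm]
  congr 1
  refine Finset.sum_congr rfl fun i hi => ?_
  have : i ≠ j := fun h => hj (h ▸ hi)
  simp [Finset.mem_insert, this]

/-- Conditioning on the sign at `j`; the signs are independent and the one at `i` has mean `v i`. -/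
theorem subsetMean_centredSignSum_insert {v a : ι → ℝ} {j : ι} (hj : j ∉ s) (φ : ℝ → ℝ) :
    subsetMean (insert j s) (fun i => (1 + v i) / 2)
        (fun T => φ (centredSignSum (insert j s) v a T)) =
      (1 - v j) / 2 * subsetMean s (fun i => (1 + v i) / 2)
        (fun T => φ (centredSignSum s v a T - (1 + v j) * a j)) +
      (1 + v j) / 2 * subsetMean s (fun i => (1 + v i) / 2)
        (fun T => φ (centredSignSum s v a T + (1 - v j) * a j)) := by
  rw [subsetMean_insert hj]
  congr 1
  · rw [show 1 - (1 + v j) / 2 = (1 - v j) / 2 by ring]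
    congr 1
    exact subsetMean_congr fun T hT => by rw [centredSignSum_insert_of_subset hj hT]
  · congr 1
    exact subsetMean_congr fun T hT => by rw [centredSignSum_insert_insert hj]

theorem subsetMean_centredSignSum (s : Finset ι) (v a : ι → ℝ) :
    subsetMean s (fun i => (1 + v i) / 2) (centredSignSum s v a) = 0 := by
  induction s using Finset.induction_on with
  | empty => simp [subsetMean, centredSignSum]
  | insert j s hj ih =>
    have := subsetMean_centredSignSum_insert (s := s) (v := v) (a := a) hj id
    simp only [id] at this
    rw [this]
    simp only [sub_eq_add_neg, subsetMean_add, subsetMean_const]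
    rw [ih]
    ring

theorem subsetMean_centredSignSum_sq (s : Finset ι) (v a : ι → ℝ) :
    subsetMean s (fun i => (1 + v i) / 2) (fun T => centredSignSum s v a T ^ 2) =
      ∑ i ∈ s, (1 - v i ^ 2) * a i ^ 2 := by
  induction s using Finset.induction_on with
  | empty => simp [subsetMean, centredSignSum]
  | insert j s hj ih =>
    rw [subsetMean_centredSignSum_insert (s := s) (v := v) (a := a) hj (· ^ 2),
      Finset.sum_insert hj, ← ih]
    have e : ∀ c : ℝ, subsetMean s (fun i => (1 + v i) / 2)
        (fun T => (centredSignSum s v a T + c) ^ 2) =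
        subsetMean s (fun i => (1 + v i) / 2) (fun T => centredSignSum s v a T ^ 2) + c ^ 2 := by
      intro c
      have : (fun T => (centredSignSum s v a T + c) ^ 2) = fun T =>
          centredSignSum s v a T ^ 2 + (2 * c * centredSignSum s v a T + c ^ 2) := by
        funext T; ring
      rw [this, subsetMean_add, subsetMean_add, subsetMean_const_mul, subsetMean_const]
      rw [subsetMean_centredSignSum]
      ring
    simp only [sub_eq_add_neg (centredSignSum s v a _), e]
    ring

/-- The fourth moment of a sum of independent fair signs. -/
theorem subsetMean_signSum_pow_four_le (s : Finset ι) (a : ι → ℝ) :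
    subsetMean s (fun _ => 1 / 2) (fun T => centredSignSum s 0 a T ^ 4) ≤
      3 * (∑ i ∈ s, a i ^ 2) ^ 2 := by
  have hhalf : (fun i : ι => (1 + (0 : ι → ℝ) i) / 2) = fun _ => 1 / 2 := by funext i; simp
  induction s using Finset.induction_on with
  | empty => simp [subsetMean, centredSignSum]
  | insert j s hj ih =>
    have h1 := subsetMean_centredSignSum_insert (s := s) (v := 0) (a := a) hj (· ^ 4)
    have h2 := subsetMean_centredSignSum_sq s 0 a
    rw [hhalf] at h1 h2
    simp only [Pi.zero_apply, sub_zero, add_zero, one_mul] at h1 h2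
    rw [h1, ← mul_add, ← subsetMean_add]
    have : (fun T => (centredSignSum s 0 a T - a j) ^ 4 + (centredSignSum s 0 a T + a j) ^ 4) =
        fun T => 2 * centredSignSum s 0 a T ^ 4 + (12 * a j ^ 2 * centredSignSum s 0 a T ^ 2 +
          2 * a j ^ 4) := by
      funext T; ring
    rw [this, subsetMean_add, subsetMean_add, subsetMean_const_mul, subsetMean_const_mul,
      subsetMean_const, h2, Finset.sum_insert hj]
    norm_num
    nlinarith [sq_nonneg (a j ^ 2)]

/-- The Paley–Zygmund inequality for sums of independent fair signs. -/
theorem le_subsetMean_lt_abs_signSum (s : Finset ι) (a : ι → ℝ) {C : ℝ}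
    (h : 2 * C ^ 2 < ∑ i ∈ s, a i ^ 2) :
    1 / 12 ≤ subsetMean s (fun _ => 1 / 2)
      (fun T => if C < |centredSignSum s 0 a T| then 1 else 0) := by
  have hhalf : (fun i : ι => (1 + (0 : ι → ℝ) i) / 2) = fun _ => 1 / 2 := by funext i; simp
  set Q := ∑ i ∈ s, a i ^ 2 with hQ
  have hQ0 : 0 < Q := lt_of_le_of_lt (by positivity) h
  have h4 := subsetMean_signSum_pow_four_le s a
  have h2 := subsetMean_centredSignSum_sq s 0 a
  rw [hhalf] at h2
  simp only [Pi.zero_apply, zero_pow two_ne_zero, sub_zero, one_mul] at h2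
  have hpt : ∀ T ⊆ s, centredSignSum s 0 a T ^ 2 ≤ Q / 2 +
      (1 / (12 * Q) * centredSignSum s 0 a T ^ 4 +
        3 * Q * (if C < |centredSignSum s 0 a T| then 1 else 0)) := by
    intro T _
    set S := centredSignSum s 0 a T
    split_ifs with hS
    · have : S ^ 2 ≤ 1 / (12 * Q) * S ^ 4 + 3 * Q := by
        -- Young's inequality; the first term has mean at most `Q / 4`
        have e : 1 / (12 * Q) * S ^ 4 + 3 * Q - S ^ 2 = (S ^ 2 - 6 * Q) ^ 2 / (12 * Q) := by
          field_simp; ring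
        have : 0 ≤ (S ^ 2 - 6 * Q) ^ 2 / (12 * Q) := by positivity
        linarith
      linarith
    · have : S ^ 2 ≤ C ^ 2 := by
        rw [not_lt] at hS
        exact sq_le_sq' (by linarith [neg_abs_le S]) (by linarith [le_abs_self S])
      have : 0 ≤ 1 / (12 * Q) * S ^ 4 := by positivity
      linarith
  have hm := subsetMean_mono (p := fun _ : ι => (1 / 2 : ℝ)) (fun i => by norm_num) hpt
  rw [h2, subsetMean_add, subsetMean_add, subsetMean_const, subsetMean_const_mul,
    subsetMean_const_mul] at hm
  set p := subsetMean s (fun _ => 1 / 2)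
      (fun T => if C < |centredSignSum s 0 a T| then (1 : ℝ) else 0)
  have h5 : 1 / (12 * Q) * subsetMean s (fun _ => 1 / 2) (fun T => centredSignSum s 0 a T ^ 4) ≤
      Q / 4 := by
    calc _ ≤ 1 / (12 * Q) * (3 * Q ^ 2) := by gcongr
      _ = Q / 4 := by field_simp; norm_num
  have : Q * (1 / 12) ≤ Q * p := by linarith
  exact le_of_mul_le_mul_left this hQ0

open Classical in
/-- If almost every point of `F` lies in the random event `E T` with probability at least `c`, then
the mean probability of `E T` is at least `c * P F`. -/
theorem mul_measureReal_le_subsetMean {Ω : Type*} [MeasurableSpace Ω] {P : Measure Ω}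
    [IsFiniteMeasure P] (hp : ∀ i, 0 ≤ p i ∧ p i ≤ 1) {F : Set Ω} (hF : NullMeasurableSet F P)
    {E : Finset ι → Set Ω} (hE : ∀ T ⊆ s, NullMeasurableSet (E T) P) {c : ℝ}
    (h : ∀ᵐ ω ∂P, ω ∈ F → c ≤ subsetMean s p (fun T => if ω ∈ E T then 1 else 0)) :
    c * P.real F ≤ subsetMean s p (fun T => P.real (E T)) := by
  have hi : ∀ {A : Set Ω}, NullMeasurableSet A P →
      Integrable (fun ω => if ω ∈ A then (1 : ℝ) else 0) P ∧
        ∫ ω, (if ω ∈ A then (1 : ℝ) else 0) ∂P = P.real A := by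
    intro A hA
    have e : (fun ω => if ω ∈ A then (1 : ℝ) else 0) = A.indicator fun _ => 1 := by
      funext ω; simp [Set.indicator]
    rw [e]
    refine ⟨(integrable_const (1 : ℝ)).indicator₀ hA, ?_⟩
    rw [integral_indicator₀ hA]
    simp
  have h1 : c * P.real F = ∫ ω, c * (if ω ∈ F then (1 : ℝ) else 0) ∂P := by
    rw [integral_const_mul, (hi hF).2]
  have hint : ∀ T ∈ s.powerset, Integrable (fun ω => ((∏ i ∈ T, p i) * ∏ i ∈ s \ T, (1 - p i)) *
      (if ω ∈ E T then (1 : ℝ) else 0)) P := fun T hT =>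
    (hi (hE T (Finset.mem_powerset.1 hT))).1.const_mul _
  have h2 : subsetMean s p (fun T => P.real (E T)) =
      ∫ ω, subsetMean s p (fun T => if ω ∈ E T then 1 else 0) ∂P := by
    simp only [subsetMean]
    rw [integral_finsetSum _ hint]
    refine Finset.sum_congr rfl fun T hT => ?_
    rw [integral_const_mul, (hi (hE T (Finset.mem_powerset.1 hT))).2]
  rw [h1, h2]
  refine integral_mono_ae ((hi hF).1.const_mul c) (integrable_finsetSum _ hint) ?_
  filter_upwards [h] with ω hω
  by_cases hmem : ω ∈ F
  · simpa [hmem] using hω hmem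
  · simp only [hmem, if_false, mul_zero]
    exact Finset.sum_nonneg fun T _ =>
      mul_nonneg (subsetMean_weight_nonneg hp T) (by beta_reduce; split_ifs <;> norm_num)

end subsetMean

/-! ### Boundedness of the range in probability -/

namespace StochasticMeasure

variable {X Ω : Type*} [MeasurableSpace X] [MeasurableSpace Ω] {P : Measure Ω}

/-- The values of the measure on the measurable subsets of `A` are bounded in probability on the
event `W`. -/
def BoundedOn (ν : StochasticMeasure X P) (A : Set X) (W : Set Ω) : Prop :=
  ∀ ε > 0, ∃ C : ℝ, ∀ B, MeasurableSet B → B ⊆ A → P.real (W ∩ {ω | C < |ν.val B ω|}) ≤ ε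

variable [IsFiniteMeasure P] {ν : StochasticMeasure X P}

theorem BoundedOn.mono {A A' : Set X} {W W' : Set Ω} (h : ν.BoundedOn A W) (hA : A' ⊆ A)
    (hW : W' ⊆ W) : ν.BoundedOn A' W' := fun ε hε =>
  let ⟨C, hC⟩ := h ε hε
  ⟨C, fun B hB hBA => (measureReal_mono (Set.inter_subset_inter_left _ hW)).trans
    (hC B hB (hBA.trans hA))⟩

theorem BoundedOn.exists_ge {A : Set X} {W : Set Ω} (h : ν.BoundedOn A W) {ε : ℝ} (hε : 0 < ε)
    (C₀ : ℝ) : ∃ C ≥ C₀, ∀ B, MeasurableSet B → B ⊆ A →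
      P.real (W ∩ {ω | C < |ν.val B ω|}) ≤ ε := by
  obtain ⟨C, hC⟩ := h ε hε
  refine ⟨max C C₀, le_max_right _ _, fun B hB hBA => (measureReal_mono ?_).trans (hC B hB hBA)⟩
  exact Set.inter_subset_inter_right _ fun ω (hω : max C C₀ < _) => lt_of_le_of_lt (le_max_left _ _) hω

theorem BoundedOn.union_event {A : Set X} {W W' : Set Ω} (h : ν.BoundedOn A W)
    (h' : ν.BoundedOn A W') : ν.BoundedOn A (W ∪ W') := by
  intro ε hε
  obtain ⟨C, hC⟩ := h (ε / 2) (by positivity)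
  obtain ⟨C', hCC', hC'⟩ := h'.exists_ge (half_pos hε) C
  refine ⟨C', fun B hB hBA => ?_⟩
  rw [Set.union_inter_distrib_right]
  have : P.real (W ∩ {ω | C' < |ν.val B ω|}) ≤ P.real (W ∩ {ω | C < |ν.val B ω|}) :=
    measureReal_mono <| Set.inter_subset_inter_right _ fun ω (hω : C' < _) => lt_of_le_of_lt hCC' hω
  linarith [measureReal_union_le (μ := P) (W ∩ {ω | C' < |ν.val B ω|})
    (W' ∩ {ω | C' < |ν.val B ω|}), hC B hB hBA, hC' B hB hBA]

theorem BoundedOn.union_set {A A' : Set X} {W : Set Ω} (hA : MeasurableSet A)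
    (h : ν.BoundedOn A W) (h' : ν.BoundedOn A' W) : ν.BoundedOn (A ∪ A') W := by
  intro ε hε
  obtain ⟨C, hC⟩ := h (ε / 2) (by positivity)
  obtain ⟨C', hC'⟩ := h' (ε / 2) (by positivity)
  refine ⟨C + C', fun B hB hBA => ?_⟩
  have h1 := hC (B ∩ A) (hB.inter hA) Set.inter_subset_right
  have h2 := hC' (B \ A) (hB.diff hA) fun x hx => (hBA hx.1).resolve_left hx.2
  refine (measureReal_le_add_of_ae (t := W ∩ {ω | C < |ν.val (B ∩ A) ω|})
    (u := W ∩ {ω | C' < |ν.val (B \ A) ω|}) ?_).trans (by linarith)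
  filter_upwards [ν.val_inter_add_diff hB hA] with ω hω hmem
  by_contra hcon
  rw [not_or] at hcon
  have e1 : |ν.val (B ∩ A) ω| ≤ C := not_lt.1 fun h => hcon.1 ⟨hmem.1, h⟩
  have e2 : |ν.val (B \ A) ω| ≤ C' := not_lt.1 fun h => hcon.2 ⟨hmem.1, h⟩
  have e3 : C + C' < |ν.val B ω| := hmem.2
  rw [hω] at e3
  linarith [abs_add_le (ν.val (B ∩ A) ω) (ν.val (B \ A) ω)]

theorem BoundedOn.iUnion_event {A : Set X} {W : ℕ → Set Ω} (hW : ∀ n, NullMeasurableSet (W n) P)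
    (h : ∀ n, ν.BoundedOn A (W n)) : ν.BoundedOn A (⋃ n, W n) := by
  have hacc : ∀ n, ν.BoundedOn A (Set.accumulate W n) := by
    intro n
    induction n with
    | zero => simpa using h 0
    | succ n ih => rw [Set.accumulate_succ]; exact ih.union_event (h _)
  have haccm : ∀ n, NullMeasurableSet (Set.accumulate W n) P := fun n => by
    unfold Set.accumulate
    exact .iUnion fun i => .iUnion fun _ => hW i
  intro ε hε
  have ht : Tendsto (fun n => P.real (Set.accumulate W n)) atTop (𝓝 (P.real (⋃ n, W n))) :=
    (ENNReal.tendsto_toReal (measure_ne_top _ _)).comp tendsto_measure_iUnion_accumulate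
  obtain ⟨n, hn⟩ := (ht.eventually_const_lt (show P.real (⋃ n, W n) - ε / 2 < _ by linarith)).exists
  obtain ⟨C, hC⟩ := hacc n (ε / 2) (by positivity)
  refine ⟨C, fun B hB hBA => ?_⟩
  have hsub : Set.accumulate W n ⊆ ⋃ n, W n := Set.accumulate_subset_iUnion n
  have hdiff := measureReal_inter_add_sdiff₀ (μ := P) (s := ⋃ n, W n) (haccm n)
  rw [Set.inter_eq_self_of_subset_right hsub] at hdiff
  have : P.real ((⋃ n, W n) ∩ {ω | C < |ν.val B ω|}) ≤
      P.real (Set.accumulate W n ∩ {ω | C < |ν.val B ω|}) +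
        P.real ((⋃ n, W n) \ Set.accumulate W n) := by
    refine measureReal_le_add_of_ae (.of_forall fun ω hω => ?_)
    by_cases h : ω ∈ Set.accumulate W n
    · exact .inl ⟨h, hω.2⟩
    · exact .inr ⟨hω.1, h⟩
  linarith [hC B hB hBA]

/-- There is, up to null sets, a largest event on which the values on the subsets of `A` are bounded
in probability: a countable union of events whose probabilities approach the supremum. -/
theorem exists_maximal_boundedOn (ν : StochasticMeasure X P) (A : Set X) :
    ∃ V : Set Ω, NullMeasurableSet V P ∧ ν.BoundedOn A V ∧
      ∀ W, NullMeasurableSet W P → ν.BoundedOn A W → P.real (W \ V) = 0 := by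
  set S : Set ℝ := {r | ∃ W, NullMeasurableSet W P ∧ ν.BoundedOn A W ∧ P.real W = r} with hS
  have hne : S.Nonempty := ⟨0, ∅, .empty, fun ε hε => ⟨0, fun B _ _ => by simpa using hε.le⟩, by simp⟩
  have hbdd : BddAbove S := ⟨P.real Set.univ, by
    rintro _ ⟨W, -, -, rfl⟩; exact measureReal_mono (Set.subset_univ _)⟩
  obtain ⟨u, -, hu, huS⟩ := exists_seq_tendsto_sSup hne hbdd
  choose W hW hWb hWu using huS
  have hV := BoundedOn.iUnion_event hW hWb
  have hVm : NullMeasurableSet (⋃ n, W n) P := .iUnion hW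
  refine ⟨⋃ n, W n, hVm, hV, fun W' hW' hb => ?_⟩
  have h1 : sSup S ≤ P.real (⋃ n, W n) :=
    le_of_tendsto' hu fun n => hWu n ▸ measureReal_mono (Set.subset_iUnion W n)
  have h2 : P.real (W' ∪ ⋃ n, W n) ≤ sSup S := le_csSup hbdd ⟨_, hW'.union hVm, hb.union_event hV, rfl⟩
  have h3 := measureReal_inter_add_sdiff₀ (μ := P) (s := W' ∪ ⋃ n, W n) hVm
  rw [Set.union_inter_cancel_right, Set.union_sdiff_right] at h3
  exact le_antisymm (by linarith) measureReal_nonneg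

/-- The event on which the measure is nowhere bounded in probability on the subsets of `A`: the
complement of the largest event on which it is bounded. -/
noncomputable def unboundedPart (ν : StochasticMeasure X P) (A : Set X) : Set Ω :=
  (ν.exists_maximal_boundedOn A).chooseᶜ

theorem nullMeasurableSet_unboundedPart (A : Set X) : NullMeasurableSet (ν.unboundedPart A) P :=
  (ν.exists_maximal_boundedOn A).choose_spec.1.compl

theorem boundedOn_compl_unboundedPart (A : Set X) : ν.BoundedOn A (ν.unboundedPart A)ᶜ := by
  rw [unboundedPart, compl_compl]
  exact (ν.exists_maximal_boundedOn A).choose_spec.2.1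

theorem BoundedOn.ae_notMem {A : Set X} {W : Set Ω} (hW : NullMeasurableSet W P)
    (h : ν.BoundedOn A W) : ∀ᵐ ω ∂P, ω ∈ W → ω ∉ ν.unboundedPart A := by
  have := (ν.exists_maximal_boundedOn A).choose_spec.2.2 W hW h
  rw [measureReal_eq_zero_iff] at this
  have h0 : ∀ᵐ ω ∂P, ω ∉ W \ (ν.exists_maximal_boundedOn A).choose :=
    measure_eq_zero_iff_ae_notMem.1 this
  filter_upwards [h0] with ω hω hmem h
  exact hω ⟨hmem, h⟩

theorem unboundedPart_mono {A A' : Set X} (h : A' ⊆ A) :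
    ∀ᵐ ω ∂P, ω ∈ ν.unboundedPart A' → ω ∈ ν.unboundedPart A := by
  have := ((boundedOn_compl_unboundedPart (ν := ν) A).mono h le_rfl).ae_notMem
    (nullMeasurableSet_unboundedPart A).compl
  filter_upwards [this] with ω hω h'
  by_contra hcon
  exact hω hcon h'

theorem unboundedPart_union {A A' : Set X} (hA : MeasurableSet A) :
    ∀ᵐ ω ∂P, ω ∈ ν.unboundedPart (A ∪ A') → ω ∈ ν.unboundedPart A ∨ ω ∈ ν.unboundedPart A' := by
  have h1 := (boundedOn_compl_unboundedPart (ν := ν) A).mono le_rfl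
    (Set.inter_subset_left (t := (ν.unboundedPart A')ᶜ))
  have h2 := (boundedOn_compl_unboundedPart (ν := ν) A').mono le_rfl
    (Set.inter_subset_right (s := (ν.unboundedPart A)ᶜ))
  filter_upwards [(h1.union_set hA h2).ae_notMem ((nullMeasurableSet_unboundedPart A).compl.inter
    (nullMeasurableSet_unboundedPart A').compl)] with ω hω h'
  by_contra hcon
  rw [not_or] at hcon
  exact hω ⟨hcon.1, hcon.2⟩ h'

/-- On the unbounded part, unboundedness in probability is uniform over events of probability at
least `η`. -/
theorem exists_pos_le_of_subset_unboundedPart (ν : StochasticMeasure X P) (A : Set X) {η : ℝ}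
    (hη : 0 < η) : ∃ ε > 0, ∀ W, NullMeasurableSet W P → W ⊆ ν.unboundedPart A → η ≤ P.real W →
      ∀ C : ℝ, ∃ B, MeasurableSet B ∧ B ⊆ A ∧ ε ≤ P.real (W ∩ {ω | C < |ν.val B ω|}) := by
  by_contra! hcon
  choose W hWm hWU hWη C hC using fun k : ℕ => hcon ((1 / 2) ^ k) (by positivity)
  -- a counterexample sequence `W k` leads to the event `⋂ m, T m` of probability at least `η`
  set T : ℕ → Set Ω := fun m => ⋃ k ≥ m, W k with hT
  have hTm : ∀ m, NullMeasurableSet (T m) P := fun m => .iUnion fun k => .iUnion fun _ => hWm k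
  have hTanti : Antitone T := fun m n hmn =>
    Set.biUnion_subset_biUnion_left fun k (hk : n ≤ k) => hmn.trans hk
  have hlim : Tendsto (fun m => P.real (T m)) atTop (𝓝 (P.real (⋂ m, T m))) :=
    (ENNReal.tendsto_toReal (measure_ne_top _ _)).comp
      (tendsto_measure_iInter_atTop hTm hTanti ⟨0, measure_ne_top _ _⟩)
  have hη' : η ≤ P.real (⋂ m, T m) := ge_of_tendsto' hlim fun m =>
    (hWη m).trans (measureReal_mono (Set.subset_biUnion_of_mem (u := W) (show m ≥ m from le_rfl))
      (measure_ne_top _ _))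
  -- but the values on the subsets of `A` are bounded in probability on this event: up to a small
  -- probability it is covered by finitely many `W k`, each with its own bound `C k`
  have hbdd : ν.BoundedOn A (⋂ m, T m) := by
    intro ε hε
    obtain ⟨m, hm⟩ := exists_pow_lt_of_lt_one (show 0 < ε / 4 by positivity)
      (show (1 / 2 : ℝ) < 1 by norm_num)
    set F : ℕ → Set Ω := fun n => ⋃ k ∈ Finset.range n, W (m + k) with hF
    have hFm : ∀ n, NullMeasurableSet (F n) P := fun n =>
      .iUnion fun k => .iUnion fun _ => hWm _
    have hFmono : Monotone F := fun a b hab =>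
      Set.biUnion_subset_biUnion_left fun k hk => Finset.range_mono hab hk
    have hFT : ⋃ n, F n = T m := by
      ext ω
      simp only [hF, hT, Set.mem_iUnion, Finset.mem_range]
      constructor
      · rintro ⟨n, k, -, h⟩
        exact ⟨m + k, by simp, h⟩
      · rintro ⟨k, hk, h⟩
        exact ⟨k - m + 1, k - m, by omega, by rwa [Nat.add_sub_cancel' hk]⟩
    have hlimF : Tendsto (fun n => P.real (F n)) atTop (𝓝 (P.real (T m))) := by
      rw [← hFT]
      exact (ENNReal.tendsto_toReal (measure_ne_top _ _)).comp (tendsto_measure_iUnion_atTop hFmono)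
    obtain ⟨n, hn⟩ :=
      (hlimF.eventually_const_lt (show P.real (T m) - ε / 2 < _ by linarith)).exists
    have hsub : F n ⊆ T m := hFT ▸ Set.subset_iUnion F n
    have hdiff := measureReal_inter_add_sdiff₀ (μ := P) (s := T m) (hFm n) (measure_ne_top _ _)
    rw [Set.inter_eq_self_of_subset_right hsub] at hdiff
    obtain ⟨K, hK⟩ : ∃ K : ℝ, ∀ k ∈ Finset.range n, C (m + k) ≤ K :=
      ((Finset.range n).image fun k => C (m + k)).bddAbove.imp fun K hK k hk =>
        hK (Finset.mem_coe.2 (Finset.mem_image_of_mem _ hk))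
    refine ⟨K, fun B hB hBA => ?_⟩
    have h1 : P.real ((⋂ m, T m) ∩ {ω | K < |ν.val B ω|}) ≤
        P.real (⋃ k ∈ Finset.range n, (W (m + k) ∩ {ω | C (m + k) < |ν.val B ω|})) +
          P.real (T m \ F n) := by
      refine measureReal_le_add_of_ae (.of_forall fun ω hω => ?_)
      by_cases h : ω ∈ F n
      · left
        obtain ⟨k, hk, h⟩ := Set.mem_iUnion₂.1 h
        exact Set.mem_iUnion₂.2 ⟨k, hk, h, lt_of_le_of_lt (hK k hk) hω.2⟩
      · exact .inr ⟨Set.mem_iInter.1 hω.1 m, h⟩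
    have h2 : P.real (⋃ k ∈ Finset.range n, (W (m + k) ∩ {ω | C (m + k) < |ν.val B ω|})) ≤
        ∑ k ∈ Finset.range n, (1 / 2 : ℝ) ^ (m + k) :=
      (measureReal_biUnion_finset_le _ _).trans
        (Finset.sum_le_sum fun k _ => (hC (m + k) B hB hBA).le)
    have h3 : ∑ k ∈ Finset.range n, (1 / 2 : ℝ) ^ (m + k) ≤ (1 / 2) ^ m * 2 := by
      simp only [pow_add, ← Finset.mul_sum]
      gcongr
      rw [geom_sum_eq (by norm_num)]
      have : (0 : ℝ) ≤ (1 / 2) ^ n := by positivity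
      rw [div_le_iff_of_neg (by norm_num)]
      linarith
    linarith
  have hnull := hbdd.ae_notMem (.iInter hTm)
  have : P.real (⋂ m, T m) ≤ P.real ∅ := by
    refine measureReal_le_of_ae ?_
    filter_upwards [hnull] with ω hω h
    obtain ⟨k, -, hk⟩ := Set.mem_iUnion₂.1 (Set.mem_iInter.1 h 0)
    exact (hω h (hWU k hk)).elim
  rw [measureReal_empty] at this
  linarith

/-- A single set makes the measure large on a third of any event of the unbounded part. It is a
random union of the atoms generated by finitely many sets, which together make the measure very
large on most of the event; their number does not depend on the level `C`. -/
theorem exists_third_le_of_subset_unboundedPart (ν : StochasticMeasure X P) {A : Set X}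
    (hA : MeasurableSet A) {W : Set Ω} (hW : NullMeasurableSet W P) (hWU : W ⊆ ν.unboundedPart A)
    (C : ℝ) : ∃ D, MeasurableSet D ∧ D ⊆ A ∧ P.real W / 3 ≤ P.real (W ∩ {ω | C < |ν.val D ω|}) := by
  classical
  wlog hC : 0 ≤ C generalizing C
  · obtain ⟨D, hD, hDA, h⟩ := this 0 le_rfl
    refine ⟨D, hD, hDA, h.trans (measureReal_mono (Set.inter_subset_inter_right _ fun ω hω => ?_))⟩
    exact (not_le.1 hC).trans hω
  rcases (measureReal_nonneg (μ := P) (s := W)).eq_or_lt with h0 | h0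
  · exact ⟨∅, .empty, Set.empty_subset _, by rw [← h0]; simp⟩
  obtain ⟨ε, hε, hbig⟩ := ν.exists_pos_le_of_subset_unboundedPart A (η := P.real W / 3) (by positivity)
  obtain ⟨n, hn⟩ := exists_nat_gt (P.real W / ε)
  rw [div_lt_iff₀ hε] at hn
  -- the `n` sets below generate `2 ^ n` atoms, so that a set of measure larger than `C'` contains an
  -- atom of measure larger than `2 * C`
  set C' : ℝ := 2 ^ n * (2 * C) with hC'
  -- as long as a third of `W` is not covered, a further set covers an event of probability at least
  -- `ε`, which can happen fewer than `n` times
  have greedy : ∀ k : ℕ, ∃ B : ℕ → Set X, (∀ i, MeasurableSet (B i)) ∧ (∀ i, B i ⊆ A) ∧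
      (P.real (W \ ⋃ i ∈ Finset.range k, {ω | C' < |ν.val (B i) ω|}) < P.real W / 3 ∨
        P.real (W \ ⋃ i ∈ Finset.range k, {ω | C' < |ν.val (B i) ω|}) ≤ P.real W - k * ε) := by
    intro k
    induction k with
    | zero => exact ⟨fun _ => ∅, fun _ => .empty, fun _ => Set.empty_subset _, .inr (by simp)⟩
    | succ k ih =>
      obtain ⟨B, hBm, hBA, hB⟩ := ih
      set R := W \ ⋃ i ∈ Finset.range k, {ω | C' < |ν.val (B i) ω|} with hR
      have hRm : NullMeasurableSet R P :=
        hW.diff (.iUnion fun i => .iUnion fun _ => ν.nullMeasurableSet_val (hBm i) C')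
      have hstep : ∀ D : Set X, W \ ⋃ i ∈ Finset.range (k + 1),
          {ω | C' < |ν.val (Function.update B k D i) ω|} = R \ {ω | C' < |ν.val D ω|} := by
        intro D
        have h1 : ⋃ i ∈ Finset.range k, {ω | C' < |ν.val (Function.update B k D i) ω|} =
            ⋃ i ∈ Finset.range k, {ω | C' < |ν.val (B i) ω|} := by
          refine Set.iUnion₂_congr fun i hi => ?_
          rw [Function.update_of_ne (Finset.mem_range.1 hi).ne]
        rw [Finset.range_add_one, Finset.set_biUnion_insert, h1, Function.update_self, hR,
          Set.sdiff_sdiff, Set.union_comm]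
      by_cases hlt : P.real R < P.real W / 3
      · refine ⟨Function.update B k ∅, fun i => ?_, fun i => ?_, .inl ?_⟩
        · rcases eq_or_ne i k with rfl | h
          · simp
          · rw [Function.update_of_ne h]; exact hBm i
        · rcases eq_or_ne i k with rfl | h
          · simp
          · rw [Function.update_of_ne h]; exact hBA i
        · rw [hstep]
          exact (measureReal_mono Set.sdiff_subset).trans_lt hlt
      · have hle := hB.resolve_left hlt
        obtain ⟨D, hDm, hDA, hD⟩ := hbig R hRm (Set.sdiff_subset.trans hWU) (not_lt.1 hlt) C'
        refine ⟨Function.update B k D, fun i => ?_, fun i => ?_, .inr ?_⟩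
        · rcases eq_or_ne i k with rfl | h
          · simpa using hDm
          · rw [Function.update_of_ne h]; exact hBm i
        · rcases eq_or_ne i k with rfl | h
          · simpa using hDA
          · rw [Function.update_of_ne h]; exact hBA i
        · rw [hstep]
          have := measureReal_inter_add_sdiff₀ (μ := P) (s := R) (ν.nullMeasurableSet_val hDm C')
          push_cast
          linarith
  obtain ⟨B, hBm, hBA, hB⟩ := greedy n
  set G := ⋃ i ∈ Finset.range n, {ω | C' < |ν.val (B i) ω|} with hG
  have hGm : NullMeasurableSet G P :=
    .iUnion fun i => .iUnion fun _ => ν.nullMeasurableSet_val (hBm i) C'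
  have hsmall : P.real (W \ G) < P.real W / 3 := by
    refine hB.resolve_right fun h => ?_
    linarith [measureReal_nonneg (μ := P) (s := W \ G)]
  have hlarge : 2 / 3 * P.real W ≤ P.real (W ∩ G) := by
    linarith [measureReal_inter_add_sdiff₀ (μ := P) (s := W) hGm]
  -- the fibres of `h` are the atoms
  set h : X → (Fin n → Bool) := fun x i => decide (x ∈ B i) with hh
  have hhm : ∀ t, MeasurableSet (h ⁻¹' {t}) := by
    intro t
    have : h ⁻¹' {t} = ⋂ i : Fin n, {x | decide (x ∈ B i) = t i} := by
      ext x
      simp [hh, funext_iff]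
    rw [this]
    refine .iInter fun i => ?_
    cases t i
    · have : {x | decide (x ∈ B i) = false} = (B i)ᶜ := by ext; simp
      exact this ▸ (hBm i).compl
    · simpa using hBm i
  have hTm : ∀ T : Finset (Fin n → Bool), MeasurableSet (A ∩ h ⁻¹' (T : Set (Fin n → Bool))) := by
    intro T
    rw [← Set.biUnion_preimage_singleton]
    exact hA.inter (T.measurableSet_biUnion fun i _ => hhm i)
  have hp : ∀ i : Fin n → Bool, 0 ≤ (fun _ : Fin n → Bool => (1 / 2 : ℝ)) i ∧
    (fun _ : Fin n → Bool => (1 / 2 : ℝ)) i ≤ 1 := fun i => by norm_num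
  have havg := mul_measureReal_le_subsetMean (P := P) (s := Finset.univ) (c := 1 / 2) hp
    (hW.inter hGm)
    (E := fun T => W ∩ {ω | C < |ν.val (A ∩ h ⁻¹' (T : Set (Fin n → Bool))) ω|})
    (fun T _ => hW.inter (ν.nullMeasurableSet_val (hTm T) C)) (by
      filter_upwards [ν.val_inter_preimage_forall hA h hhm Finset.univ] with ω hω hmem
      obtain ⟨i, hi, hlt⟩ := Set.mem_iUnion₂.1 hmem.2
      rw [Finset.mem_range] at hi
      obtain ⟨t, ht⟩ : ∃ t, 2 * C < |ν.val (A ∩ h ⁻¹' {t}) ω| := by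
        by_contra! hcon
        have hBi : B i = A ∩ h ⁻¹' ((Finset.univ.filter fun t : Fin n → Bool => t ⟨i, hi⟩ = true :
            Finset (Fin n → Bool)) : Set (Fin n → Bool)) := by
          ext x
          simp only [hh, Finset.coe_filter, Finset.mem_univ, true_and, Set.mem_inter_iff,
            Set.mem_preimage, Set.mem_ofPred_eq, decide_eq_true_eq]
          exact ⟨fun hx => ⟨hBA i hx, hx⟩, fun hx => hx.2⟩
        have hlt' : C' < |ν.val (B i) ω| := hlt
        rw [hBi, hω _ (Finset.subset_univ _)] at hlt'
        have h1 : |∑ t ∈ Finset.univ.filter (fun t : Fin n → Bool => t ⟨i, hi⟩ = true),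
            ν.val (A ∩ h ⁻¹' {t}) ω| ≤ ∑ _t : Fin n → Bool, 2 * C :=
          (Finset.abs_sum_le_sum_abs _ _).trans <|
            (Finset.sum_le_sum fun t _ => hcon t).trans <|
              Finset.sum_le_sum_of_subset_of_nonneg (Finset.subset_univ _) fun _ _ _ => by linarith
        simp at h1
        linarith
      -- given the selection of the other atoms, at least one of selecting `t` or not succeeds
      have := le_subsetMean_lt_abs_sum (s := Finset.univ) (C := C)
        (a := fun t => ν.val (A ∩ h ⁻¹' {t}) ω) (θ := 1 / 2) (m := 1 / 2)
        (by norm_num) (by norm_num) (B := {t}) (Finset.subset_univ _) (by simpa using ht)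
        (by norm_num) (by norm_num)
      refine this.trans (le_of_eq (subsetMean_congr fun T hT => ?_))
      rw [← hω T hT]
      simp [hmem.1])
  obtain ⟨T, -, hT⟩ := exists_le_of_le_subsetMean hp havg
  exact ⟨_, hTm T, Set.inter_subset_left, by linarith⟩

end StochasticMeasure

theorem exists_measureReal_lt_abs_lt {Ω : Type*} [MeasurableSpace Ω] {P : Measure Ω}
    [IsFiniteMeasure P] {ξ : Ω → ℝ} (hξ : AEMeasurable ξ P) {ε : ℝ} (hε : 0 < ε) :
    ∃ K : ℝ, 0 ≤ K ∧ P.real {ω | K < |ξ ω|} < ε := by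
  have hlim : Tendsto (fun n : ℕ => P.real {ω | (n : ℝ) < |ξ ω|}) atTop
      (𝓝 (P.real (⋂ n : ℕ, {ω | (n : ℝ) < |ξ ω|}))) :=
    (ENNReal.tendsto_toReal (measure_ne_top _ _)).comp <| tendsto_measure_iInter_atTop
      (fun n => nullMeasurableSet_lt aemeasurable_const hξ.abs)
      (fun m n hmn ω (hω : (n : ℝ) < _) => lt_of_le_of_lt (Nat.cast_le.2 hmn) hω)
      ⟨0, measure_ne_top _ _⟩
  have h0 : ⋂ n : ℕ, {ω | (n : ℝ) < |ξ ω|} = ∅ := by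
    rw [Set.eq_empty_iff_forall_notMem]
    intro ω hω
    obtain ⟨n, hn⟩ := exists_nat_gt |ξ ω|
    exact lt_asymm hn (Set.mem_iInter.1 hω n)
  rw [h0, measureReal_empty] at hlim
  obtain ⟨n, hn⟩ := (hlim.eventually_lt_const hε).exists
  exact ⟨n, n.cast_nonneg, hn⟩

namespace StochasticMeasure

variable {X Ω : Type*} [MeasurableSpace X] [MeasurableSpace Ω] {P : Measure Ω}

section Finite

variable [IsFiniteMeasure P]

/-- Where the measure is unbounded on `R`, it is unbounded on one of the pieces of a finite
partition of `R`. -/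
theorem unboundedPart_subset_iUnion {ι : Type*} [Fintype ι] (ν : StochasticMeasure X P) {R : Set X}
    (hR : MeasurableSet R) (h : X → ι) (hh : ∀ i, MeasurableSet (h ⁻¹' {i})) :
    ∀ᵐ ω ∂P, ω ∈ ν.unboundedPart R → ∃ i, ω ∈ ν.unboundedPart (R ∩ h ⁻¹' {i}) := by
  classical
  have key : ∀ s : Finset ι, ∀ᵐ ω ∂P, ω ∈ ν.unboundedPart (⋃ i ∈ s, R ∩ h ⁻¹' {i}) →
      ∃ i, ω ∈ ν.unboundedPart (R ∩ h ⁻¹' {i}) := by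
    intro s
    induction s using Finset.induction_on with
    | empty =>
      have : ν.BoundedOn ∅ Set.univ := fun ε hε => ⟨0, fun B _ hB => by
        rw [Set.subset_empty_iff.1 hB]
        refine (measureReal_le_of_ae (t := ∅) ?_).trans (by simpa using hε.le)
        filter_upwards [ν.val_empty] with ω hω h
        have h' : 0 < |ν.val ∅ ω| := h.2
        simp [hω] at h'⟩
      filter_upwards [this.ae_notMem .univ] with ω hω h'
      simp only [Finset.notMem_empty, Set.iUnion_of_empty, Set.iUnion_empty] at h'
      exact (hω trivial h').elim
    | insert i s hi ih =>
      rw [Finset.set_biUnion_insert]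
      filter_upwards [ih, ν.unboundedPart_union (A' := ⋃ i ∈ s, R ∩ h ⁻¹' {i})
        (hR.inter (hh i))] with ω h1 h2 h3
      exact (h2 h3).elim (fun h => ⟨i, h⟩) h1
  have : ⋃ i ∈ (Finset.univ : Finset ι), R ∩ h ⁻¹' {i} = R := by
    ext x; simp
  have hkey := key Finset.univ
  rwa [this] at hkey

/-- One set can be chosen in each `A i` such that, on a third of any part of the union of the unbounded
parts, at least one of these sets has large measure. -/
theorem exists_forall_third_le {ι : Type*} [DecidableEq ι] (ν : StochasticMeasure X P)
    {A : ι → Set X} (hA : ∀ i, MeasurableSet (A i)) (C : ℝ) (s : Finset ι) :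
    ∀ W, NullMeasurableSet W P → W ⊆ ⋃ i ∈ s, ν.unboundedPart (A i) →
      ∃ D : ι → Set X, (∀ i, MeasurableSet (D i)) ∧ (∀ i, D i ⊆ A i) ∧
        P.real W / 3 ≤ P.real (W ∩ ⋃ i ∈ s, {ω | C < |ν.val (D i) ω|}) := by
  induction s using Finset.induction_on with
  | empty =>
    intro W hW hWs
    have : W = ∅ := by simpa [Set.subset_empty_iff] using hWs
    exact ⟨fun _ => ∅, fun _ => .empty, fun _ => Set.empty_subset _, by simp [this]⟩
  | insert i s hi ih =>
    intro W hW hWs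
    rw [Finset.set_biUnion_insert] at hWs
    set U := ν.unboundedPart (A i) with hU
    have hUm : NullMeasurableSet U P := nullMeasurableSet_unboundedPart _
    obtain ⟨D, hDm, hDA, hD⟩ := ih (W \ U) (hW.diff hUm)
      fun ω hω => (hWs hω.1).resolve_left hω.2
    obtain ⟨E, hEm, hEA, hE⟩ := ν.exists_third_le_of_subset_unboundedPart (hA i)
      (hW.inter hUm) Set.inter_subset_right C
    refine ⟨Function.update D i E, fun j => ?_, fun j => ?_, ?_⟩
    · rcases eq_or_ne j i with rfl | h
      · simpa using hEm
      · rw [Function.update_of_ne h]; exact hDm j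
    · rcases eq_or_ne j i with rfl | h
      · simpa using hEA
      · rw [Function.update_of_ne h]; exact hDA j
    · have h1 : ⋃ j ∈ s, {ω | C < |ν.val (Function.update D i E j) ω|} =
          ⋃ j ∈ s, {ω | C < |ν.val (D j) ω|} := by
        refine Set.iUnion₂_congr fun j hj => ?_
        rw [Function.update_of_ne (ne_of_mem_of_not_mem hj hi)]
      rw [Finset.set_biUnion_insert, h1, Function.update_self]
      have h2 := measureReal_inter_add_sdiff₀ (μ := P) (s := W) hUm
      have h3 := measureReal_inter_add_sdiff₀ (μ := P)
        (s := W ∩ ({ω | C < |ν.val E ω|} ∪ ⋃ j ∈ s, {ω | C < |ν.val (D j) ω|})) hUm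
      have h4 : P.real (W ∩ U ∩ {ω | C < |ν.val E ω|}) ≤
          P.real (W ∩ ({ω | C < |ν.val E ω|} ∪ ⋃ j ∈ s, {ω | C < |ν.val (D j) ω|}) ∩ U) :=
        measureReal_mono fun ω h => ⟨⟨h.1.1, .inl h.2⟩, h.1.2⟩
      have h5 : P.real ((W \ U) ∩ ⋃ j ∈ s, {ω | C < |ν.val (D j) ω|}) ≤
          P.real ((W ∩ ({ω | C < |ν.val E ω|} ∪ ⋃ j ∈ s, {ω | C < |ν.val (D j) ω|})) \ U) :=
        measureReal_mono fun ω h => ⟨⟨h.1.1, .inr h.2⟩, h.1.2⟩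
      linarith

/-- Repeated splitting: after `T` rounds there is a finite partition of `R` in which the number of
pieces of measure larger than `τ` dominates a random variable `G ≤ T` of mean at least a quarter of
`T` times the probability of the unbounded part. In each round every piece is split by a set of very
large measure; where such a piece exists, both of its parts are large, and elsewhere a large piece
leaves at least one part that is half as large. -/
theorem exists_partition_mean_le (ν : StochasticMeasure X P) {R : Set X} (hR : MeasurableSet R)
    (T : ℕ) : ∀ τ : ℝ, 0 < τ → ∃ (ι : Type) (_ : Fintype ι) (h : X → ι) (G : Ω → ℝ),
      (∀ i, MeasurableSet (h ⁻¹' {i})) ∧ MeasureTheory.Integrable G P ∧ (∀ ω, G ω ≤ T) ∧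
      (∀ᵐ ω ∂P, G ω ≤ ∑ i, if τ < |ν.val (R ∩ h ⁻¹' {i}) ω| then 1 else 0) ∧
      T * (P.real (ν.unboundedPart R) / 4) ≤ ∫ ω, G ω ∂P := by
  classical
  induction T with
  | zero =>
    intro τ hτ
    refine ⟨Unit, inferInstance, fun _ => (), fun _ => 0, fun _ => measurable_const trivial,
      integrable_zero _ _ _, fun _ => by simp, .of_forall fun ω => ?_, by simp⟩
    positivity
  | succ T ih =>
    intro τ hτ
    obtain ⟨ι, _, h, G, hh, hGi, hGT, hGle, hGint⟩ := ih (2 * τ) (by positivity)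
    set u := P.real (ν.unboundedPart R) with hu
    rcases (measureReal_nonneg (μ := P) (s := ν.unboundedPart R)).eq_or_lt with h0 | h0
    · refine ⟨ι, inferInstance, h, G, hh, hGi, fun ω => (hGT ω).trans (by simp), ?_, ?_⟩
      · filter_upwards [hGle] with ω hω
        refine hω.trans (Finset.sum_le_sum fun i _ => ?_)
        split_ifs with h1 h2
        · rfl
        · linarith
        · norm_num
        · rfl
      · rw [← hu] at h0
        rw [← h0] at hGint ⊢
        simpa using hGint
    have hRi : ∀ i, MeasurableSet (R ∩ h ⁻¹' {i}) := fun i => hR.inter (hh i)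
    set ξ : Ω → ℝ := fun ω => ∑ i, |ν.val (R ∩ h ⁻¹' {i}) ω| with hξ
    have hξm : AEMeasurable ξ P :=
      Finset.aemeasurable_fun_sum _ fun i _ => (ν.aemeasurable _ (hRi i)).abs
    obtain ⟨K, hK0, hK⟩ := exists_measureReal_lt_abs_lt hξm (show 0 < u / 12 by positivity)
    set W := ν.unboundedPart R ∩ ⋃ i ∈ Finset.univ, ν.unboundedPart (R ∩ h ⁻¹' {i}) with hW
    have hWm : NullMeasurableSet W P := (nullMeasurableSet_unboundedPart _).inter
      (.iUnion fun i => .iUnion fun _ => nullMeasurableSet_unboundedPart _)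
    have hWu : u ≤ P.real W := by
      refine measureReal_le_of_ae ?_
      filter_upwards [ν.unboundedPart_subset_iUnion hR h hh] with ω hω hmem
      obtain ⟨i, hi⟩ := hω hmem
      exact ⟨hmem, Set.mem_iUnion₂.2 ⟨i, Finset.mem_univ i, hi⟩⟩
    obtain ⟨D, hDm, hDR, hD⟩ := ν.exists_forall_third_le hRi (K + τ) Finset.univ W hWm
      Set.inter_subset_right
    -- here all the pieces have measure at most `K`, but some `D i` has measure larger than `K + τ`, so
    -- that `D i` and the rest of its piece are both larger than `τ`
    set good : Set Ω := (W ∩ ⋃ i ∈ Finset.univ, {ω | K + τ < |ν.val (D i) ω|}) \ {ω | K < |ξ ω|}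
      with hgood
    have hgoodm : NullMeasurableSet good P := (hWm.inter (.iUnion fun i => .iUnion fun _ =>
      ν.nullMeasurableSet_val (hDm i) _)).diff (nullMeasurableSet_lt aemeasurable_const hξm.abs)
    have hgoodP : u / 4 ≤ P.real good := by
      have := measureReal_le_add_of_ae (P := P) (t := good) (u := {ω | K < |ξ ω|})
        (s := W ∩ ⋃ i ∈ Finset.univ, {ω | K + τ < |ν.val (D i) ω|}) (.of_forall fun ω hω => by
          by_cases h : ω ∈ {ω | K < |ξ ω|}
          · exact .inr h
          · exact .inl ⟨hω, h⟩)
      linarith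
    -- the refined partition into the sets `D i` and the rest of each piece
    set h' : X → ι × Bool := fun x => (h x, decide (x ∈ D (h x))) with hh'
    have htrue : ∀ i, R ∩ h' ⁻¹' {(i, true)} = D i := by
      intro i
      ext x
      simp only [hh', Set.mem_inter_iff, Set.mem_preimage, Set.mem_singleton_iff, Prod.mk.injEq,
        decide_eq_true_eq]
      constructor
      · rintro ⟨-, rfl, hx⟩; exact hx
      · intro hx
        obtain ⟨hx1, hx2 : h x = i⟩ := hDR i hx
        exact ⟨hx1, hx2, hx2 ▸ hx⟩
    have hfalse : ∀ i, R ∩ h' ⁻¹' {(i, false)} = (R ∩ h ⁻¹' {i}) \ D i := by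
      intro i
      ext x
      simp only [hh', Set.mem_inter_iff, Set.mem_preimage, Set.mem_singleton_iff, Prod.mk.injEq,
        decide_eq_false_iff_not, Set.mem_sdiff]
      constructor
      · rintro ⟨h1, rfl, hx⟩; exact ⟨⟨h1, rfl⟩, hx⟩
      · rintro ⟨⟨h1, rfl⟩, hx⟩; exact ⟨h1, rfl, hx⟩
    have hh'm : ∀ p, MeasurableSet (h' ⁻¹' {p}) := by
      rintro ⟨i, b⟩
      have : h' ⁻¹' {(i, b)} = h ⁻¹' {i} ∩ {x | decide (x ∈ D i) = b} := by
        ext x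
        simp only [hh', Set.mem_inter_iff, Set.mem_preimage, Set.mem_singleton_iff, Prod.mk.injEq,
          Set.mem_ofPred_eq]
        constructor <;> rintro ⟨rfl, h⟩ <;> exact ⟨rfl, h⟩
      rw [this]
      refine (hh i).inter ?_
      cases b
      · have : {x | decide (x ∈ D i) = false} = (D i)ᶜ := by ext; simp
        exact this ▸ (hDm i).compl
      · have : {x | decide (x ∈ D i) = true} = D i := by ext; simp
        rw [this]; exact hDm i
    refine ⟨ι × Bool, inferInstance, h', fun ω => G ω + good.indicator (fun _ => 1) ω, hh'm,
      hGi.add ((integrable_const _).indicator₀ hgoodm), fun ω => ?_, ?_, ?_⟩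
    · push_cast
      exact add_le_add (hGT ω) (Set.indicator_le_self' (fun _ _ => zero_le_one) ω)
    · filter_upwards [hGle, ae_all_iff.2 fun i => ν.val_inter_add_diff (hRi i) (hDm i)]
        with ω hω hadd
      rw [Fintype.sum_prod_type]
      simp only [Fintype.sum_bool, htrue, hfalse]
      have hadd' : ∀ i, ν.val (R ∩ h ⁻¹' {i}) ω =
          ν.val (D i) ω + ν.val ((R ∩ h ⁻¹' {i}) \ D i) ω := fun i => by
        rw [hadd i, Set.inter_eq_self_of_subset_right (hDR i)]
      have hpt : ∀ i, (if 2 * τ < |ν.val (R ∩ h ⁻¹' {i}) ω| then (1 : ℝ) else 0) ≤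
          (if τ < |ν.val (D i) ω| then 1 else 0) +
            (if τ < |ν.val ((R ∩ h ⁻¹' {i}) \ D i) ω| then 1 else 0) := by
        intro i
        have := abs_add_le (ν.val (D i) ω) (ν.val ((R ∩ h ⁻¹' {i}) \ D i) ω)
        rw [← hadd' i] at this
        split_ifs <;> linarith
      by_cases hg : ω ∈ good
      · rw [Set.indicator_of_mem hg]
        obtain ⟨⟨-, hmem⟩, hξK⟩ := hg
        obtain ⟨i₀, -, hi₀⟩ := Set.mem_iUnion₂.1 hmem
        have hi₀' : K + τ < |ν.val (D i₀) ω| := hi₀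
        have hξK' : |ξ ω| ≤ K := not_lt.1 hξK
        have hRK : |ν.val (R ∩ h ⁻¹' {i₀}) ω| ≤ K :=
          (Finset.single_le_sum (f := fun i => |ν.val (R ∩ h ⁻¹' {i}) ω|)
            (fun i _ => abs_nonneg _) (Finset.mem_univ i₀)).trans ((le_abs_self _).trans hξK')
        have h2 : τ < |ν.val ((R ∩ h ⁻¹' {i₀}) \ D i₀) ω| := by
          have := abs_sub (ν.val (R ∩ h ⁻¹' {i₀}) ω) (ν.val ((R ∩ h ⁻¹' {i₀}) \ D i₀) ω)
          rw [hadd' i₀, add_sub_cancel_right, ← hadd' i₀] at this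
          linarith
        have h1 : τ < |ν.val (D i₀) ω| := by linarith
        calc G ω + 1 ≤ ∑ i, ((if 2 * τ < |ν.val (R ∩ h ⁻¹' {i}) ω| then (1 : ℝ) else 0) +
              if i = i₀ then 1 else 0) := by
              rw [Finset.sum_add_distrib, Finset.sum_ite_eq' Finset.univ i₀]
              simpa using hω
          _ ≤ _ := by
              refine Finset.sum_le_sum fun i _ => ?_
              by_cases hi : i = i₀
              · subst hi
                rw [if_pos h1, if_pos h2, if_pos rfl]
                split_ifs <;> norm_num
              · rw [if_neg hi, add_zero]
                exact hpt i
      · rw [Set.indicator_of_notMem hg, add_zero]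
        exact hω.trans (Finset.sum_le_sum fun i _ => hpt i)
    · rw [integral_add hGi ((integrable_const _).indicator₀ hgoodm), integral_indicator₀ hgoodm]
      simp only [integral_const, MeasurableSet.univ, measureReal_restrict_apply, Set.univ_inter,
        smul_eq_mul, mul_one]
      push_cast
      linarith

end Finite

variable [IsProbabilityMeasure P]

/-- With probability bounded below, a suitable finite partition of `R` has at least `N` pieces of
measure larger than `τ`. -/
theorem exists_partition_count_le (ν : StochasticMeasure X P) {R : Set X} (hR : MeasurableSet R)
    {u τ : ℝ} (hu : 0 < u) (huR : u ≤ P.real (ν.unboundedPart R)) (hτ : 0 < τ) (N : ℕ) :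
    ∃ (ι : Type) (_ : Fintype ι) (h : X → ι), (∀ i, MeasurableSet (h ⁻¹' {i})) ∧
      u / 8 ≤ P.real {ω | (N : ℝ) ≤ ∑ i, if τ < |ν.val (R ∩ h ⁻¹' {i}) ω| then (1 : ℝ) else 0} := by
  obtain ⟨T, hT⟩ := exists_nat_gt (8 * N / u)
  rw [div_lt_iff₀ hu] at hT
  obtain ⟨ι, _, h, G, hh, hGi, hGT, hGle, hGint⟩ := ν.exists_partition_mean_le hR T τ hτ
  refine ⟨ι, inferInstance, h, hh, ?_⟩
  have hT0 : (0 : ℝ) < T := by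
    by_contra! hcon
    have : (0 : ℝ) ≤ N := N.cast_nonneg
    nlinarith
  set E : Set Ω := {ω | T * u / 8 < G ω} with hE
  have hEm : NullMeasurableSet E P := nullMeasurableSet_lt aemeasurable_const hGi.aemeasurable
  have h1 : ∫ ω, G ω ∂P ≤ ∫ ω, (T * u / 8 + T * E.indicator (fun _ => 1) ω) ∂P := by
    refine integral_mono hGi ((integrable_const _).add
      (((integrable_const _).indicator₀ hEm).const_mul _)) fun ω => ?_
    by_cases hω : ω ∈ E
    · rw [Set.indicator_of_mem hω]
      have : 0 ≤ T * u / 8 := by positivity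
      linarith [hGT ω]
    · rw [Set.indicator_of_notMem hω]
      have : G ω ≤ T * u / 8 := not_lt.1 hω
      linarith
  rw [integral_add (integrable_const _) (((integrable_const _).indicator₀ hEm).const_mul _),
    integral_const_mul, integral_indicator₀ hEm] at h1
  simp only [integral_const, MeasurableSet.univ, measureReal_restrict_apply, Set.univ_inter,
    smul_eq_mul, mul_one, probReal_univ, one_mul] at h1
  have h2 : u / 8 ≤ P.real E := by
    have h3 : T * (u / 4) ≤ T * (P.real (ν.unboundedPart R) / 4) := by gcongr
    have h4 : T * (u / 8) ≤ T * P.real E := by linarith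
    exact le_of_mul_le_mul_left h4 hT0
  refine h2.trans (measureReal_le_of_ae ?_)
  filter_upwards [hGle] with ω hω hmem
  have h5 : T * u / 8 < G ω := hmem
  exact le_trans (by linarith) (h5.le.trans hω)

theorem quarter_le_one_sub_inv_pow {M : ℕ} (hM : 0 < M) :
    (1 / 4 : ℝ) ≤ (1 - 1 / (2 * M : ℝ)) ^ (2 * M) := by
  have hM' : (1 : ℝ) ≤ M := by exact_mod_cast hM
  have h := one_add_mul_le_pow (a := -(1 / (2 * M : ℝ))) (n := M) (by
    have : 1 / (2 * M : ℝ) ≤ 1 := by rw [div_le_one (by positivity)]; linarith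
    linarith)
  have h2 : 1 + M * -(1 / (2 * M : ℝ)) = 1 / 2 := by field_simp; norm_num
  rw [h2, ← sub_eq_add_neg] at h
  rw [mul_comm 2 M, pow_mul]
  nlinarith

/-- A subset of `R` whose measure is large with probability bounded below can be removed from `R`
at an arbitrarily small cost in the unbounded part: remove a random selection of a small proportion
`θ` of the pieces of a partition in which there are about `1 / θ` large pieces. -/
theorem exists_large_subset_unboundedPart_diff (ν : StochasticMeasure X P) {R : Set X}
    (hR : MeasurableSet R) {u ε : ℝ} (hu : 0 < u) (huR : u ≤ P.real (ν.unboundedPart R))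
    (hε : 0 < ε) : ∃ D, MeasurableSet D ∧ D ⊆ R ∧ u / 64 ≤ P.real {ω | 1 < |ν.val D ω|} ∧
      P.real (ν.unboundedPart R) - ε ≤ P.real (ν.unboundedPart (R \ D)) := by
  classical
  set U := P.real (ν.unboundedPart R) with hU
  have hU1 : U ≤ 1 := measureReal_le_one
  obtain ⟨M, hM⟩ := exists_nat_gt (max (128 / (u * ε)) (2 / ε))
  have hMa : 128 < M * (u * ε) := (div_lt_iff₀ (by positivity)).1 ((le_max_left _ _).trans_lt hM)
  have hMb : 2 < M * ε := (div_lt_iff₀ hε).1 ((le_max_right _ _).trans_lt hM)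
  have hM0 : 0 < M := by
    rcases Nat.eq_zero_or_pos M with rfl | h
    · norm_num at hMb
    · exact h
  have hM1 : (1 : ℝ) ≤ M := by exact_mod_cast hM0
  obtain ⟨ι, _, h, hh, hcount⟩ := ν.exists_partition_count_le hR hu huR
    (show (0 : ℝ) < 2 * 1 by norm_num) (2 * M)
  set F : Set Ω := {ω | ((2 * M : ℕ) : ℝ) ≤
    ∑ i, if 2 * 1 < |ν.val (R ∩ h ⁻¹' {i}) ω| then (1 : ℝ) else 0} with hF
  have hRi : ∀ i, MeasurableSet (R ∩ h ⁻¹' {i}) := fun i => hR.inter (hh i)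
  have hFm : NullMeasurableSet F P := by
    refine nullMeasurableSet_le aemeasurable_const
      (Finset.aemeasurable_fun_sum _ fun i _ => ?_)
    have : (fun ω => if 2 * 1 < |ν.val (R ∩ h ⁻¹' {i}) ω| then (1 : ℝ) else 0) =
        {ω | 2 * 1 < |ν.val (R ∩ h ⁻¹' {i}) ω|}.indicator fun _ => 1 := by
      funext ω; simp [Set.indicator]
    rw [this]
    exact aemeasurable_const.indicator₀ (ν.nullMeasurableSet_val (hRi i) _)
  set D : Finset ι → Set X := fun T => R ∩ h ⁻¹' (T : Set ι) with hD
  have hDm : ∀ T, MeasurableSet (D T) := by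
    intro T
    simp only [hD]
    rw [← Set.biUnion_preimage_singleton]
    exact hR.inter (T.measurableSet_biUnion fun i _ => hh i)
  -- with this proportion, selecting none and selecting exactly one of `2 * M` given pieces both have
  -- probability at least `1 / 4`
  set θ : ℝ := 1 / (2 * M : ℝ) with hθ
  have hθ0 : 0 ≤ θ := by positivity
  have hθ1 : θ ≤ 1 := by rw [hθ, div_le_one (by positivity)]; linarith
  have hp : ∀ i : ι, 0 ≤ (fun _ : ι => θ) i ∧ (fun _ : ι => θ) i ≤ 1 := fun i => ⟨hθ0, hθ1⟩
  have hq : 1 / 4 ≤ (1 - θ) ^ (2 * M) := quarter_le_one_sub_inv_pow hM0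
  have hq' : 1 / 4 ≤ ((2 * M : ℕ) : ℝ) * (θ * (1 - θ) ^ (2 * M - 1)) := by
    have e : ((2 * M : ℕ) : ℝ) * θ = 1 := by rw [hθ]; push_cast; field_simp
    rw [← mul_assoc, e, one_mul]
    exact hq.trans (pow_le_pow_of_le_one (by linarith) (by linarith) (Nat.sub_le _ _))
  have hlarge := mul_measureReal_le_subsetMean (P := P) (s := Finset.univ) (c := 1 / 4) hp hFm
    (E := fun T => {ω | 1 < |ν.val (D T) ω|}) (fun T _ => ν.nullMeasurableSet_val (hDm T) 1) (by
      filter_upwards [ν.val_inter_preimage_forall hR h hh Finset.univ] with ω hω hmem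
      have hmem' : ((2 * M : ℕ) : ℝ) ≤
        ∑ i, if 2 * 1 < |ν.val (R ∩ h ⁻¹' {i}) ω| then (1 : ℝ) else 0 := hmem
      rw [Finset.sum_boole] at hmem'
      obtain ⟨B, hBs, hBc⟩ := Finset.exists_subset_card_eq (Nat.cast_le.1 hmem')
      have := le_subsetMean_lt_abs_sum (s := Finset.univ) (C := 1)
        (a := fun i => ν.val (R ∩ h ⁻¹' {i}) ω) hθ0 hθ1 (B := B) (m := 1 / 4)
        (Finset.subset_univ _) (fun i hi => (Finset.mem_filter.1 (hBs hi)).2)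
        (by rw [hBc]; exact hq) (by rw [hBc]; exact hq')
      refine this.trans (le_of_eq (subsetMean_congr fun T hT => ?_))
      simp only [hD, hω T hT])
  have hkeep := mul_measureReal_le_subsetMean (P := P) (s := Finset.univ) (c := 1 - θ) hp
    (nullMeasurableSet_unboundedPart (ν := ν) R)
    (E := fun T => ν.unboundedPart (R \ D T))
    (fun T _ => nullMeasurableSet_unboundedPart _) (by
      have hmono : ∀ i, ∀ T : Finset ι, i ∉ T → ∀ᵐ ω ∂P, ω ∈ ν.unboundedPart (R ∩ h ⁻¹' {i}) →
          ω ∈ ν.unboundedPart (R \ D T) := by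
        intro i T hi
        refine unboundedPart_mono ?_
        rintro x ⟨hx, hxi : h x = i⟩
        exact ⟨hx, fun hx' => hi (hxi ▸ hx'.2)⟩
      have hmono' : ∀ᵐ ω ∂P, ∀ i, ∀ T : Finset ι, i ∉ T → ω ∈ ν.unboundedPart (R ∩ h ⁻¹' {i}) →
          ω ∈ ν.unboundedPart (R \ D T) := by
        simp only [ae_all_iff]
        exact hmono
      filter_upwards [ν.unboundedPart_subset_iUnion hR h hh, hmono'] with ω h1 h2 hmem
      obtain ⟨i, hi⟩ := h1 hmem
      rw [← subsetMean_notMem (p := fun _ => θ) (Finset.mem_univ i)]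
      refine subsetMean_mono hp fun T _ => ?_
      by_cases hiT : i ∈ T
      · rw [if_pos hiT]; split_ifs <;> norm_num
      · rw [if_neg hiT, if_pos (h2 i T hiT hi)])
  -- one selection has to serve both purposes, so a weighted sum is averaged; since the first
  -- probability is at most `1`, the weight `2 / ε` forces the loss in the second one to be below `ε`
  have hmean : u / 32 + 2 / ε * ((1 - θ) * U) ≤ subsetMean Finset.univ (fun _ : ι => θ) fun T =>
      P.real {ω | 1 < |ν.val (D T) ω|} + 2 / ε * P.real (ν.unboundedPart (R \ D T)) := by
    rw [subsetMean_add, subsetMean_const_mul]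
    have h2 : 2 / ε * ((1 - θ) * U) ≤ 2 / ε * subsetMean Finset.univ (fun _ => θ)
      (fun T => P.real (ν.unboundedPart (R \ D T))) := by gcongr
    linarith
  obtain ⟨T, -, hT⟩ := exists_le_of_le_subsetMean hp hmean
  have hmonoU : P.real (ν.unboundedPart (R \ D T)) ≤ U :=
    measureReal_le_of_ae (unboundedPart_mono Set.sdiff_subset)
  have hone : P.real {ω | 1 < |ν.val (D T) ω|} ≤ 1 := measureReal_le_one
  have hMθ : M * θ = 1 / 2 := by rw [hθ]; field_simp
  have hθε : θ ≤ ε / 4 := by nlinarith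
  have hθu : θ ≤ u * ε / 256 := by nlinarith
  have e1 : 2 / ε * ((1 - θ) * U) = 2 / ε * U - 2 / ε * θ * U := by ring
  have e2 : 2 / ε * θ * U ≤ 2 / ε * (u * ε / 256) * 1 := by gcongr
  have e3 : 2 / ε * (u * ε / 256) * 1 = u / 128 := by field_simp; norm_num
  refine ⟨D T, hDm T, Set.inter_subset_left, ?_, ?_⟩
  · have : 2 / ε * P.real (ν.unboundedPart (R \ D T)) ≤ 2 / ε * U := by gcongr
    linarith
  · have e4 : 2 / ε * (U - ε) = 2 / ε * U - 2 := by field_simp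
    have : 2 / ε * (U - ε) ≤ 2 / ε * P.real (ν.unboundedPart (R \ D T)) := by linarith
    exact le_of_mul_le_mul_left this (by positivity)

/-- The range of a stochastic measure is bounded in probability. If it were not, disjoint sets of
measure larger than `1` could be removed successively, each at a negligible cost in the unbounded
part, which contradicts exhaustivity. -/
theorem boundedOn_univ (ν : StochasticMeasure X P) : ν.BoundedOn Set.univ Set.univ := by
  by_cases h0 : P.real (ν.unboundedPart Set.univ) = 0
  · intro ε hε
    obtain ⟨C, hC⟩ := boundedOn_compl_unboundedPart (ν := ν) Set.univ ε hε
    refine ⟨C, fun B hB hBA => (measureReal_le_of_ae ?_).trans (hC B hB hBA)⟩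
    rw [measureReal_eq_zero_iff] at h0
    filter_upwards [measure_eq_zero_iff_ae_notMem.1 h0] with ω hω h
    exact ⟨hω, h.2⟩
  exfalso
  set u := P.real (ν.unboundedPart Set.univ) with hu
  have hu0 : 0 < u := lt_of_le_of_ne measureReal_nonneg (Ne.symm h0)
  have step : ∀ R : {R : Set X // MeasurableSet R ∧ u / 2 < P.real (ν.unboundedPart R)},
      ∃ D, MeasurableSet D ∧ D ⊆ R.1 ∧ u / 2 / 64 ≤ P.real {ω | 1 < |ν.val D ω|} ∧
        u / 2 < P.real (ν.unboundedPart (R.1 \ D)) := by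
    rintro ⟨R, hR, hRu⟩
    obtain ⟨D, hD, hDR, h1, h2⟩ := ν.exists_large_subset_unboundedPart_diff hR (half_pos hu0) hRu.le
      (show 0 < (P.real (ν.unboundedPart R) - u / 2) / 2 by linarith)
    exact ⟨D, hD, hDR, h1, by linarith⟩
  choose D hDm hDR hDl hDu using step
  let R : ℕ → {R : Set X // MeasurableSet R ∧ u / 2 < P.real (ν.unboundedPart R)} := fun n =>
    Nat.rec ⟨Set.univ, .univ, by linarith⟩ (fun _ R => ⟨R.1 \ D R, R.2.1.diff (hDm R), hDu R⟩) n
  have hRanti : Antitone fun n => (R n).1 := antitone_nat_of_succ_le fun n => Set.sdiff_subset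
  have hdisj : ∀ i j, i < j → Disjoint (D (R i)) (D (R j)) := by
    intro i j hij
    have : D (R j) ⊆ (R i).1 \ D (R i) := (hDR _).trans (hRanti (Nat.succ_le_of_lt hij))
    exact (Set.disjoint_sdiff_left.mono_left this).symm
  have hlim := ν.tendsto_val_of_pairwise_disjoint (D := fun n => D (R n)) (fun n => hDm _)
    fun i j hij => hij.lt_or_gt.elim (hdisj i j) fun h => (hdisj j i h).symm
  obtain ⟨n, hn⟩ := (tendstoInMeasure_zero_iff.1 hlim 1 one_pos (u / 2 / 64) (by positivity)).exists
  exact absurd (hDl (R n)) (not_le.2 hn)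

end StochasticMeasure

/-! ### Boundedness of the integral and square summability -/

theorem sum_smul_simpleFunc_apply {X ι : Type*} [MeasurableSpace X] (s : Finset ι) (c : ι → ℝ)
    (g : ι → SimpleFunc X ℝ) (x : X) : (∑ i ∈ s, c i • g i) x = ∑ i ∈ s, c i * g i x := by
  classical
  induction s using Finset.induction_on with
  | empty => simp
  | insert i s hi ih => simp [Finset.sum_insert hi, ih]

namespace StochasticMeasure

variable {X Ω : Type*} [MeasurableSpace X] [MeasurableSpace Ω] {P : Measure Ω}
  [IsProbabilityMeasure P]

/-- The integrals of the simple functions with values in `[-1, 1]` are bounded in probability. The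
coefficients `v` are the means of independent random signs; sums with signs are differences of two
values of the measure, and the variance of the random sum is at most the sum of the squares of the
values of the measure, which the Paley–Zygmund inequality bounds. -/
theorem exists_simpleIntegral_bound_of_abs_le_one (μ : StochasticMeasure X P) {ε : ℝ}
    (hε : 0 < ε) : ∃ C : ℝ, 0 < C ∧ ∀ (A : Set X) (g : SimpleFunc X ℝ), MeasurableSet A →
      (∀ x ∈ A, |g x| ≤ 1) → P.real {ω | C < |μ.simpleIntegral A g ω|} ≤ ε := by
  -- each signed sum is a difference of two values, hence large with probability at most `ε / 14`,
  -- and it enters `12` times in the bound for the squares and twice in the final estimate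
  obtain ⟨C, hC1, hC⟩ := μ.boundedOn_univ.exists_ge (show 0 < ε / 28 by positivity) 1
  simp only [Set.univ_inter] at hC
  have hC0 : 0 < C := by linarith
  refine ⟨2 * C + 4 * C, by positivity, fun A g hA hg => ?_⟩
  set s := g.range with hs
  set a : Ω → ℝ → ℝ := fun ω v => μ.val (A ∩ g ⁻¹' {v}) ω with ha
  have ham : ∀ v, AEMeasurable (fun ω => a ω v) P := fun v =>
    μ.aemeasurable _ (hA.inter (g.measurableSet_fiber v))
  -- the values of `g` outside `[-1, 1]` are not attained on `A` and are truncated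
  set c : ℝ → ℝ := fun v => max (-1) (min 1 v) with hc
  have hc1 : ∀ v, -1 ≤ c v ∧ c v ≤ 1 := fun v =>
    ⟨le_max_left _ _, max_le (by norm_num) (min_le_left _ _)⟩
  have hint : ∀ᵐ ω ∂P, μ.simpleIntegral A g ω = ∑ v ∈ s, c v * a ω v := by
    have h0 : ∀ᵐ ω ∂P, ∀ v ∈ s, 1 < |v| → a ω v = 0 := by
      refine (Finset.eventually_all s).2 fun v _ => ?_
      filter_upwards [μ.val_empty] with ω hω hv
      have : A ∩ g ⁻¹' {v} = ∅ := by
        rw [Set.eq_empty_iff_forall_notMem]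
        rintro x ⟨hx, hxv : g x = v⟩
        exact absurd (hg x hx) (not_le.2 (hxv ▸ hv))
      simp only [ha, this, hω]
    filter_upwards [h0] with ω hω
    rw [simpleIntegral]
    refine Finset.sum_congr rfl fun v hv => ?_
    by_cases h : 1 < |v|
    · have := hω v hv h
      simp only [ha] at this
      simp only [ha, this, mul_zero]
    · rw [not_lt, abs_le] at h
      simp only [hc, ha, min_eq_right h.2, max_eq_right h.1]
  have hsplit : ∀ᵐ ω ∂P, ∀ T ⊆ s, centredSignSum s 0 (a ω) T =
      μ.val (A ∩ g ⁻¹' (T : Set ℝ)) ω - μ.val (A ∩ g ⁻¹' ((s \ T : Finset ℝ) : Set ℝ)) ω := by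
    filter_upwards [μ.val_inter_preimage_forall hA g g.measurableSet_fiber s] with ω hω T hT
    rw [hω T hT, hω (s \ T) Finset.sdiff_subset, centredSignSum,
      ← Finset.sum_sdiff hT, add_comm, sub_eq_add_neg, ← Finset.sum_neg_distrib]
    congr 1 <;> refine Finset.sum_congr rfl fun v hv => ?_
    · simp [hv, ha]
    · simp [(Finset.mem_sdiff.1 hv).2, ha]
  have hTm : ∀ T : Finset ℝ, MeasurableSet (A ∩ g ⁻¹' (T : Set ℝ)) := fun T =>
    hA.inter (g.measurableSet_preimage _)
  have hcss : ∀ v T, AEMeasurable (fun ω => centredSignSum s v (a ω) T) P := fun v T => by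
    unfold centredSignSum
    exact Finset.aemeasurable_fun_sum _ fun i _ => (ham i).const_mul _
  have hSm : ∀ T, NullMeasurableSet {ω | 2 * C < |centredSignSum s 0 (a ω) T|} P := fun T =>
    nullMeasurableSet_lt_abs (hcss 0 T) _
  have hS : ∀ T ⊆ s, P.real {ω | 2 * C < |centredSignSum s 0 (a ω) T|} ≤ ε / 14 := by
    intro T hT
    have h1 := hC _ (hTm T) (Set.subset_univ _)
    have h2 := hC _ (hTm (s \ T)) (Set.subset_univ _)
    refine (measureReal_le_add_of_ae (t := {ω | C < |μ.val (A ∩ g ⁻¹' (T : Set ℝ)) ω|})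
      (u := {ω | C < |μ.val (A ∩ g ⁻¹' ((s \ T : Finset ℝ) : Set ℝ)) ω|}) ?_).trans (by linarith)
    filter_upwards [hsplit] with ω hω (h : 2 * C < _)
    by_contra hcon
    rw [not_or] at hcon
    have e1 : |μ.val (A ∩ g ⁻¹' (T : Set ℝ)) ω| ≤ C := not_lt.1 hcon.1
    have e2 : |μ.val (A ∩ g ⁻¹' ((s \ T : Finset ℝ) : Set ℝ)) ω| ≤ C := not_lt.1 hcon.2
    rw [hω T hT] at h
    linarith [abs_sub (μ.val (A ∩ g ⁻¹' (T : Set ℝ)) ω)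
      (μ.val (A ∩ g ⁻¹' ((s \ T : Finset ℝ) : Set ℝ)) ω)]
  set Q : Ω → ℝ := fun ω => ∑ v ∈ s, a ω v ^ 2 with hQ
  have hQm : AEMeasurable Q P := Finset.aemeasurable_fun_sum _ fun v _ => (ham v).pow_const 2
  have hmeanS : ∀ p : ℝ → ℝ, (∀ i, 0 ≤ p i ∧ p i ≤ 1) →
      subsetMean s p (fun T => P.real {ω | 2 * C < |centredSignSum s 0 (a ω) T|}) ≤ ε / 14 :=
    fun p hp => (subsetMean_mono hp hS).trans_eq (subsetMean_const s p _)
  -- the Paley–Zygmund inequality bounds the sum of squares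
  have hQP : P.real {ω | 2 * (2 * C) ^ 2 < Q ω} ≤ 12 * (ε / 14) := by
    have hp : ∀ i : ℝ, 0 ≤ (fun _ : ℝ => (1 / 2 : ℝ)) i ∧ (fun _ : ℝ => (1 / 2 : ℝ)) i ≤ 1 :=
      fun i => by norm_num
    have := mul_measureReal_le_subsetMean (P := P) (s := s) (c := 1 / 12) hp
      (F := {ω | 2 * (2 * C) ^ 2 < Q ω}) (nullMeasurableSet_lt aemeasurable_const hQm)
      (E := fun T => {ω | 2 * C < |centredSignSum s 0 (a ω) T|}) (fun T _ => hSm T)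
      (.of_forall fun ω hω => by
        refine (le_subsetMean_lt_abs_signSum s (a ω) hω).trans (le_of_eq ?_)
        exact subsetMean_congr fun T _ => by congr)
    linarith [hmeanS _ hp]
  have hmain : P.real ({ω | 2 * C + 4 * C < |∑ v ∈ s, c v * a ω v|} ∩
      {ω | Q ω ≤ 2 * (2 * C) ^ 2}) ≤ 2 * (ε / 14) := by
    have hp : ∀ i : ℝ, 0 ≤ (fun v => (1 + c v) / 2) i ∧ (fun v => (1 + c v) / 2) i ≤ 1 :=
      fun i => ⟨by linarith [(hc1 i).1], by linarith [(hc1 i).2]⟩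
    have := mul_measureReal_le_subsetMean (P := P) (s := s) (c := 1 / 2) hp
      (F := {ω | 2 * C + 4 * C < |∑ v ∈ s, c v * a ω v|} ∩ {ω | Q ω ≤ 2 * (2 * C) ^ 2})
      ((nullMeasurableSet_lt_abs (Finset.aemeasurable_fun_sum _ fun i _ => (ham i).const_mul _)
        _).inter (nullMeasurableSet_le hQm aemeasurable_const))
      (E := fun T => {ω | 2 * C < |centredSignSum s 0 (a ω) T|}) (fun T _ => hSm T)
      (.of_forall fun ω hω => by
        have hω1 : 2 * C + 4 * C < |∑ v ∈ s, c v * a ω v| := hω.1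
        have hω2 : Q ω ≤ 2 * (2 * C) ^ 2 := hω.2
        -- Chebyshev's inequality for the centred random sum
        have hpt : ∀ T ⊆ s, 1 ≤ (if ω ∈ {ω | 2 * C < |centredSignSum s 0 (a ω) T|} then 1 else 0) +
            1 / (4 * C) ^ 2 * centredSignSum s c (a ω) T ^ 2 := by
          intro T _
          split_ifs with h
          · have : 0 ≤ 1 / (4 * C) ^ 2 * centredSignSum s c (a ω) T ^ 2 := by positivity
            linarith
          · have h' : |centredSignSum s 0 (a ω) T| ≤ 2 * C := not_lt.1 h
            have e : ∑ v ∈ s, c v * a ω v =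
                centredSignSum s 0 (a ω) T - centredSignSum s c (a ω) T := by
              rw [centredSignSum, centredSignSum, ← Finset.sum_sub_distrib]
              exact Finset.sum_congr rfl fun v _ => by simp only [Pi.zero_apply]; ring
            rw [e] at hω1
            have := abs_sub (centredSignSum s 0 (a ω) T) (centredSignSum s c (a ω) T)
            have h4 : 4 * C ≤ |centredSignSum s c (a ω) T| := by linarith
            have h5 : (4 * C) ^ 2 ≤ centredSignSum s c (a ω) T ^ 2 := by
              rw [← sq_abs (centredSignSum s c (a ω) T)]
              gcongr
            rw [zero_add, one_div, ← div_eq_inv_mul, le_div_iff₀ (by positivity), one_mul]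
            exact h5
        have hmean := subsetMean_mono hp hpt
        rw [subsetMean_const, subsetMean_add, subsetMean_const_mul,
          subsetMean_centredSignSum_sq] at hmean
        have hvar : ∑ i ∈ s, (1 - c i ^ 2) * a ω i ^ 2 ≤ Q ω :=
          Finset.sum_le_sum fun i _ => by
            have := mul_nonneg (sq_nonneg (c i)) (sq_nonneg (a ω i))
            linarith
        have h6 : 1 / (4 * C) ^ 2 * ∑ i ∈ s, (1 - c i ^ 2) * a ω i ^ 2 ≤ 1 / 2 := by
          calc _ ≤ 1 / (4 * C) ^ 2 * (2 * (2 * C) ^ 2) := by gcongr; exact hvar.trans hω2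
            _ = 1 / 2 := by field_simp; norm_num
        have h7 : (1 : ℝ) / 2 ≤ subsetMean s (fun v => (1 + c v) / 2) fun T =>
            if ω ∈ {ω | 2 * C < |centredSignSum s 0 (a ω) T|} then 1 else 0 := by linarith
        exact h7.trans (le_of_eq (subsetMean_congr fun T _ => by congr)))
    linarith [hmeanS _ hp]
  refine (measureReal_le_add_of_ae (u := {ω | 2 * (2 * C) ^ 2 < Q ω})
    (t := {ω | 2 * C + 4 * C < |∑ v ∈ s, c v * a ω v|} ∩ {ω | Q ω ≤ 2 * (2 * C) ^ 2}) ?_).trans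
    (by linarith)
  filter_upwards [hint] with ω hω hmem
  by_cases h : Q ω ≤ 2 * (2 * C) ^ 2
  · exact .inl ⟨by simpa only [Set.mem_ofPred_eq, hω] using hmem, h⟩
  · exact .inr (not_le.1 h)

theorem exists_simpleIntegral_bound (μ : StochasticMeasure X P) {ε : ℝ} (hε : 0 < ε) :
    ∃ C : ℝ, 0 < C ∧ ∀ (A : Set X) (g : SimpleFunc X ℝ) (M : ℝ), MeasurableSet A → 0 < M →
      (∀ x ∈ A, |g x| ≤ M) → P.real {ω | M * C < |μ.simpleIntegral A g ω|} ≤ ε := by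
  obtain ⟨C, hC0, hC⟩ := μ.exists_simpleIntegral_bound_of_abs_le_one hε
  refine ⟨C, hC0, fun A g M hA hM hg => ?_⟩
  refine (measureReal_le_of_ae ?_).trans (hC A (M⁻¹ • g) hA fun x hx => ?_)
  · filter_upwards [μ.simpleIntegral_smul hA M⁻¹ g] with ω hω (h : M * C < _)
    show C < |_|
    rw [hω, abs_mul, abs_of_pos (inv_pos.2 hM), ← div_eq_inv_mul, lt_div_iff₀ hM, mul_comm]
    exact h
  · rw [SimpleFunc.coe_smul, Pi.smul_apply, smul_eq_mul, abs_mul, abs_of_pos (inv_pos.2 hM),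
      ← div_eq_inv_mul, div_le_one hM]
    exact hg x hx

/-- Square summability of the integrals along a countable family of layers of simple functions:
if the absolute values in layer `l` add up to at most `c l` pointwise and `∑ w l * c l` converges,
then almost surely the sums of squares over the layers are `O((w l)⁻²)`. -/
theorem exists_layer_bound {Λ κ : Type*} [Countable Λ] (μ : StochasticMeasure X P)
    (s : Λ → Finset κ) (φ : Λ → κ → SimpleFunc X ℝ) {w c : Λ → ℝ} (hw : ∀ l, 0 ≤ w l)
    (hφ : ∀ l x, ∑ q ∈ s l, |φ l q x| ≤ c l) (hsum : Summable fun l => w l * c l) :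
    ∀ᵐ ω ∂P, ∃ B, ∀ l, w l ^ 2 * ∑ q ∈ s l, μ.simpleIntegral Set.univ (φ l q) ω ^ 2 ≤ B := by
  classical
  rcases isEmpty_or_nonempty X with hX | hX
  · have h0 : ∀ g : SimpleFunc X ℝ, ∀ ω, μ.simpleIntegral Set.univ g ω = 0 := fun g ω => by
      have : g.range = ∅ := by
        rw [Finset.eq_empty_iff_forall_notMem]
        intro v hv
        obtain ⟨x, -⟩ := SimpleFunc.mem_range.1 hv
        exact hX.elim x
      rw [simpleIntegral, this, Finset.sum_empty]
    exact .of_forall fun ω => ⟨0, fun l => by simp [h0]⟩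
  have hc0 : ∀ l, 0 ≤ c l := fun l =>
    (Finset.sum_nonneg fun q _ => abs_nonneg _).trans (hφ l hX.some)
  set ξ : Λ → κ → Ω → ℝ := fun l q => μ.simpleIntegral Set.univ (φ l q) with hξ
  have hξm : ∀ l q, AEMeasurable (ξ l q) P := fun l q => μ.aemeasurable_simpleIntegral .univ _
  set K : ℝ := ∑' l, w l * c l + 1 with hK
  have hK0 : 0 < K := by
    have : 0 ≤ ∑' l, w l * c l := tsum_nonneg fun l => mul_nonneg (hw l) (hc0 l)
    linarith
  set Q : Finset Λ → Ω → ℝ := fun F ω => ∑ l ∈ F, w l ^ 2 * ∑ q ∈ s l, ξ l q ω ^ 2 with hQ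
  have hQm : ∀ F, AEMeasurable (Q F) P := fun F => Finset.aemeasurable_fun_sum _ fun l _ =>
    (Finset.aemeasurable_fun_sum _ fun q _ => (hξm l q).pow_const 2).const_mul _
  have hbound : ∀ ε > 0, ∃ B : ℝ, ∀ F, P.real {ω | B < Q F ω} ≤ ε := by
    intro ε hε
    obtain ⟨C, hC0, hC⟩ := μ.exists_simpleIntegral_bound (show 0 < ε / 12 by positivity)
    refine ⟨2 * (K * C) ^ 2, fun F => ?_⟩
    set I : Finset (Σ _ : Λ, κ) := F.sigma s with hI
    -- the weighted integrals of all layers in `F` form one family, whose signed sums are integrals of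
    -- functions bounded by `K`
    set a : Ω → (Σ _ : Λ, κ) → ℝ := fun ω i => w i.1 * ξ i.1 i.2 ω with ha
    have hQI : ∀ ω, Q F ω = ∑ i ∈ I, a ω i ^ 2 := fun ω => by
      rw [hI, Finset.sum_sigma]
      exact Finset.sum_congr rfl fun l _ => by
        rw [Finset.mul_sum]
        exact Finset.sum_congr rfl fun q _ => by simp only [ha]; ring
    have hcss : ∀ T, AEMeasurable (fun ω => centredSignSum I 0 (a ω) T) P := fun T => by
      unfold centredSignSum
      exact Finset.aemeasurable_fun_sum _ fun i _ => ((hξm _ _).const_mul _).const_mul _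
    have hS : ∀ T ⊆ I, P.real {ω | K * C < |centredSignSum I 0 (a ω) T|} ≤ ε / 12 := by
      intro T _
      set σ : (Σ _ : Λ, κ) → ℝ := fun i => (if i ∈ T then 1 else -1) * w i.1 with hσ
      refine (measureReal_le_of_ae ?_).trans
        (hC Set.univ (∑ i ∈ I, σ i • φ i.1 i.2) K .univ hK0 fun x _ => ?_)
      · filter_upwards [μ.simpleIntegral_sum .univ I σ fun i => φ i.1 i.2] with ω hω hmem
        have : centredSignSum I 0 (a ω) T =
            ∑ i ∈ I, σ i * μ.simpleIntegral Set.univ (φ i.1 i.2) ω :=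
          Finset.sum_congr rfl fun i _ => by simp [ha, hσ, hξ]
        simpa only [Set.mem_ofPred_eq, hω, this] using hmem
      · rw [sum_smul_simpleFunc_apply]
        calc |∑ i ∈ I, σ i * φ i.1 i.2 x| ≤ ∑ i ∈ I, w i.1 * |φ i.1 i.2 x| := by
              refine (Finset.abs_sum_le_sum_abs _ _).trans (Finset.sum_le_sum fun i _ => ?_)
              rw [abs_mul]
              refine mul_le_mul_of_nonneg_right (le_of_eq ?_) (abs_nonneg _)
              simp only [hσ]
              split_ifs <;> simp [abs_of_nonneg (hw i.1)]
          _ = ∑ l ∈ F, w l * ∑ q ∈ s l, |φ l q x| := by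
              rw [hI, Finset.sum_sigma]
              exact Finset.sum_congr rfl fun l _ => by rw [Finset.mul_sum]
          _ ≤ ∑ l ∈ F, w l * c l :=
              Finset.sum_le_sum fun l _ => mul_le_mul_of_nonneg_left (hφ l x) (hw l)
          _ ≤ ∑' l, w l * c l := hsum.sum_le_tsum F fun l _ => mul_nonneg (hw l) (hc0 l)
          _ ≤ K := by linarith
    have hp : ∀ i : (Σ _ : Λ, κ), 0 ≤ (fun _ : (Σ _ : Λ, κ) => (1 / 2 : ℝ)) i ∧
      (fun _ : (Σ _ : Λ, κ) => (1 / 2 : ℝ)) i ≤ 1 := fun i => by norm_num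
    have := mul_measureReal_le_subsetMean (P := P) (s := I) (c := 1 / 12) hp
      (F := {ω | 2 * (K * C) ^ 2 < Q F ω}) (nullMeasurableSet_lt aemeasurable_const (hQm F))
      (E := fun T => {ω | K * C < |centredSignSum I 0 (a ω) T|})
      (fun T _ => nullMeasurableSet_lt_abs (hcss T) _) (.of_forall fun ω hω => by
        have hω' : 2 * (K * C) ^ 2 < Q F ω := hω
        rw [hQI] at hω'
        refine (le_subsetMean_lt_abs_signSum I (a ω) hω').trans (le_of_eq ?_)
        exact subsetMean_congr fun T _ => by congr)
    have h2 := (subsetMean_mono hp hS).trans_eq (subsetMean_const I (fun _ => 1 / 2) _)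
    linarith
  have hQmono : ∀ ω, Monotone fun F => Q F ω := fun ω F F' hFF' =>
    Finset.sum_le_sum_of_subset_of_nonneg hFF' fun l _ _ =>
      mul_nonneg (sq_nonneg _) (Finset.sum_nonneg fun q _ => sq_nonneg _)
  have hnull : P {ω | ¬ ∃ B, ∀ l, w l ^ 2 * ∑ q ∈ s l, ξ l q ω ^ 2 ≤ B} = 0 := by
    refine le_antisymm (ENNReal.le_of_forall_pos_le_add fun ε hε _ => ?_) zero_le
    obtain ⟨B, hB⟩ := hbound ε hε
    have hsub : {ω | ¬ ∃ B, ∀ l, w l ^ 2 * ∑ q ∈ s l, ξ l q ω ^ 2 ≤ B} ⊆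
        ⋃ F, {ω | B < Q F ω} := by
      intro ω hω
      by_contra hcon
      simp only [Set.mem_iUnion, not_exists] at hcon
      refine hω ⟨B, fun l => ?_⟩
      have : Q {l} ω ≤ B := not_lt.1 (hcon {l})
      simpa [hQ] using this
    have hdir : Directed (· ⊆ ·) fun F => {ω | B < Q F ω} :=
      Monotone.directed_le fun F F' hFF' ω (hω : B < Q F ω) => hω.trans_le (hQmono ω hFF')
    rw [zero_add]
    refine (measure_mono hsub).trans ?_
    rw [hdir.measure_iUnion]
    refine iSup_le fun F => ?_
    rw [← ofReal_measureReal (μ := P) (s := {ω | B < Q F ω}), ← ENNReal.ofReal_coe_nnreal]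
    exact ENNReal.ofReal_le_ofReal (hB F)
  exact hnull

end StochasticMeasure

/-! ### Convergence in probability through the truncated mean -/

section truncMean

variable {Ω : Type*} [MeasurableSpace Ω] {P : Measure Ω}

/-- The functional `E min(|ξ|, 1)`, which metrizes convergence in probability. -/
noncomputable def truncMean (P : Measure Ω) (ξ : Ω → ℝ) : ℝ := ∫ ω, min |ξ ω| 1 ∂P

theorem truncMean_nonneg (ξ : Ω → ℝ) : 0 ≤ truncMean P ξ :=
  integral_nonneg fun _ => le_min (abs_nonneg _) zero_le_one

theorem truncMean_congr {ξ ζ : Ω → ℝ} (h : ∀ᵐ ω ∂P, ξ ω = ζ ω) : truncMean P ξ = truncMean P ζ :=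
  integral_congr_ae (h.mono fun ω hω => by simp only [hω])

theorem truncMean_neg (ξ : Ω → ℝ) : truncMean P (fun ω => -ξ ω) = truncMean P ξ := by
  simp [truncMean]

variable [IsProbabilityMeasure P]

theorem integrable_min_abs_one {ξ : Ω → ℝ} (hξ : AEMeasurable ξ P) :
    Integrable (fun ω => min |ξ ω| 1) P :=
  Integrable.of_bound (hξ.abs.min aemeasurable_const).aestronglyMeasurable 1 <| .of_forall fun ω => by
    rw [Real.norm_eq_abs, abs_of_nonneg (le_min (abs_nonneg _) zero_le_one)]
    exact min_le_right _ _

theorem truncMean_add_le {ξ ζ : Ω → ℝ} (hξ : AEMeasurable ξ P) (hζ : AEMeasurable ζ P) :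
    truncMean P (fun ω => ξ ω + ζ ω) ≤ truncMean P ξ + truncMean P ζ := by
  rw [truncMean, truncMean, truncMean,
    ← integral_add (integrable_min_abs_one hξ) (integrable_min_abs_one hζ)]
  refine integral_mono (integrable_min_abs_one (hξ.add hζ))
    ((integrable_min_abs_one hξ).add (integrable_min_abs_one hζ)) fun ω => ?_
  have h := abs_add_le (ξ ω) (ζ ω)
  have h1 := abs_nonneg (ξ ω)
  have h2 := abs_nonneg (ζ ω)
  beta_reduce
  rcases min_cases |ξ ω| 1 with h3 | h3 <;> rcases min_cases |ζ ω| 1 with h4 | h4 <;>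
    rcases min_cases |ξ ω + ζ ω| 1 with h5 | h5 <;> linarith

theorem truncMean_sub_le {ξ ζ : Ω → ℝ} (hξ : AEMeasurable ξ P) (hζ : AEMeasurable ζ P) :
    truncMean P (fun ω => ξ ω - ζ ω) ≤ truncMean P ξ + truncMean P ζ := by
  have := truncMean_add_le hξ hζ.neg
  rw [show truncMean P (-ζ) = truncMean P ζ from truncMean_neg ζ] at this
  simpa only [sub_eq_add_neg, Pi.neg_apply] using this

theorem truncMean_const_mul_le (c : ℝ) {ξ : Ω → ℝ} (hξ : AEMeasurable ξ P) :
    truncMean P (fun ω => c * ξ ω) ≤ (|c| + 1) * truncMean P ξ := by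
  rw [truncMean, truncMean, ← integral_const_mul]
  refine integral_mono (integrable_min_abs_one (hξ.const_mul c))
    ((integrable_min_abs_one hξ).const_mul _) fun ω => ?_
  have h1 := abs_nonneg (ξ ω)
  have h2 := abs_nonneg c
  beta_reduce
  rw [abs_mul]
  have h3 := mul_nonneg h2 h1
  rcases min_cases |ξ ω| 1 with h4 | h4
  · rw [h4.1]
    exact (min_le_left _ _).trans (by linarith)
  · rw [h4.1]
    exact (min_le_right _ _).trans (by linarith)

theorem truncMean_sum_le {ι : Type*} (s : Finset ι) {ξ : ι → Ω → ℝ}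
    (hξ : ∀ i, AEMeasurable (ξ i) P) :
    truncMean P (fun ω => ∑ i ∈ s, ξ i ω) ≤ ∑ i ∈ s, truncMean P (ξ i) := by
  classical
  induction s using Finset.induction_on with
  | empty => simp [truncMean]
  | insert i s hi ih =>
    simp only [Finset.sum_insert hi]
    exact (truncMean_add_le (hξ i) (Finset.aemeasurable_fun_sum s fun j _ => hξ j)).trans (by gcongr)

theorem truncMean_le_add_measureReal {ξ : Ω → ℝ} (hξ : AEMeasurable ξ P) {t : ℝ} (ht : 0 ≤ t) :
    truncMean P ξ ≤ t + P.real {ω | t < |ξ ω|} := by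
  have hm : NullMeasurableSet {ω | t < |ξ ω|} P := nullMeasurableSet_lt aemeasurable_const hξ.abs
  have hi : Integrable (fun ω => {ω | t < |ξ ω|}.indicator (fun _ => (1 : ℝ)) ω) P :=
    (integrable_const _).indicator₀ hm
  have : truncMean P ξ ≤ ∫ ω, (t + {ω | t < |ξ ω|}.indicator (fun _ => (1 : ℝ)) ω) ∂P := by
    refine integral_mono (integrable_min_abs_one hξ) ((integrable_const _).add hi) fun ω => ?_
    by_cases h : t < |ξ ω|
    · have e : {ω | t < |ξ ω|}.indicator (fun _ => (1 : ℝ)) ω = 1 :=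
        Set.indicator_of_mem (show ω ∈ {ω | t < |ξ ω|} from h) _
      beta_reduce
      rw [e]
      exact (min_le_right _ _).trans (by linarith)
    · have e : {ω | t < |ξ ω|}.indicator (fun _ => (1 : ℝ)) ω = 0 :=
        Set.indicator_of_notMem (show ω ∉ {ω | t < |ξ ω|} from h) _
      beta_reduce
      rw [e]
      exact (min_le_left _ _).trans (by linarith [not_lt.1 h])
  rw [integral_add (integrable_const _) hi, integral_indicator₀ hm] at this
  simpa using this

theorem mul_measureReal_le_truncMean {ξ : Ω → ℝ} (hξ : AEMeasurable ξ P) {t : ℝ}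
    (ht1 : t ≤ 1) : t * P.real {ω | t < |ξ ω|} ≤ truncMean P ξ := by
  have hm : NullMeasurableSet {ω | t < |ξ ω|} P := nullMeasurableSet_lt aemeasurable_const hξ.abs
  have hi : Integrable (fun ω => {ω | t < |ξ ω|}.indicator (fun _ => t) ω) P :=
    (integrable_const _).indicator₀ hm
  have : ∫ ω, {ω | t < |ξ ω|}.indicator (fun _ => t) ω ∂P ≤ truncMean P ξ := by
    refine integral_mono hi (integrable_min_abs_one hξ) fun ω => ?_
    by_cases h : t < |ξ ω|
    · rw [Set.indicator_of_mem (show ω ∈ {ω | t < |ξ ω|} from h)]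
      exact le_min h.le ht1
    · rw [Set.indicator_of_notMem (show ω ∉ {ω | t < |ξ ω|} from h)]
      exact le_min (abs_nonneg _) zero_le_one
  rw [integral_indicator₀ hm] at this
  simpa [mul_comm] using this

theorem tendstoInMeasure_zero_iff_truncMean {ξ : ℕ → Ω → ℝ} (hξ : ∀ n, AEMeasurable (ξ n) P) :
    TendstoInMeasure P ξ atTop (fun _ => 0) ↔
      Tendsto (fun n => truncMean P (ξ n)) atTop (𝓝 0) := by
  rw [StochasticMeasure.tendstoInMeasure_zero_iff]
  constructor
  · intro h
    rw [Metric.tendsto_nhds]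
    intro ε hε
    filter_upwards [h (ε / 2) (by positivity) (ε / 2) (by positivity)] with n hn
    rw [Real.dist_0_eq_abs, abs_of_nonneg (truncMean_nonneg _)]
    linarith [truncMean_le_add_measureReal (hξ n) (show 0 ≤ ε / 2 by positivity)]
  · intro h ε hε δ hδ
    set t := min ε 1
    have ht : 0 < t := lt_min hε one_pos
    filter_upwards [h.eventually_lt_const (show 0 < t * δ by positivity)] with n hn
    have h1 := mul_measureReal_le_truncMean (t := t) (hξ n) (min_le_right _ _)
    have h2 : P.real {ω | ε < |ξ n ω|} ≤ P.real {ω | t < |ξ n ω|} :=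
      measureReal_mono fun ω (h : ε < _) => lt_of_le_of_lt (min_le_left _ _) h
    exact h2.trans_lt (lt_of_mul_lt_mul_left (h1.trans_lt hn) ht.le)

theorem tendstoInMeasure_iff_truncMean {ξ : ℕ → Ω → ℝ} {J : Ω → ℝ}
    (hξ : ∀ n, AEMeasurable (ξ n) P) (hJ : AEMeasurable J P) :
    TendstoInMeasure P ξ atTop J ↔
      Tendsto (fun n => truncMean P fun ω => ξ n ω - J ω) atTop (𝓝 0) := by
  refine Iff.trans ?_ (tendstoInMeasure_zero_iff_truncMean fun n => (hξ n).sub hJ)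
  rw [tendstoInMeasure_iff_norm, tendstoInMeasure_iff_norm]
  simp

theorem ae_eq_zero_of_truncMean_le_zero {ξ : Ω → ℝ} (hξ : AEMeasurable ξ P)
    (h : truncMean P ξ ≤ 0) : ∀ᵐ ω ∂P, ξ ω = 0 := by
  have h0 : truncMean P ξ = 0 := le_antisymm h (truncMean_nonneg _)
  have := (integral_eq_zero_iff_of_nonneg (fun ω => le_min (abs_nonneg (ξ ω)) zero_le_one)
    (integrable_min_abs_one hξ)).1 h0
  filter_upwards [this] with ω hω
  have hω' : min |ξ ω| 1 = 0 := hω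
  rcases min_choice |ξ ω| 1 with h1 | h1 <;> rw [h1] at hω'
  · exact abs_eq_zero.1 hω'
  · norm_num at hω'

end truncMean

/-! ### Uniform countable additivity and uniqueness of the integral -/

namespace StochasticMeasure

variable {X Ω : Type*} [MeasurableSpace X] [MeasurableSpace Ω] {P : Measure Ω}
  [IsProbabilityMeasure P]

/-- On a sequence of sets that decreases to the empty set, the measure tends to zero in probability
uniformly over the subsets: otherwise there are disjoint subsets of measure bounded below. -/
theorem exists_forall_subset_truncMean_le (ν : StochasticMeasure X P) {A : ℕ → Set X}
    (hA : ∀ i, MeasurableSet (A i)) (hanti : Antitone A) (hemp : ⋂ i, A i = ∅) {η : ℝ}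
    (hη : 0 < η) : ∃ i, ∀ C, MeasurableSet C → C ⊆ A i → truncMean P (ν.val C) ≤ η := by
  by_contra! hcon
  have step : ∀ i, ∃ C, MeasurableSet C ∧ C ⊆ A i ∧ ∃ j ≥ i, η < truncMean P (ν.val (C \ A j)) := by
    intro i
    obtain ⟨C, hC, hCA, hlt⟩ := hcon i
    have h0 : Tendsto (fun j => truncMean P (ν.val (C ∩ A j))) atTop (𝓝 0) := by
      rw [← tendstoInMeasure_zero_iff_truncMean fun j => ν.aemeasurable _ (hC.inter (hA j))]
      refine ν.tendsto_zero _ (fun j => hC.inter (hA j))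
        (fun j k hjk => Set.inter_subset_inter_right _ (hanti hjk)) ?_
      rw [← Set.inter_iInter, hemp, Set.inter_empty]
    obtain ⟨j, hj, hij⟩ := ((h0.eventually_lt_const (sub_pos.2 hlt)).and (eventually_ge_atTop i)).exists
    refine ⟨C, hC, hCA, j, hij, ?_⟩
    have h1 := truncMean_add_le (ν.aemeasurable _ (hC.inter (hA j)))
      (ν.aemeasurable _ (hC.diff (hA j)))
    rw [← truncMean_congr (ν.val_inter_add_diff hC (hA j))] at h1
    linarith
  choose C hC hCA j hj hlt using step
  let i : ℕ → ℕ := fun n => Nat.rec 0 (fun _ k => j k) n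
  have hi : Monotone i := monotone_nat_of_le_succ fun n => hj (i n)
  have hdisj : ∀ m n, m < n → Disjoint (C (i m) \ A (j (i m))) (C (i n) \ A (j (i n))) := by
    intro m n hmn
    have : C (i n) \ A (j (i n)) ⊆ A (j (i m)) :=
      Set.sdiff_subset.trans ((hCA _).trans (hanti (hi (Nat.succ_le_of_lt hmn))))
    exact Set.disjoint_sdiff_left.mono_right this
  have hm : ∀ n, MeasurableSet (C (i n) \ A (j (i n))) := fun n => (hC _).diff (hA _)
  have hlim := ν.tendsto_val_of_pairwise_disjoint hm
    fun m n hmn => hmn.lt_or_gt.elim (hdisj m n) fun h => (hdisj n m h).symm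
  rw [tendstoInMeasure_zero_iff_truncMean fun n => ν.aemeasurable _ (hm n)] at hlim
  obtain ⟨n, hn⟩ := (hlim.eventually_lt_const hη).exists
  exact absurd (hlt (i n)) (not_lt.2 hn.le)

/-- Nikodym's theorem: a sequence of stochastic measures that is Cauchy in probability on every set
is uniformly countably additive. The unions of the differences `A i \ A (i + 1)` are parametrized by
the Cantor space, on which the measures are continuous, and Baire's theorem applies. -/
theorem exists_forall_truncMean_le_of_cauchy (ν : ℕ → StochasticMeasure X P)
    (hν : ∀ A, MeasurableSet A → ∀ η > 0, ∃ N, ∀ m ≥ N, ∀ n ≥ N,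
      truncMean P (fun ω => (ν m).val A ω - (ν n).val A ω) ≤ η)
    {A : ℕ → Set X} (hA : ∀ i, MeasurableSet (A i)) (hanti : Antitone A) (hemp : ⋂ i, A i = ∅)
    {η : ℝ} (hη : 0 < η) : ∃ i, ∀ n, truncMean P ((ν n).val (A i)) ≤ η := by
  set E : (ℕ → Bool) → Set X := fun σ => ⋃ i, ⋃ (_ : σ i = true), A i \ A (i + 1) with hE
  have hEm : ∀ σ, MeasurableSet (E σ) := fun σ =>
    .iUnion fun i => .iUnion fun _ => (hA i).diff (hA (i + 1))
  have hidx : ∀ {x i j}, x ∈ A i \ A (i + 1) → x ∈ A j → j ≤ i := by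
    intro x i j hx hj
    by_contra! hlt
    exact hx.2 (hanti (Nat.succ_le_of_lt hlt) hj)
  have hex : ∀ {x m}, x ∈ A m → ∃ i ≥ m, x ∈ A i \ A (i + 1) := by
    intro x m hx
    have : ∃ i, x ∉ A i := by
      by_contra! h
      exact Set.notMem_empty x (hemp ▸ Set.mem_iInter.2 h)
    classical
    have hpos : m < Nat.find this := by
      by_contra! h
      exact Nat.find_spec this (hanti h hx)
    refine ⟨Nat.find this - 1, by omega, ?_, ?_⟩
    · have := Nat.find_min this (m := Nat.find this - 1) (by omega)
      exact not_not.1 this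
    · rw [Nat.sub_add_cancel (by omega)]
      exact Nat.find_spec this
  -- the part of `E σ` inside `A m` is what depends on the coordinates of `σ` from `m` on
  have hout : ∀ {σ σ' : ℕ → Bool} {m}, (∀ i < m, σ' i = σ i) → E σ' \ A m = E σ \ A m := by
    have : ∀ {σ σ' : ℕ → Bool} {m}, (∀ i < m, σ' i = σ i) → E σ' \ A m ⊆ E σ \ A m := by
      rintro σ σ' m h x ⟨hx, hxm⟩
      obtain ⟨i, hi, hxi⟩ := Set.mem_iUnion₂.1 hx
      have him : i < m := by
        by_contra! hmi
        exact hxm (hanti hmi hxi.1)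
      exact ⟨Set.mem_iUnion₂.2 ⟨i, (h i him) ▸ hi, hxi⟩, hxm⟩
    exact fun {σ σ' m} h => (this h).antisymm (this fun i hi => (h i hi).symm)
  have hcont : ∀ m n, Continuous fun σ =>
      truncMean P (fun ω => (ν m).val (E σ) ω - (ν n).val (E σ) ω) := by
    intro m n
    rw [continuous_iff_continuousAt]
    intro σ
    rw [ContinuousAt, Metric.tendsto_nhds]
    intro ε hε
    obtain ⟨i₁, hi₁⟩ := (ν m).exists_forall_subset_truncMean_le hA hanti hemp
      (show 0 < ε / 5 by positivity)
    obtain ⟨i₂, hi₂⟩ := (ν n).exists_forall_subset_truncMean_le hA hanti hemp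
      (show 0 < ε / 5 by positivity)
    set k := max i₁ i₂
    have hk : PiNat.cylinder σ k ∈ 𝓝 σ :=
      (PiNat.isOpen_cylinder (fun _ => Bool) σ k).mem_nhds (PiNat.self_mem_cylinder σ k)
    filter_upwards [hk] with σ' hσ'
    rw [PiNat.mem_cylinder_iff] at hσ'
    have e := hout hσ'
    have hmeas : ∀ (l : ℕ) (τ : ℕ → Bool), AEMeasurable ((ν l).val (E τ ∩ A k)) P := fun l τ =>
      (ν l).aemeasurable _ ((hEm τ).inter (hA k))
    have b1 : ∀ τ, truncMean P ((ν m).val (E τ ∩ A k)) ≤ ε / 5 := fun τ =>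
      hi₁ _ ((hEm τ).inter (hA k)) (Set.inter_subset_right.trans (hanti (le_max_left _ _)))
    have b2 : ∀ τ, truncMean P ((ν n).val (E τ ∩ A k)) ≤ ε / 5 := fun τ =>
      hi₂ _ ((hEm τ).inter (hA k)) (Set.inter_subset_right.trans (hanti (le_max_right _ _)))
    have b3 : ∀ τ, truncMean P (fun ω => (ν m).val (E τ ∩ A k) ω - (ν n).val (E τ ∩ A k) ω) ≤
        2 * (ε / 5) := fun τ =>
      (truncMean_sub_le (hmeas m τ) (hmeas n τ)).trans (by linarith [b1 τ, b2 τ])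
    set d : (ℕ → Bool) → Ω → ℝ := fun τ ω => (ν m).val (E τ) ω - (ν n).val (E τ) ω with hd
    have hdm : ∀ τ, AEMeasurable (d τ) P := fun τ =>
      ((ν m).aemeasurable _ (hEm τ)).sub ((ν n).aemeasurable _ (hEm τ))
    have hdiff : truncMean P (fun ω => d σ' ω - d σ ω) ≤ 4 * (ε / 5) := by
      have e1 : truncMean P (fun ω => d σ' ω - d σ ω) = truncMean P (fun ω =>
          ((ν m).val (E σ' ∩ A k) ω - (ν n).val (E σ' ∩ A k) ω) -
          ((ν m).val (E σ ∩ A k) ω - (ν n).val (E σ ∩ A k) ω)) := by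
        refine truncMean_congr ?_
        filter_upwards [(ν m).val_inter_add_diff (hEm σ) (hA k),
          (ν m).val_inter_add_diff (hEm σ') (hA k), (ν n).val_inter_add_diff (hEm σ) (hA k),
          (ν n).val_inter_add_diff (hEm σ') (hA k)] with ω h1 h2 h3 h4
        simp only [hd]
        rw [h1, h2, h3, h4, e]
        ring
      rw [e1]
      exact (truncMean_sub_le ((hmeas m σ').sub (hmeas n σ')) ((hmeas m σ).sub (hmeas n σ))).trans
        ((add_le_add (b3 σ') (b3 σ)).trans (by linarith))
    have f1 : truncMean P (d σ') ≤ truncMean P (fun ω => d σ' ω - d σ ω) + truncMean P (d σ) := by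
      refine le_trans (le_of_eq ?_) (truncMean_add_le ((hdm σ').sub (hdm σ)) (hdm σ))
      exact truncMean_congr (.of_forall fun ω => by simp)
    have f2 : truncMean P (d σ) ≤ truncMean P (d σ') + truncMean P (fun ω => d σ' ω - d σ ω) := by
      refine le_trans (le_of_eq ?_) (truncMean_sub_le (hdm σ') ((hdm σ').sub (hdm σ)))
      exact truncMean_congr (.of_forall fun ω => by simp)
    rw [Real.dist_eq, abs_lt]
    constructor <;> linarith
  obtain ⟨N, hN⟩ : ∃ N, (interior {σ | ∀ m ≥ N, ∀ n ≥ N,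
      truncMean P (fun ω => (ν m).val (E σ) ω - (ν n).val (E σ) ω) ≤ η / 4}).Nonempty := by
    refine nonempty_interior_of_iUnion_of_closed (fun N => ?_) ?_
    · have : {σ | ∀ m ≥ N, ∀ n ≥ N,
          truncMean P (fun ω => (ν m).val (E σ) ω - (ν n).val (E σ) ω) ≤ η / 4} =
          ⋂ m ≥ N, ⋂ n ≥ N,
            {σ | truncMean P (fun ω => (ν m).val (E σ) ω - (ν n).val (E σ) ω) ≤ η / 4} := by
        ext σ; simp
      rw [this]
      exact isClosed_iInter fun m => isClosed_iInter fun _ => isClosed_iInter fun n =>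
        isClosed_iInter fun _ => isClosed_le (hcont m n) continuous_const
    · exact Set.eq_univ_of_forall fun σ => Set.mem_iUnion.2
        (hν (E σ) (hEm σ) (η / 4) (by positivity))
  obtain ⟨σ₀, hσ₀⟩ := hN
  obtain ⟨k, hk⟩ : ∃ k, PiNat.cylinder σ₀ k ⊆ {σ | ∀ m ≥ N, ∀ n ≥ N,
      truncMean P (fun ω => (ν m).val (E σ) ω - (ν n).val (E σ) ω) ≤ η / 4} := by
    obtain ⟨_, ⟨τ, k, rfl⟩, h1, h2⟩ := (PiNat.isTopologicalBasis_cylinders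
      (fun _ : ℕ => Bool)).exists_subset_of_mem_open hσ₀ isOpen_interior
    refine ⟨k, ?_⟩
    rw [PiNat.mem_cylinder_iff_eq.1 h1]
    exact h2.trans interior_subset
  -- the finitely many measures of index at most `N` are treated separately
  have hsmall : ∀ᶠ i in atTop, ∀ n ∈ Finset.range (N + 1), truncMean P ((ν n).val (A i)) ≤ η / 4 := by
    refine (Finset.eventually_all _).2 fun n _ => ?_
    have := (tendstoInMeasure_zero_iff_truncMean fun i => (ν n).aemeasurable _ (hA i)).1
      ((ν n).tendsto_zero A hA hanti hemp)
    filter_upwards [this.eventually_lt_const (show 0 < η / 4 by positivity)] with i hi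
    exact hi.le
  obtain ⟨i, hi, hik⟩ := (hsmall.and (eventually_ge_atTop k)).exists
  refine ⟨i, fun n => ?_⟩
  rcases lt_or_ge n N with hn | hn
  · linarith [hi n (Finset.mem_range.2 (by omega))]
  -- two points of the cylinder for which `E σ₂` is the disjoint union of `E σ₁` and `A i`: hence
  -- `ν n` and `ν N` differ by at most `η / 2` on `A i`
  set σ₁ : ℕ → Bool := fun l => if l < k then σ₀ l else false with hσ₁
  set σ₂ : ℕ → Bool := fun l => if l < k then σ₀ l else decide (i ≤ l) with hσ₂
  have h₁ : σ₁ ∈ PiNat.cylinder σ₀ k := by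
    rw [PiNat.mem_cylinder_iff]; intro l hl; simp [hσ₁, hl]
  have h₂ : σ₂ ∈ PiNat.cylinder σ₀ k := by
    rw [PiNat.mem_cylinder_iff]; intro l hl; simp [hσ₂, hl]
  have hunion : E σ₁ ∪ A i = E σ₂ := by
    ext x
    simp only [hE, Set.mem_union, Set.mem_iUnion, exists_prop]
    constructor
    · rintro (⟨l, hl, hx⟩ | hx)
      · have hlk : l < k := by
          by_contra h
          simp [hσ₁, h] at hl
        exact ⟨l, by simpa [hσ₁, hσ₂, hlk] using hl, hx⟩
      · obtain ⟨l, hl, hx⟩ := hex hx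
        have hl' : i ≤ l := hl
        refine ⟨l, ?_, hx⟩
        have : ¬ l < k := by omega
        simp [hσ₂, this, hl']
    · rintro ⟨l, hl, hx⟩
      by_cases hlk : l < k
      · exact .inl ⟨l, by simpa [hσ₁, hσ₂, hlk] using hl, hx⟩
      · have : i ≤ l := by simpa [hσ₂, hlk] using hl
        exact .inr (hanti this hx.1)
  have hdisj : Disjoint (E σ₁) (A i) := by
    rw [Set.disjoint_left]
    intro x hx hxi
    obtain ⟨l, hl, hxl⟩ := Set.mem_iUnion₂.1 hx
    have hlk : l < k := by
      by_contra h
      simp [hσ₁, h] at hl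
    have := hidx hxl hxi
    omega
  have hadd : ∀ l, ∀ᵐ ω ∂P, (ν l).val (E σ₂) ω = (ν l).val (E σ₁) ω + (ν l).val (A i) ω := fun l => by
    have := (ν l).add _ _ (hEm σ₁) (hA i) hdisj
    rwa [hunion] at this
  have hd : ∀ τ, AEMeasurable (fun ω => (ν n).val (E τ) ω - (ν N).val (E τ) ω) P := fun τ =>
    ((ν n).aemeasurable _ (hEm τ)).sub ((ν N).aemeasurable _ (hEm τ))
  have hcalc : truncMean P ((ν n).val (A i)) ≤
      truncMean P (fun ω => ((ν n).val (E σ₂) ω - (ν N).val (E σ₂) ω) -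
        ((ν n).val (E σ₁) ω - (ν N).val (E σ₁) ω)) + truncMean P ((ν N).val (A i)) := by
    refine le_trans (le_of_eq (truncMean_congr ?_))
      (truncMean_add_le ((hd σ₂).sub (hd σ₁)) ((ν N).aemeasurable _ (hA i)))
    filter_upwards [hadd n, hadd N] with ω h1 h2
    rw [h1, h2]
    ring
  have := truncMean_sub_le (hd σ₂) (hd σ₁)
  linarith [hk h₁ n hn N le_rfl, hk h₂ n hn N le_rfl, hi N (Finset.mem_range.2 (by omega))]

/-- The stochastic measure `A ↦ ∫_A g dμ` with a simple density. -/
noncomputable def withSimpleDensity (μ : StochasticMeasure X P) (g : SimpleFunc X ℝ) :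
    StochasticMeasure X P where
  val A := μ.simpleIntegral A g
  aemeasurable A hA := μ.aemeasurable_simpleIntegral hA g
  add A B hA hB hd := μ.simpleIntegral_union hA hB hd g
  tendsto_zero A hA hanti hemp := by
    rw [tendstoInMeasure_zero_iff_truncMean fun n => μ.aemeasurable_simpleIntegral (hA n) g]
    have hm : ∀ n v, AEMeasurable (μ.val (A n ∩ g ⁻¹' {v})) P := fun n v =>
      μ.aemeasurable _ ((hA n).inter (g.measurableSet_fiber v))
    have h0 : ∀ v, Tendsto (fun n => truncMean P (μ.val (A n ∩ g ⁻¹' {v}))) atTop (𝓝 0) := by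
      intro v
      rw [← tendstoInMeasure_zero_iff_truncMean fun n => hm n v]
      refine μ.tendsto_zero _ (fun n => (hA n).inter (g.measurableSet_fiber v))
        (fun m n hmn => Set.inter_subset_inter_left _ (hanti hmn)) ?_
      rw [← Set.iInter_inter, hemp, Set.empty_inter]
    have h1 : Tendsto (fun n => ∑ v ∈ g.range, (|v| + 1) * truncMean P (μ.val (A n ∩ g ⁻¹' {v})))
        atTop (𝓝 0) := by
      have := tendsto_finsetSum g.range fun v _ => (h0 v).const_mul (|v| + 1)
      simpa using this
    refine squeeze_zero (fun n => truncMean_nonneg _) (fun n => ?_) h1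
    refine (truncMean_sum_le g.range fun v => (hm n v).const_mul v).trans ?_
    exact Finset.sum_le_sum fun v _ => truncMean_const_mul_le v (hm n v)

theorem exists_truncMean_sub_le_of_tendstoInMeasure {ξ : ℕ → Ω → ℝ} {J : Ω → ℝ}
    (hξ : ∀ n, AEMeasurable (ξ n) P) (h : TendstoInMeasure P ξ atTop J) {η : ℝ} (hη : 0 < η) :
    ∃ N, ∀ m ≥ N, ∀ n ≥ N, truncMean P (fun ω => ξ m ω - ξ n ω) ≤ η := by
  have hJ : AEMeasurable J P := h.aemeasurable hξ
  obtain ⟨N, hN⟩ := eventually_atTop.1 (((tendstoInMeasure_iff_truncMean hξ hJ).1 h).eventually_lt_const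
    (half_pos hη))
  refine ⟨N, fun m hm n hn => ?_⟩
  have := truncMean_sub_le ((hξ m).sub hJ) ((hξ n).sub hJ)
  simp only [Pi.sub_apply, sub_sub_sub_cancel_right] at this
  have h1 := hN m hm
  have h2 := hN n hn
  exact this.trans (by
    show truncMean P (fun ω => ξ m ω - J ω) + truncMean P (fun ω => ξ n ω - J ω) ≤ η
    linarith)

/-- The integral with respect to a stochastic measure does not depend on the approximating sequence
of simple functions. -/
theorem HasIntegral.unique {μ : StochasticMeasure X P} {f : X → ℝ} {I I' : Ω → ℝ}
    (h : μ.HasIntegral f I) (h' : μ.HasIntegral f I') : ∀ᵐ ω ∂P, I ω = I' ω := by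
  obtain ⟨g, hgf, hgA, hgI⟩ := h
  obtain ⟨g', hgf', hgA', hgI'⟩ := h'
  set u : ℕ → SimpleFunc X ℝ := fun n => g n - g' n with hu
  have hm : ∀ {A : Set X}, MeasurableSet A → ∀ g : SimpleFunc X ℝ,
    AEMeasurable (μ.simpleIntegral A g) P := fun hA g => μ.aemeasurable_simpleIntegral hA g
  have hI : AEMeasurable I P := hgI.aemeasurable fun n => hm .univ _
  have hI' : AEMeasurable I' P := hgI'.aemeasurable fun n => hm .univ _
  have hcauchy : ∀ A, MeasurableSet A → ∀ η > 0, ∃ N, ∀ m ≥ N, ∀ n ≥ N, truncMean P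
      (fun ω => (μ.withSimpleDensity (u m)).val A ω - (μ.withSimpleDensity (u n)).val A ω) ≤ η := by
    intro A hA η hη
    obtain ⟨J, hJ⟩ := hgA A hA
    obtain ⟨J', hJ'⟩ := hgA' A hA
    obtain ⟨N, hN⟩ := exists_truncMean_sub_le_of_tendstoInMeasure (fun n => hm hA _) hJ (half_pos hη)
    obtain ⟨N', hN'⟩ := exists_truncMean_sub_le_of_tendstoInMeasure (fun n => hm hA _) hJ'
      (half_pos hη)
    refine ⟨max N N', fun m hm' n hn' => ?_⟩
    have h1 := hN m ((le_max_left _ _).trans hm') n ((le_max_left _ _).trans hn')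
    have h2 := hN' m ((le_max_right _ _).trans hm') n ((le_max_right _ _).trans hn')
    have h3 := truncMean_sub_le ((hm hA (g m)).sub (hm hA (g n))) ((hm hA (g' m)).sub (hm hA (g' n)))
    refine le_trans (le_of_eq (truncMean_congr ?_)) (h3.trans (show _ ≤ η from ?_))
    · filter_upwards [μ.simpleIntegral_sub hA (g m) (g' m), μ.simpleIntegral_sub hA (g n) (g' n)]
        with ω e1 e2
      simp only [withSimpleDensity, hu, Pi.sub_apply]
      rw [e1, e2]
      ring
    · show truncMean P (fun ω => μ.simpleIntegral A (g m) ω - μ.simpleIntegral A (g n) ω) +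
        truncMean P (fun ω => μ.simpleIntegral A (g' m) ω - μ.simpleIntegral A (g' n) ω) ≤ η
      linarith
  have hzero : ∀ η > 0, ∀ᶠ n in atTop, truncMean P (μ.simpleIntegral Set.univ (u n)) ≤ 3 * η := by
    intro η hη
    obtain ⟨C, hC0, hC⟩ := μ.exists_simpleIntegral_bound hη
    -- off the set `A m` below, `|u n| ≤ ε` for `n ≥ m`, so that the integral is at most `ε * C = η`
    -- outside an event of probability `η`; on `A m` it is small by Nikodym's theorem
    set ε : ℝ := η / C with hε
    have hε0 : 0 < ε := by positivity
    set A : ℕ → Set X := fun m => ⋃ n ≥ m, {x | ε < |u n x|} with hA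
    have hAm : ∀ m, MeasurableSet (A m) := fun m => .iUnion fun n => .iUnion fun _ =>
      measurableSet_lt measurable_const (u n).measurable.abs
    have hanti : Antitone A := fun m n hmn =>
      Set.biUnion_subset_biUnion_left fun k (hk : n ≤ k) => hmn.trans hk
    have hemp : ⋂ m, A m = ∅ := by
      rw [Set.eq_empty_iff_forall_notMem]
      intro x hx
      have h0 : Tendsto (fun n => u n x) atTop (𝓝 0) := by
        have := (hgf x).sub (hgf' x)
        rw [sub_self] at this
        exact this
      obtain ⟨m, hm'⟩ := Metric.tendsto_atTop.1 h0 ε hε0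
      obtain ⟨n, hn, hlt⟩ := Set.mem_iUnion₂.1 (Set.mem_iInter.1 hx m)
      have := hm' n hn
      rw [Real.dist_0_eq_abs] at this
      exact lt_asymm this hlt
    obtain ⟨m, hm'⟩ := exists_forall_truncMean_le_of_cauchy (fun n => μ.withSimpleDensity (u n))
      hcauchy hAm hanti hemp hη
    filter_upwards [eventually_ge_atTop m] with n hn
    have h1 : truncMean P (μ.simpleIntegral (A m) (u n)) ≤ η := hm' n
    have h2 : truncMean P (μ.simpleIntegral (A m)ᶜ (u n)) ≤ 2 * η := by
      have hb := hC (A m)ᶜ (u n) ε (hAm m).compl hε0 fun x hx => by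
        by_contra! hcon
        exact hx (Set.mem_iUnion₂.2 ⟨n, hn, hcon⟩)
      rw [show ε * C = η by rw [hε]; field_simp] at hb
      linarith [truncMean_le_add_measureReal (hm (hAm m).compl (u n)) hη.le]
    have h3 := truncMean_add_le (hm (hAm m) (u n)) (hm (hAm m).compl (u n))
    have h4 := μ.simpleIntegral_union (hAm m) (hAm m).compl disjoint_compl_right (u n)
    rw [Set.union_compl_self] at h4
    rw [truncMean_congr h4]
    linarith
  have hle : truncMean P (fun ω => I ω - I' ω) ≤ 0 := by
    refine le_of_forall_pos_le_add fun η hη => ?_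
    have t1 := (tendstoInMeasure_iff_truncMean (fun n => hm .univ (g n)) hI).1 hgI
    have t2 := (tendstoInMeasure_iff_truncMean (fun n => hm .univ (g' n)) hI').1 hgI'
    obtain ⟨n, hn1, hn2, hn3⟩ := ((t1.eventually_lt_const (show 0 < η / 5 by positivity)).and
      ((t2.eventually_lt_const (show 0 < η / 5 by positivity)).and
        (hzero (η / 5) (by positivity)))).exists
    have s1 := truncMean_sub_le (hm .univ (u n)) ((hm .univ (g n)).sub hI)
    have s2 := truncMean_add_le ((hm .univ (u n)).sub ((hm .univ (g n)).sub hI))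
      ((hm .univ (g' n)).sub hI')
    have e : truncMean P (fun ω => I ω - I' ω) = truncMean P (fun ω =>
        (μ.simpleIntegral Set.univ (u n) - (μ.simpleIntegral Set.univ (g n) - I)) ω +
          (μ.simpleIntegral Set.univ (g' n) - I') ω) := by
      refine truncMean_congr ?_
      filter_upwards [μ.simpleIntegral_sub .univ (g n) (g' n)] with ω hω
      simp only [Pi.sub_apply, hu]
      rw [hω]
      ring
    have s1' : truncMean P (μ.simpleIntegral Set.univ (u n) -
        (μ.simpleIntegral Set.univ (g n) - I)) ≤ 3 * (η / 5) + η / 5 :=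
      s1.trans (add_le_add hn3 hn1.le)
    have s3 : truncMean P (μ.simpleIntegral Set.univ (g' n) - I') < η / 5 := hn2
    rw [e]
    linarith
  filter_upwards [ae_eq_zero_of_truncMean_le_zero (hI.sub hI') hle] with ω hω
  exact sub_eq_zero.1 hω

end StochasticMeasure

/-! ### The Haar kernel -/

/-- The kernel `∑_{n ≤ 2^k} χ_n(x) χ_n(t)` of the one-dimensional Haar partial sum. -/
noncomputable def haarKernel (k : ℕ) (x t : ℝ) : ℝ :=
  ∑ n ∈ Finset.Icc 1 (2 ^ k), haar n x * haar n t

/-- The weight that a point `x` of `[0,1]` gives to the interval `(a, b)`: interior points have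
weight one, the endpoints one half, unless they are endpoints of `[0,1]`. -/
noncomputable def cellWeight (a b x : ℝ) : ℝ :=
  if a < x ∧ x < b then 1
  else if x = a then (if a = 0 then 1 else 1 / 2)
  else if x = b then (if b = 1 then 1 else 1 / 2)
  else 0

theorem haar_one (x : ℝ) : haar 1 x = 1 := by simp [haar]

/-- The Haar function of level `k` on the dyadic interval `[a, b]` of index `i`, with `i` counted
from `0`. -/
theorem haar_two_pow_add {k i : ℕ} (hi : i < 2 ^ k) (x : ℝ) {a b m h : ℝ} (ha : a = i / 2 ^ k)
    (hb : b = (i + 1) / 2 ^ k) (hm : m = (a + b) / 2) (hh : h = (2 : ℝ) ^ ((k : ℝ) / 2)) :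
    haar (2 ^ k + i + 1) x =
      if a < x ∧ x < m then h
      else if m < x ∧ x < b then -h
      else if x = a then (if a = 0 then h else h / 2)
      else if x = b then (if b = 1 then -h else -h / 2)
      else 0 := by
  have hpos : 0 < 2 ^ k := by positivity
  have hlog : Nat.log 2 (2 ^ k + i + 1 - 1) = k := by
    rw [Nat.add_sub_cancel]
    exact Nat.log_eq_of_pow_le_of_lt_pow (by omega) (by rw [pow_succ]; omega)
  have hidx : 2 ^ k + i + 1 - 2 ^ k = i + 1 := by omega
  have e1 : (((i + 1 : ℕ) : ℝ) - 1) / 2 ^ k = a := by rw [ha]; push_cast; ring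
  have e2 : ((i + 1 : ℕ) : ℝ) / 2 ^ k = b := by rw [hb]; push_cast; ring
  rw [haar, if_neg (by omega)]
  simp only [hlog, hidx, e1, e2, ← hm, ← hh]

theorem haar_eq_zero_of_notMem {k i : ℕ} (hi : i < 2 ^ k) {x : ℝ}
    (hx : x < i / 2 ^ k ∨ (i + 1) / 2 ^ k < x) : haar (2 ^ k + i + 1) x = 0 := by
  rw [haar_two_pow_add hi x rfl rfl rfl rfl]
  have hab : (i : ℝ) / 2 ^ k < (i + 1) / 2 ^ k := by gcongr; linarith
  set a : ℝ := (i : ℝ) / 2 ^ k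
  set b : ℝ := ((i : ℝ) + 1) / 2 ^ k
  have h1 : ¬(a < x ∧ x < (a + b) / 2) := fun h => by rcases hx with hx | hx <;> linarith [h.1, h.2]
  have h2 : ¬((a + b) / 2 < x ∧ x < b) := fun h => by rcases hx with hx | hx <;> linarith [h.1, h.2]
  have h3 : x ≠ a := fun h => by rcases hx with hx | hx <;> linarith
  have h4 : x ≠ b := fun h => by rcases hx with hx | hx <;> linarith
  rw [if_neg h1, if_neg h2, if_neg h3, if_neg h4]

theorem sum_Icc_one_eq_sum_range (N : ℕ) (F : ℕ → ℝ) :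
    ∑ n ∈ Finset.Icc 1 N, F n = ∑ i ∈ Finset.range N, F (i + 1) := by
  rw [Finset.range_eq_Ico, Finset.sum_Ico_add' F 0 N 1]
  rfl

theorem haarKernel_succ (k : ℕ) (x t : ℝ) : haarKernel (k + 1) x t = haarKernel k x t +
    ∑ i ∈ Finset.range (2 ^ k), haar (2 ^ k + i + 1) x * haar (2 ^ k + i + 1) t := by
  rw [haarKernel, haarKernel, sum_Icc_one_eq_sum_range, sum_Icc_one_eq_sum_range, pow_succ, mul_two,
    Finset.sum_range_add]

/-- On passing to the left half of a dyadic interval, the normalized weight changes by the Haar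
function of that interval, including the values at the endpoints. -/
theorem cellWeight_left {a b m x : ℝ} (ha : 0 ≤ a) (hb : b ≤ 1) (hab : a < b) (hm : m = (a + b) / 2) :
    2 * cellWeight a m x = cellWeight a b x +
      (if a < x ∧ x < m then 1
      else if m < x ∧ x < b then -1
      else if x = a then (if a = 0 then 1 else 1 / 2)
      else if x = b then (if b = 1 then -1 else -1 / 2)
      else 0) := by
  have h1 : a < m := by linarith
  have h2 : m < b := by linarith
  have hm1 : m ≠ 1 := by linarith
  unfold cellWeight
  rcases lt_trichotomy x a with h | rfl | h
  · simp [h.not_gt, h.ne, (h.trans h1).not_gt, (h.trans h1).ne, (h.trans hab).ne]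
  · by_cases hx : x = 0
    · subst hx
      simp [h1.not_gt]; norm_num
    · simp [hx, h1.not_gt]; norm_num
  · rcases lt_trichotomy x m with h' | rfl | h'
    · simp [h, h', h'.trans h2]; norm_num
    · simp [h.ne', hm1, h2, h2.ne, h]
    · rcases lt_trichotomy x b with h'' | rfl | h''
      · simp [h, h', h'', h'.not_gt, h.ne', h'.ne']
      · by_cases hx : x = 1
        · subst hx
          simp [h'.not_gt, h.ne', h'.ne']
        · simp [hx, h'.not_gt, h.ne', h'.ne']; norm_num
      · simp [h, h'.not_gt, h''.not_gt, h.ne', h'.ne', h''.ne']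

/-- On passing to the right half of a dyadic interval, the Haar function of that interval is
subtracted from the normalized weight. -/
theorem cellWeight_right {a b m x : ℝ} (ha : 0 ≤ a) (hb : b ≤ 1) (hab : a < b)
    (hm : m = (a + b) / 2) :
    2 * cellWeight m b x = cellWeight a b x -
      (if a < x ∧ x < m then 1
      else if m < x ∧ x < b then -1
      else if x = a then (if a = 0 then 1 else 1 / 2)
      else if x = b then (if b = 1 then -1 else -1 / 2)
      else 0) := by
  have h1 : a < m := by linarith
  have h2 : m < b := by linarith
  have hm0 : m ≠ 0 := by linarith
  unfold cellWeight
  rcases lt_trichotomy x a with h | rfl | h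
  · simp [h.not_gt, h.ne, (h.trans h1).not_gt, (h.trans h1).ne, (h.trans hab).ne]
  · by_cases hx : x = 0
    · subst hx
      simp [h1.not_gt, h1.ne, hab.ne]
    · simp [hx, h1.not_gt, h1.ne, hab.ne]
  · rcases lt_trichotomy x m with h' | rfl | h'
    · simp [h, h', h'.trans h2, h'.not_gt, h'.ne, (h'.trans h2).ne]
    · simp [h.ne', hm0, h2, h2.ne, h]
    · rcases lt_trichotomy x b with h'' | rfl | h''
      · simp [h, h', h'', h'.not_gt]; norm_num
      · by_cases hx : x = 1
        · subst hx
          simp [h'.not_gt, h.ne', h'.ne']; norm_num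
        · simp [hx, h'.not_gt, h.ne', h'.ne']; norm_num
      · simp [h, h'.not_gt, h''.not_gt, h.ne', h'.ne', h''.ne']

/-- For `t` off the dyadic points of level `k`, the kernel is the normalized weight of the dyadic
interval that contains `t`: its indicator function, up to the values at the endpoints. -/
theorem haarKernel_eq_cellWeight (k : ℕ) {i : ℕ} (hi : i < 2 ^ k) {x t : ℝ}
    (hx : x ∈ Set.Icc (0 : ℝ) 1) (ht : (i : ℝ) / 2 ^ k < t) (ht' : t < (i + 1) / 2 ^ k) :
    haarKernel k x t = 2 ^ k * cellWeight (i / 2 ^ k) ((i + 1) / 2 ^ k) x := by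
  induction k generalizing i with
  | zero =>
    obtain rfl : i = 0 := by simpa using hi
    have : cellWeight 0 1 x = 1 := by
      unfold cellWeight
      rcases hx.1.eq_or_lt with h | h
      · simp [← h]
      · rcases hx.2.eq_or_lt with h' | h'
        · simp [h']
        · simp [h, h']
    simp [haarKernel, haar_one, this]
  | succ k ih =>
    obtain ⟨p, hp⟩ : ∃ p, i = 2 * p ∨ i = 2 * p + 1 := ⟨i / 2, by omega⟩
    have hpk : p < 2 ^ k := by rw [pow_succ] at hi; omega
    set a : ℝ := (p : ℝ) / 2 ^ k with ha
    set b : ℝ := ((p : ℝ) + 1) / 2 ^ k with hb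
    set m : ℝ := (a + b) / 2 with hm
    have hab : a < b := by rw [ha, hb]; gcongr; linarith
    have ha0 : 0 ≤ a := by positivity
    have hb1 : b ≤ 1 := by
      rw [hb, div_le_one (by positivity)]
      exact_mod_cast hpk
    have hmid : m = (2 * p + 1) / 2 ^ (k + 1) := by
      rw [hm, ha, hb, pow_succ]; field_simp; ring
    have ha' : (2 * p : ℝ) / 2 ^ (k + 1) = a := by rw [ha, pow_succ]; field_simp
    have hb' : (2 * p + 1 + 1 : ℝ) / 2 ^ (k + 1) = b := by rw [hb, pow_succ]; field_simp; ring
    set h : ℝ := (2 : ℝ) ^ ((k : ℝ) / 2) with hh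
    have hsq : h * h = 2 ^ k := by
      rw [hh, ← Real.rpow_add two_pos, add_halves, Real.rpow_natCast]
    -- the function `χ_{2^k + p + 1}` in the normalization of `cellWeight_left`
    have hX : haar (2 ^ k + p + 1) x = h * (if a < x ∧ x < m then 1
        else if m < x ∧ x < b then -1
        else if x = a then (if a = 0 then 1 else 1 / 2)
        else if x = b then (if b = 1 then -1 else -1 / 2)
        else 0) := by
      rw [haar_two_pow_add hpk x ha hb hm hh]
      split_ifs <;> ring
    have hsingle : ∀ {t : ℝ}, a < t → t < b →
        ∑ i ∈ Finset.range (2 ^ k), haar (2 ^ k + i + 1) x * haar (2 ^ k + i + 1) t =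
          haar (2 ^ k + p + 1) x * haar (2 ^ k + p + 1) t := by
      intro t hat htb
      refine Finset.sum_eq_single p (fun r hr hrp => ?_) fun h => absurd (Finset.mem_range.2 hpk) h
      refine mul_eq_zero_of_right _ (haar_eq_zero_of_notMem (Finset.mem_range.1 hr) ?_)
      rcases lt_or_gt_of_ne hrp with hlt | hlt
      · right
        refine lt_of_le_of_lt ?_ hat
        rw [ha]
        gcongr
        exact_mod_cast hlt
      · left
        refine htb.trans_le ?_
        rw [hb]
        gcongr
        exact_mod_cast hlt
    rcases hp with rfl | rfl
    · push_cast at ht ht' ⊢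
      rw [ha'] at ht ⊢
      rw [← hmid] at ht' ⊢
      have htb : t < b := ht'.trans (by linarith)
      have hT : haar (2 ^ k + p + 1) t = h := by
        rw [haar_two_pow_add hpk t ha hb hm hh, if_pos ⟨ht, ht'⟩]
      rw [haarKernel_succ, ih hpk ht htb, hsingle ht htb, hT, hX, ← ha, ← hb,
        pow_succ, mul_assoc (2 ^ k : ℝ), cellWeight_left ha0 hb1 hab hm, ← hsq]
      ring
    · push_cast at ht ht' ⊢
      rw [hb'] at ht' ⊢
      rw [← hmid] at ht ⊢
      have hta : a < t := lt_trans (by linarith) ht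
      have hT : haar (2 ^ k + p + 1) t = -h := by
        rw [haar_two_pow_add hpk t ha hb hm hh, if_neg fun h => lt_asymm ht h.2, if_pos ⟨ht, ht'⟩]
      rw [haarKernel_succ, ih hpk hta ht', hsingle hta ht', hT, hX, ← ha, ← hb,
        pow_succ, mul_assoc (2 ^ k : ℝ), cellWeight_right ha0 hb1 hab hm, ← hsq]
      ring

theorem cellWeight_nonneg (a b x : ℝ) : 0 ≤ cellWeight a b x := by
  unfold cellWeight
  split_ifs <;> norm_num

theorem cellWeight_eq_zero {a b x : ℝ} (hab : a ≤ b) (h : x < a ∨ b < x) : cellWeight a b x = 0 := by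
  unfold cellWeight
  have h1 : ¬(a < x ∧ x < b) := fun h' => by rcases h with h | h <;> linarith [h'.1, h'.2]
  have h2 : x ≠ a := fun h' => by rcases h with h | h <;> linarith
  have h3 : x ≠ b := fun h' => by rcases h with h | h <;> linarith
  rw [if_neg h1, if_neg h2, if_neg h3]

theorem exists_cell_of_ne (k : ℕ) {t : ℝ} (ht : t ∈ Set.Icc (0 : ℝ) 1)
    (hne : ∀ p ∈ Finset.range (2 ^ k + 1), t ≠ (p : ℝ) / 2 ^ k) :
    ∃ i : ℕ, i < 2 ^ k ∧ (i : ℝ) / 2 ^ k < t ∧ t < (i + 1) / 2 ^ k := by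
  have h2 : (0 : ℝ) < 2 ^ k := by positivity
  have hle : ⌊t * 2 ^ k⌋₊ ≤ 2 ^ k := by
    refine Nat.floor_le_of_le ?_
    push_cast
    nlinarith [ht.2]
  have h3 : (⌊t * 2 ^ k⌋₊ : ℝ) / 2 ^ k ≤ t := by
    rw [div_le_iff₀ h2]
    exact Nat.floor_le (mul_nonneg ht.1 h2.le)
  have h4 : t < (⌊t * 2 ^ k⌋₊ + 1) / 2 ^ k := by
    rw [lt_div_iff₀ h2]
    exact Nat.lt_floor_add_one _
  have h5 := lt_of_le_of_ne h3 (hne _ (Finset.mem_range.2 (by omega))).symm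
  refine ⟨⌊t * 2 ^ k⌋₊, lt_of_le_of_ne hle fun h => ?_, h5, h4⟩
  rw [h] at h5
  push_cast at h5
  rw [div_self h2.ne'] at h5
  linarith [ht.2]

theorem haarKernel_nonneg {k : ℕ} {x t : ℝ} (hx : x ∈ Set.Icc (0 : ℝ) 1) (ht : t ∈ Set.Icc (0 : ℝ) 1)
    (hne : ∀ p ∈ Finset.range (2 ^ k + 1), t ≠ (p : ℝ) / 2 ^ k) : 0 ≤ haarKernel k x t := by
  obtain ⟨i, hi, h1, h2⟩ := exists_cell_of_ne k ht hne
  rw [haarKernel_eq_cellWeight k hi hx h1 h2]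
  exact mul_nonneg (by positivity) (cellWeight_nonneg _ _ _)

theorem haarKernel_eq_zero {k : ℕ} {x t : ℝ} (hx : x ∈ Set.Icc (0 : ℝ) 1)
    (ht : t ∈ Set.Icc (0 : ℝ) 1) (hne : ∀ p ∈ Finset.range (2 ^ k + 1), t ≠ (p : ℝ) / 2 ^ k)
    (hxt : 1 / 2 ^ k < |t - x|) : haarKernel k x t = 0 := by
  obtain ⟨i, hi, h1, h2⟩ := exists_cell_of_ne k ht hne
  rw [haarKernel_eq_cellWeight k hi hx h1 h2, cellWeight_eq_zero (h1.trans h2).le, mul_zero]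
  rw [add_div] at h2 ⊢
  rcases lt_abs.1 hxt with h | h
  · left; linarith
  · right; linarith

theorem exists_abs_haar_le (n : ℕ) : ∃ B, ∀ x, |haar n x| ≤ B := by
  obtain ⟨B, hB⟩ := ((finite_range_haar n).image abs).bddAbove
  exact ⟨B, fun x => hB ⟨_, ⟨x, rfl⟩, rfl⟩⟩

theorem integrableOn_haar (n : ℕ) : IntegrableOn (haar n) (Set.Icc 0 1) := by
  obtain ⟨B, hB⟩ := exists_abs_haar_le n
  exact Measure.integrableOn_of_bounded (by simp) (measurable_haar n).aestronglyMeasurable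
    (.of_forall hB)

theorem integral_haar_two_pow_add {k i : ℕ} (hi : i < 2 ^ k) :
    ∫ t in Set.Icc (0 : ℝ) 1, haar (2 ^ k + i + 1) t = 0 := by
  set a : ℝ := (i : ℝ) / 2 ^ k with ha
  set b : ℝ := ((i : ℝ) + 1) / 2 ^ k with hb
  set m : ℝ := (a + b) / 2 with hm
  set h : ℝ := (2 : ℝ) ^ ((k : ℝ) / 2) with hh
  have hab : a < b := by rw [ha, hb]; gcongr; linarith
  have ha0 : 0 ≤ a := by positivity
  have hb1 : b ≤ 1 := by
    rw [hb, div_le_one (by positivity)]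
    exact_mod_cast hi
  have hae : ∀ᵐ t ∂(volume.restrict (Set.Icc (0 : ℝ) 1)), haar (2 ^ k + i + 1) t =
      (Set.Ioo a m).indicator (fun _ => h) t - (Set.Ioo m b).indicator (fun _ => h) t := by
    refine ae_restrict_of_ae ?_
    filter_upwards [Measure.ae_ne volume a, Measure.ae_ne volume b] with t hta htb
    rw [haar_two_pow_add hi t ha hb hm hh, if_neg hta, if_neg htb]
    by_cases h1 : a < t ∧ t < m
    · have h2 : t ∉ Set.Ioo m b := fun h => lt_asymm h1.2 h.1
      rw [if_pos h1, Set.indicator_of_mem (show t ∈ Set.Ioo a m from h1), Set.indicator_of_notMem h2,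
        sub_zero]
    · rw [if_neg h1, Set.indicator_of_notMem (show t ∉ Set.Ioo a m from h1)]
      by_cases h2 : m < t ∧ t < b
      · rw [if_pos h2, Set.indicator_of_mem (show t ∈ Set.Ioo m b from h2), zero_sub]
      · rw [if_neg h2, Set.indicator_of_notMem (show t ∉ Set.Ioo m b from h2), sub_zero]
  have hint : ∀ u v : ℝ, Integrable ((Set.Ioo u v).indicator fun _ => h)
      (volume.restrict (Set.Icc (0 : ℝ) 1)) := fun u v =>
    (integrable_const h).indicator measurableSet_Ioo
  have hval : ∀ u v : ℝ, 0 ≤ u → u ≤ v → v ≤ 1 →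
      ∫ t in Set.Icc (0 : ℝ) 1, (Set.Ioo u v).indicator (fun _ => h) t = (v - u) * h := by
    intro u v hu huv hv
    rw [integral_indicator measurableSet_Ioo, Measure.restrict_restrict measurableSet_Ioo,
      Set.inter_eq_left.2 (Set.Ioo_subset_Icc_self.trans (Set.Icc_subset_Icc hu hv)),
      setIntegral_const, Real.volume_real_Ioo_of_le huv, smul_eq_mul]
  rw [integral_congr_ae hae, integral_sub (hint _ _) (hint _ _),
    hval a m ha0 (by linarith) (by linarith), hval m b (by linarith) (by linarith) hb1, hm]
  ring

theorem integrableOn_haarKernel (k : ℕ) (x : ℝ) : IntegrableOn (haarKernel k x) (Set.Icc 0 1) :=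
  integrable_finsetSum _ fun n _ => (integrableOn_haar n).const_mul _

theorem integral_haarKernel (k : ℕ) (x : ℝ) : ∫ t in Set.Icc (0 : ℝ) 1, haarKernel k x t = 1 := by
  induction k with
  | zero => simp [haarKernel, haar_one]
  | succ k ih =>
    simp only [haarKernel_succ]
    rw [integral_add (integrableOn_haarKernel k x)
      (integrable_finsetSum _ fun n _ => (integrableOn_haar _).const_mul _), ih,
      integral_finsetSum _ fun n _ => (integrableOn_haar _).const_mul _]
    rw [Finset.sum_eq_zero, add_zero]
    intro i hi
    rw [integral_const_mul, integral_haar_two_pow_add (Finset.mem_range.1 hi), mul_zero]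

/-! ### Fourier–Haar sums on the cube -/

section unitCube

variable {d : ℕ}

theorem unitCube_eq_preimage : unitCube d =
    (MeasurableEquiv.toLp 2 (Fin d → ℝ)).symm ⁻¹' Set.univ.pi fun _ => Set.Icc (0 : ℝ) 1 := by
  ext x
  exact ⟨fun h s _ => h s, fun h s => h s trivial⟩

theorem measurableSet_unitCube : MeasurableSet (unitCube d) := by
  rw [unitCube_eq_preimage]
  exact (MeasurableEquiv.measurable _) (.univ_pi fun _ => measurableSet_Icc)

theorem isCompact_unitCube : IsCompact (unitCube d) := by
  have : unitCube d = WithLp.toLp 2 '' Set.univ.pi fun _ : Fin d => Set.Icc (0 : ℝ) 1 := by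
    ext x
    constructor
    · exact fun h => ⟨x.ofLp, fun s _ => h s, rfl⟩
    · rintro ⟨y, hy, rfl⟩ s
      exact hy s trivial
  rw [this]
  exact (isCompact_univ_pi fun _ => isCompact_Icc).image (PiLp.continuous_toLp 2 _)

theorem convex_unitCube : Convex ℝ (unitCube d) := by
  intro x hx y hy a b ha hb hab s
  exact convex_Icc (0 : ℝ) 1 (hx s) (hy s) ha hb hab

theorem uniqueDiffOn_unitCube : UniqueDiffOn ℝ (unitCube d) := by
  refine uniqueDiffOn_convex convex_unitCube ?_
  refine ⟨WithLp.toLp 2 fun _ => 1 / 2, ?_⟩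
  rw [mem_interior]
  refine ⟨{x | ∀ s, x s ∈ Set.Ioo (0 : ℝ) 1}, fun x hx s => Set.Ioo_subset_Icc_self (hx s), ?_,
    fun s => ⟨by norm_num, by norm_num⟩⟩
  have : {x : EuclideanSpace ℝ (Fin d) | ∀ s, x s ∈ Set.Ioo (0 : ℝ) 1} =
      ⋂ s, (fun x : EuclideanSpace ℝ (Fin d) => x s) ⁻¹' Set.Ioo 0 1 := by
    ext x; simp
  rw [this]
  exact isOpen_iInter_of_finite fun s => isOpen_Ioo.preimage (by fun_prop)

/-- Lebesgue measure on the cube is the product measure, in the coordinates of `EuclideanSpace`. -/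
theorem measurePreserving_unitCube : MeasurePreserving (MeasurableEquiv.toLp 2 (Fin d → ℝ)).symm
    (volume.restrict (unitCube d))
    (Measure.pi fun _ : Fin d => volume.restrict (Set.Icc (0 : ℝ) 1)) := by
  rw [unitCube_eq_preimage, ← Measure.restrict_pi_pi]
  exact (EuclideanSpace.volume_preserving_symm_measurableEquiv_toLp (Fin d)).restrict_preimage
    (.univ_pi fun _ => measurableSet_Icc)

theorem integral_unitCube_prod (F : Fin d → ℝ → ℝ) :
    ∫ t in unitCube d, ∏ s, F s (t s) = ∏ s, ∫ u in Set.Icc (0 : ℝ) 1, F s u := by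
  rw [← integral_fintype_prod_eq_prod,
    ← measurePreserving_unitCube.integral_comp (MeasurableEquiv.measurableEmbedding _)]
  rfl

theorem integrableOn_unitCube_prod {F : Fin d → ℝ → ℝ}
    (hF : ∀ s, IntegrableOn (F s) (Set.Icc (0 : ℝ) 1)) :
    IntegrableOn (fun t : EuclideanSpace ℝ (Fin d) => ∏ s, F s (t s)) (unitCube d) := by
  have := Integrable.fintype_prod hF
  exact (measurePreserving_unitCube.integrable_comp_emb
    (MeasurableEquiv.measurableEmbedding _)).2 this

theorem ae_unitCube_ne (s : Fin d) (v : ℝ) :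
    ∀ᵐ t ∂(volume.restrict (unitCube d)), t s ≠ v := by
  have h : ∀ᵐ u ∂(Measure.pi fun _ : Fin d => volume.restrict (Set.Icc (0 : ℝ) 1)), u s ≠ v :=
    (Measure.quasiMeasurePreserving_eval (μ := fun _ : Fin d => volume.restrict (Set.Icc (0 : ℝ) 1))
      s).ae (Measure.ae_ne _ v)
  exact measurePreserving_unitCube.quasiMeasurePreserving.ae h

theorem haarSum_apply (k : ℕ) (g : EuclideanSpace ℝ (Fin d) → ℝ) (x : unitCube d) :
    haarSum k g x = ∑ n ∈ Fintype.piFinset (fun _ : Fin d => Finset.Icc 1 (2 ^ k)),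
      haarCoeff g n * ∏ s, haar (n s) (x.1 s) :=
  sum_smul_simpleFunc_apply _ _ _ _

theorem integrableOn_mul_prod_haar {g : EuclideanSpace ℝ (Fin d) → ℝ}
    (hg : ContinuousOn g (unitCube d)) (n : Fin d → ℕ) :
    IntegrableOn (fun t => g t * ∏ s, haar (n s) (t s)) (unitCube d) := by
  obtain ⟨B, hB⟩ := isCompact_unitCube.exists_bound_of_continuousOn hg
  refine Integrable.bdd_mul (c := B) (integrableOn_unitCube_prod fun s => integrableOn_haar (n s))
    (hg.aestronglyMeasurable measurableSet_unitCube) ?_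
  exact (ae_restrict_iff' measurableSet_unitCube).2 (.of_forall hB)

theorem integrableOn_mul_prod_haarKernel {g : EuclideanSpace ℝ (Fin d) → ℝ}
    (hg : ContinuousOn g (unitCube d)) (k : ℕ) (x : Fin d → ℝ) :
    IntegrableOn (fun t => g t * ∏ s, haarKernel k (x s) (t s)) (unitCube d) := by
  obtain ⟨B, hB⟩ := isCompact_unitCube.exists_bound_of_continuousOn hg
  refine Integrable.bdd_mul (c := B)
    (integrableOn_unitCube_prod fun s => integrableOn_haarKernel k (x s))
    (hg.aestronglyMeasurable measurableSet_unitCube) ?_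
  exact (ae_restrict_iff' measurableSet_unitCube).2 (.of_forall hB)

theorem haarSum_eq_integral {g : EuclideanSpace ℝ (Fin d) → ℝ} (hg : ContinuousOn g (unitCube d))
    (k : ℕ) (x : unitCube d) :
    haarSum k g x = ∫ t in unitCube d, g t * ∏ s, haarKernel k (x.1 s) (t s) := by
  have : ∀ t : EuclideanSpace ℝ (Fin d), g t * ∏ s, haarKernel k (x.1 s) (t s) =
      ∑ n ∈ Fintype.piFinset (fun _ : Fin d => Finset.Icc 1 (2 ^ k)),
        (g t * ∏ s, haar (n s) (t s)) * ∏ s, haar (n s) (x.1 s) := by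
    intro t
    simp only [haarKernel]
    rw [Finset.prod_univ_sum, Finset.mul_sum]
    refine Finset.sum_congr rfl fun n _ => ?_
    rw [Finset.prod_mul_distrib]
    ring
  simp only [this]
  rw [integral_finsetSum _ fun n _ => (integrableOn_mul_prod_haar hg n).mul_const _, haarSum_apply]
  refine Finset.sum_congr rfl fun n _ => ?_
  rw [integral_mul_const, haarCoeff]

theorem haarSum_sub {g h : EuclideanSpace ℝ (Fin d) → ℝ} (hg : ContinuousOn g (unitCube d))
    (hh : ContinuousOn h (unitCube d)) (k : ℕ) (x : unitCube d) :
    haarSum k (fun t => g t - h t) x = haarSum k g x - haarSum k h x := by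
  rw [haarSum_eq_integral (g := fun t => g t - h t) (hg.sub hh), haarSum_eq_integral hg, haarSum_eq_integral hh,
    ← integral_sub (integrableOn_mul_prod_haarKernel hg k _)
      (integrableOn_mul_prod_haarKernel hh k _)]
  simp only [sub_mul]

theorem haarSum_sum {ι : Type*} (S : Finset ι) (c : ι → ℝ)
    {g : ι → EuclideanSpace ℝ (Fin d) → ℝ} (hg : ∀ i, ContinuousOn (g i) (unitCube d)) (k : ℕ)
    (x : unitCube d) :
    haarSum k (fun t => ∑ i ∈ S, c i * g i t) x = ∑ i ∈ S, c i * haarSum k (g i) x := by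
  rw [haarSum_eq_integral (continuousOn_finsetSum _ fun i _ => (hg i).const_mul (c i))]
  simp only [Finset.sum_mul, mul_assoc]
  rw [integral_finsetSum _ fun i _ => (integrableOn_mul_prod_haarKernel (hg i) k _).const_mul _]
  refine Finset.sum_congr rfl fun i _ => ?_
  rw [integral_const_mul, haarSum_eq_integral (hg i)]

/-- The Fourier–Haar sum at `x` is an average of the values of the function at points whose
coordinates differ from those of `x` by at most `2^{-k}`, since the kernel is nonnegative almost
everywhere, has mean one and vanishes elsewhere. -/
theorem abs_haarSum_sub_le {g : EuclideanSpace ℝ (Fin d) → ℝ} (hg : ContinuousOn g (unitCube d))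
    {k : ℕ} {x : unitCube d} {c B : ℝ}
    (h : ∀ t ∈ unitCube d, (∀ s, |t s - x.1 s| ≤ 1 / 2 ^ k) → |g t - c| ≤ B) :
    |haarSum k g x - c| ≤ B := by
  have hone : ∫ t in unitCube d, ∏ s, haarKernel k (x.1 s) (t s) = 1 := by
    rw [integral_unitCube_prod fun s => haarKernel k (x.1 s)]
    simp [integral_haarKernel]
  have hint : IntegrableOn (fun t : EuclideanSpace ℝ (Fin d) => ∏ s, haarKernel k (x.1 s) (t s))
      (unitCube d) := integrableOn_unitCube_prod fun s => integrableOn_haarKernel k (x.1 s)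
  have hsub : haarSum k g x - c =
      ∫ t in unitCube d, (g t - c) * ∏ s, haarKernel k (x.1 s) (t s) := by
    simp only [sub_mul]
    rw [integral_sub (integrableOn_mul_prod_haarKernel hg k _) (hint.const_mul c),
      integral_const_mul, hone, haarSum_eq_integral hg, mul_one]
  have hbound : ∀ᵐ t ∂(volume.restrict (unitCube d)),
      ‖(g t - c) * ∏ s, haarKernel k (x.1 s) (t s)‖ ≤ B * ∏ s, haarKernel k (x.1 s) (t s) := by
    have hne : ∀ᵐ t ∂(volume.restrict (unitCube d)), ∀ s, ∀ p ∈ Finset.range (2 ^ k + 1),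
        t s ≠ (p : ℝ) / 2 ^ k :=
      ae_all_iff.2 fun s => (Finset.eventually_all _).2 fun p _ => ae_unitCube_ne s _
    filter_upwards [hne, ae_restrict_mem measurableSet_unitCube] with t ht htc
    have hnn : ∀ s, 0 ≤ haarKernel k (x.1 s) (t s) := fun s =>
      haarKernel_nonneg (x.2 s) (htc s) (ht s)
    rw [norm_mul, Real.norm_eq_abs, Real.norm_eq_abs,
      abs_of_nonneg (Finset.prod_nonneg fun s _ => hnn s)]
    by_cases hx : ∀ s, |t s - x.1 s| ≤ 1 / 2 ^ k
    · exact mul_le_mul_of_nonneg_right (h t htc hx) (Finset.prod_nonneg fun s _ => hnn s)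
    · push Not at hx
      obtain ⟨s, hs⟩ := hx
      rw [Finset.prod_eq_zero (Finset.mem_univ s) (haarKernel_eq_zero (x.2 s) (htc s) (ht s) hs),
        mul_zero, mul_zero]
  rw [hsub, ← Real.norm_eq_abs]
  refine (norm_integral_le_of_norm_le (hint.const_mul B) hbound).trans ?_
  rw [integral_const_mul, hone, mul_one]

end unitCube

/-! ### Dyadic grids -/

/-- The position of `u ≥ 0` relative to the grid `2^{-k} ℕ`: the code `2p` stands for the grid point
`p / 2^k`, and `2p + 1` for the open interval `(p / 2^k, (p + 1) / 2^k)`. -/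
noncomputable def gridCode (k : ℕ) (u : ℝ) : ℕ := ⌊2 ^ k * u⌋₊ + ⌈2 ^ k * u⌉₊

/-- The index of the dyadic interval of length `2^{-j}` that contains `u`; the point `1` is assigned
to the last interval of `[0,1]`. -/
noncomputable def cellIndex (j : ℕ) (u : ℝ) : ℕ := min ⌊2 ^ j * u⌋₊ (2 ^ j - 1)

theorem gridCode_le (k : ℕ) {u : ℝ} (hu : u ≤ 1) : gridCode k u ≤ 2 ^ (k + 1) := by
  have h : (2 : ℝ) ^ k * u ≤ (2 ^ k : ℕ) := by
    push_cast
    exact mul_le_of_le_one_right (by positivity) hu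
  have h1 : ⌊(2 : ℝ) ^ k * u⌋₊ ≤ 2 ^ k := Nat.floor_le_of_le h
  have h2 : ⌈(2 : ℝ) ^ k * u⌉₊ ≤ 2 ^ k := Nat.ceil_le.2 h
  rw [gridCode, pow_succ]
  omega

theorem floor_eq_of_gridCode_eq {k : ℕ} {u v : ℝ} (h : gridCode k u = gridCode k v) :
    ⌊2 ^ k * u⌋₊ = ⌊2 ^ k * v⌋₊ ∧ ⌈2 ^ k * u⌉₊ = ⌈2 ^ k * v⌉₊ := by
  have h1 := Nat.floor_le_ceil ((2 : ℝ) ^ k * u)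
  have h2 := Nat.ceil_le_floor_add_one ((2 : ℝ) ^ k * u)
  have h3 := Nat.floor_le_ceil ((2 : ℝ) ^ k * v)
  have h4 := Nat.ceil_le_floor_add_one ((2 : ℝ) ^ k * v)
  unfold gridCode at h
  omega

theorem lt_div_iff_of_gridCode_eq {k : ℕ} {u v : ℝ} (hu : 0 ≤ u) (hv : 0 ≤ v)
    (h : gridCode k u = gridCode k v) (p : ℕ) : u < p / 2 ^ k ↔ v < p / 2 ^ k := by
  have h2 : (0 : ℝ) < 2 ^ k := by positivity
  rw [lt_div_iff₀' h2, lt_div_iff₀' h2, ← Nat.floor_lt (by positivity), ← Nat.floor_lt (by positivity),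
    (floor_eq_of_gridCode_eq h).1]

theorem div_lt_iff_of_gridCode_eq {k : ℕ} {u v : ℝ}
    (h : gridCode k u = gridCode k v) (p : ℕ) : p / 2 ^ k < u ↔ p / 2 ^ k < v := by
  have h2 : (0 : ℝ) < 2 ^ k := by positivity
  rw [div_lt_iff₀' h2, div_lt_iff₀' h2, ← Nat.lt_ceil, ← Nat.lt_ceil, (floor_eq_of_gridCode_eq h).2]

/-- The Haar functions of level below `k` only depend on the position relative to the grid. -/
theorem haar_eq_of_gridCode_eq {k n : ℕ} (hn : n ≤ 2 ^ k) {u v : ℝ} (hu : 0 ≤ u) (hv : 0 ≤ v)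
    (h : gridCode k u = gridCode k v) : haar n u = haar n v := by
  rcases Nat.lt_or_ge 1 n with hn1 | hn1
  swap
  · simp [haar, hn1]
  obtain ⟨j, i, hi, rfl⟩ : ∃ j i, i < 2 ^ j ∧ n = 2 ^ j + i + 1 := by
    have h1 := Nat.pow_log_le_self 2 (show n - 1 ≠ 0 by omega)
    have h2 := Nat.lt_pow_succ_log_self (b := 2) one_lt_two (n - 1)
    rw [pow_succ] at h2
    exact ⟨Nat.log 2 (n - 1), n - 1 - 2 ^ Nat.log 2 (n - 1), by omega, by omega⟩
  have hjk : j < k := by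
    by_contra! hkj
    have := Nat.pow_le_pow_right (n := 2) two_pos hkj
    omega
  obtain ⟨r, rfl⟩ : ∃ r, k = j + r + 1 := ⟨k - j - 1, by omega⟩
  rw [haar_two_pow_add hi u rfl rfl rfl rfl, haar_two_pow_add hi v rfl rfl rfl rfl]
  set a : ℝ := (i : ℝ) / 2 ^ j with ha
  set b : ℝ := ((i : ℝ) + 1) / 2 ^ j with hb
  set m : ℝ := (a + b) / 2 with hm
  have ea : a = ((i * 2 ^ (r + 1) : ℕ) : ℝ) / 2 ^ (j + r + 1) := by
    rw [ha, add_assoc, pow_add]; push_cast; field_simp; ring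
  have eb : b = (((i + 1) * 2 ^ (r + 1) : ℕ) : ℝ) / 2 ^ (j + r + 1) := by
    rw [hb, add_assoc, pow_add]; push_cast; field_simp; ring
  have em : m = (((2 * i + 1) * 2 ^ r : ℕ) : ℝ) / 2 ^ (j + r + 1) := by
    rw [hm, ha, hb, pow_succ, pow_add]; push_cast; field_simp; ring
  have l : ∀ {c : ℝ} {p : ℕ}, c = (p : ℝ) / 2 ^ (j + r + 1) →
      ((u < c ↔ v < c) ∧ (c < u ↔ c < v) ∧ (u = c ↔ v = c)) := by
    rintro c p rfl
    have h1 := lt_div_iff_of_gridCode_eq hu hv h p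
    have h2 := div_lt_iff_of_gridCode_eq h p
    refine ⟨h1, h2, ?_⟩
    rw [le_antisymm_iff, le_antisymm_iff, ← not_lt, ← not_lt, ← not_lt, ← not_lt, h1, h2]
  simp only [(l ea).2.1, (l em).1, (l em).2.1, (l eb).1, (l ea).2.2, (l eb).2.2]

theorem cellIndex_lt (j : ℕ) (u : ℝ) : cellIndex j u < 2 ^ j := by
  have : 0 < 2 ^ j := by positivity
  unfold cellIndex
  omega

theorem cellIndex_eq_div_of_le {j k : ℕ} (hjk : j ≤ k) (u : ℝ) :
    cellIndex j u = min (⌊2 ^ k * u⌋₊ / 2 ^ (k - j)) (2 ^ j - 1) := by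
  obtain ⟨r, rfl⟩ := Nat.exists_eq_add_of_le hjk
  have : (2 : ℝ) ^ j * u = 2 ^ (j + r) * u / (2 ^ r : ℕ) := by
    rw [pow_add]; push_cast; field_simp
  rw [cellIndex, this, Nat.floor_div_natCast, Nat.add_sub_cancel_left]

theorem cellIndex_eq_of_gridCode_eq {j k : ℕ} (hjk : j ≤ k) {u v : ℝ}
    (h : gridCode k u = gridCode k v) : cellIndex j u = cellIndex j v := by
  rw [cellIndex_eq_div_of_le hjk, cellIndex_eq_div_of_le hjk, (floor_eq_of_gridCode_eq h).1]

theorem cellIndex_succ_div_two (j : ℕ) (u : ℝ) : cellIndex (j + 1) u / 2 = cellIndex j u := by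
  rw [cellIndex_eq_div_of_le j.le_succ, cellIndex]
  have : 0 < 2 ^ j := by positivity
  simp only [Nat.add_sub_cancel_left, Nat.succ_eq_add_one, pow_one]
  rw [show 2 ^ (j + 1) = 2 * 2 ^ j by ring]
  omega

theorem two_pow_mul_sub_cellIndex_mem (j : ℕ) {u : ℝ} (hu : u ∈ Set.Icc (0 : ℝ) 1) :
    2 ^ j * u - cellIndex j u ∈ Set.Icc (0 : ℝ) 1 := by
  have h0 : (0 : ℝ) ≤ 2 ^ j * u := mul_nonneg (by positivity) hu.1
  have h1 : ((min ⌊(2 : ℝ) ^ j * u⌋₊ (2 ^ j - 1) : ℕ) : ℝ) ≤ 2 ^ j * u :=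
    le_trans (by exact_mod_cast min_le_left _ _) (Nat.floor_le h0)
  have h2 : (2 : ℝ) ^ j * u ≤ (min ⌊(2 : ℝ) ^ j * u⌋₊ (2 ^ j - 1) : ℕ) + 1 := by
    rcases min_choice ⌊(2 : ℝ) ^ j * u⌋₊ (2 ^ j - 1) with h | h
    · rw [h]; exact (Nat.lt_floor_add_one _).le
    · rw [h, Nat.cast_sub (Nat.one_le_two_pow)]
      push_cast
      rw [sub_add_cancel]
      exact mul_le_of_le_one_right (by positivity) hu.2
  unfold cellIndex
  constructor <;> linarith

section gridMap

variable {d : ℕ}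

/-- The position of a point of the cube relative to the dyadic grid of level `k`, coordinate by
coordinate. -/
noncomputable def gridMap (d k : ℕ) : SimpleFunc (unitCube d) (Fin d → ℕ) where
  toFun x s := gridCode k (x.1 s)
  measurableSet_fiber' e := by
    have h : Measurable (fun x : unitCube d => fun s => gridCode k (x.1 s)) := by
      refine measurable_pi_lambda _ fun s => ?_
      have h1 : Measurable (fun y : EuclideanSpace ℝ (Fin d) => 2 ^ k * y s) := by fun_prop
      have h2 := h1.comp (measurable_subtype_coe (p := (· ∈ unitCube d)))
      exact (Nat.measurable_floor.comp h2).add (Nat.measurable_ceil.comp h2)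
    exact h (measurableSet_singleton e)
  finite_range' := by
    refine (Finset.finite_toSet (Fintype.piFinset fun _ : Fin d =>
      Finset.range (2 ^ (k + 1) + 1))).subset ?_
    rintro _ ⟨x, rfl⟩
    refine Finset.mem_coe.2 (Fintype.mem_piFinset.2 fun s => Finset.mem_range.2 ?_)
    exact Nat.lt_succ_of_le (gridCode_le k (x.2 s).2)

theorem card_range_gridMap_le (d k : ℕ) : (gridMap d k).range.card ≤ (2 ^ (k + 1) + 1) ^ d := by
  have : (gridMap d k).range ⊆ Fintype.piFinset fun _ : Fin d => Finset.range (2 ^ (k + 1) + 1) := by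
    intro e he
    obtain ⟨x, rfl⟩ := SimpleFunc.mem_range.1 he
    refine Fintype.mem_piFinset.2 fun s => Finset.mem_range.2 ?_
    exact Nat.lt_succ_of_le (gridCode_le k (x.2 s).2)
  refine (Finset.card_le_card this).trans_eq ?_
  simp [Fintype.card_piFinset]

theorem haarSum_eq_of_gridMap_eq {k k' : ℕ} (hk : k ≤ k') (g : EuclideanSpace ℝ (Fin d) → ℝ)
    {x y : unitCube d} (h : gridMap d k' x = gridMap d k' y) : haarSum k g x = haarSum k g y := by
  rw [haarSum_apply, haarSum_apply]
  refine Finset.sum_congr rfl fun n hn => ?_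
  congr 1
  refine Finset.prod_congr rfl fun s _ => ?_
  exact haar_eq_of_gridCode_eq ((Finset.mem_Icc.1 (Fintype.mem_piFinset.1 hn s)).2.trans
    (Nat.pow_le_pow_right two_pos hk)) (x.2 s).1 (y.2 s).1 (congrFun h s)

/-- The index of the dyadic cube of side `2^{-j}` that contains `x`. -/
noncomputable def cubeIndex (j : ℕ) (x : unitCube d) (s : Fin d) : ℕ := cellIndex j (x.1 s)

theorem cubeIndex_eq_of_gridMap_eq {j k : ℕ} (hjk : j ≤ k) {x y : unitCube d}
    (h : gridMap d k x = gridMap d k y) : cubeIndex j x = cubeIndex j y :=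
  funext fun s => cellIndex_eq_of_gridCode_eq hjk (congrFun h s)

end gridMap

/-! ### Tensor product interpolation on dyadic cubes -/

section interpolation

variable {d l : ℕ}

/-- The `l + 1` equidistant interpolation nodes in `[0, 1)`. -/
noncomputable def interpNode (l : ℕ) (m : Fin (l + 1)) : ℝ := m / (l + 1)

/-- The Lagrange basis polynomials of the nodes `interpNode l`. -/
noncomputable def interpBasis (l : ℕ) (m : Fin (l + 1)) : Polynomial ℝ :=
  Lagrange.basis Finset.univ (interpNode l) m

/-- The polynomials on `ℝ^d` of degree at most `l` in each of the variables. -/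
def polySpace (d l : ℕ) : Submodule ℝ (EuclideanSpace ℝ (Fin d) → ℝ) :=
  Submodule.span ℝ {h | ∃ p : Fin d → Polynomial ℝ, (∀ s, (p s).natDegree ≤ l) ∧
    h = fun t => ∏ s, (p s).eval (t s)}

/-- The interpolation node with multi-index `M` in the dyadic cube of side `2^{-j}` and index `q`. -/
noncomputable def cubeNode (j : ℕ) (q : Fin d → ℕ) (M : Fin d → Fin (l + 1)) :
    EuclideanSpace ℝ (Fin d) :=
  WithLp.toLp 2 fun s => (q s + interpNode l (M s)) / 2 ^ j

/-- The tensor product Lagrange basis on the dyadic cube of side `2^{-j}` and index `q`. -/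
noncomputable def cubeBasis (j : ℕ) (q : Fin d → ℕ) (M : Fin d → Fin (l + 1))
    (t : EuclideanSpace ℝ (Fin d)) : ℝ :=
  ∏ s, (interpBasis l (M s)).eval (2 ^ j * t s - q s)

/-- The polynomial of degree at most `l` in each variable that interpolates `h` at the nodes of the
dyadic cube of side `2^{-j}` and index `q`. -/
noncomputable def cubeInterp (l j : ℕ) (q : Fin d → ℕ) (h : EuclideanSpace ℝ (Fin d) → ℝ)
    (t : EuclideanSpace ℝ (Fin d)) : ℝ :=
  ∑ M : Fin d → Fin (l + 1), h (cubeNode j q M) * cubeBasis j q M t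

/-- The coefficients of the difference of the interpolation polynomials on the dyadic cube of side
`2^{-j}` and index `q` and on its parent cube (for `j = 0`, of the interpolation polynomial). -/
noncomputable def detailCoeff (l : ℕ) (h : EuclideanSpace ℝ (Fin d) → ℝ) :
    ℕ → (Fin d → ℕ) → (Fin d → Fin (l + 1)) → ℝ
  | 0, q, M => h (cubeNode 0 q M)
  | j + 1, q, M => h (cubeNode (j + 1) q M) -
      cubeInterp l j (fun s => q s / 2) h (cubeNode (j + 1) q M)

theorem interpNode_mem (m : Fin (l + 1)) : interpNode l m ∈ Set.Icc (0 : ℝ) 1 := by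
  unfold interpNode
  refine ⟨by positivity, (div_le_one (by positivity)).2 ?_⟩
  exact_mod_cast m.2.le

theorem interpNode_injective (l : ℕ) : Function.Injective (interpNode l) := by
  intro m n h
  unfold interpNode at h
  have h0 : (l : ℝ) + 1 ≠ 0 := by positivity
  rw [div_left_inj' h0] at h
  exact Fin.ext (by exact_mod_cast h)

theorem natDegree_interpBasis_le (m : Fin (l + 1)) : (interpBasis l m).natDegree ≤ l := by
  refine Polynomial.natDegree_le_of_degree_le ?_
  rw [interpBasis, Lagrange.degree_basis (interpNode_injective l).injOn (Finset.mem_univ m)]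
  simp

theorem sum_eval_mul_interpBasis {p : Polynomial ℝ} (hp : p.natDegree ≤ l) (z : ℝ) :
    ∑ m, p.eval (interpNode l m) * (interpBasis l m).eval z = p.eval z := by
  have hdeg : p.degree < (Finset.univ : Finset (Fin (l + 1))).card := by
    rw [Finset.card_univ, Fintype.card_fin]
    exact (Polynomial.degree_le_of_natDegree_le hp).trans_lt (by exact_mod_cast Nat.lt_succ_self l)
  have h := Lagrange.eq_interpolate (v := interpNode l) (interpNode_injective l).injOn hdeg
  conv_rhs => rw [h, Lagrange.interpolate_apply, Polynomial.eval_finsetSum]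
  simp [interpBasis]

/-- Interpolation reproduces the polynomials of degree at most `l` in each variable. -/
theorem cubeInterp_eq_self {h : EuclideanSpace ℝ (Fin d) → ℝ} (hh : h ∈ polySpace d l) (j : ℕ)
    (q : Fin d → ℕ) (t : EuclideanSpace ℝ (Fin d)) : cubeInterp l j q h t = h t := by
  induction hh using Submodule.span_induction with
  | mem h hh =>
    obtain ⟨p, hp, rfl⟩ := hh
    set a : Polynomial ℝ := Polynomial.C ((2 : ℝ) ^ j)⁻¹ with ha
    -- the polynomial `p s` in the coordinate of the cube
    set P : Fin d → Polynomial ℝ := fun s =>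
      (p s).comp (a * (Polynomial.X + Polynomial.C (q s : ℝ))) with hP
    have hdeg : ∀ s, (P s).natDegree ≤ l := fun s => by
      refine Polynomial.natDegree_comp_le.trans ?_
      have : (a * (Polynomial.X + Polynomial.C (q s : ℝ))).natDegree ≤ 1 :=
        (Polynomial.natDegree_C_mul_le _ _).trans (Polynomial.natDegree_X_add_C _).le
      calc _ ≤ l * 1 := Nat.mul_le_mul (hp s) this
        _ = l := mul_one l
    have heval : ∀ s z, (P s).eval z = (p s).eval ((q s + z) / 2 ^ j) := fun s z => by
      simp only [hP, ha, Polynomial.eval_comp, Polynomial.eval_mul, Polynomial.eval_C,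
        Polynomial.eval_add, Polynomial.eval_X]
      congr 1
      rw [div_eq_inv_mul, add_comm]
    have h1 : ∀ s, ∑ m, (p s).eval ((q s + interpNode l m) / 2 ^ j) *
        (interpBasis l m).eval (2 ^ j * t s - q s) = (p s).eval (t s) := fun s => by
      have := sum_eval_mul_interpBasis (hdeg s) (2 ^ j * t s - q s)
      simp only [heval] at this
      rw [this]
      congr 1
      field_simp
      ring
    simp only [cubeInterp, cubeNode, cubeBasis, ← Finset.prod_mul_distrib, ← h1]
    rw [Finset.prod_univ_sum, Fintype.piFinset_univ]
  | zero => simp [cubeInterp]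
  | add g h _ _ h1 h2 =>
    rw [Pi.add_apply, ← h1, ← h2]
    simp only [cubeInterp, Pi.add_apply, add_mul, Finset.sum_add_distrib]
  | smul c h _ h1 =>
    rw [Pi.smul_apply, ← h1]
    simp only [cubeInterp, Pi.smul_apply, smul_eq_mul, mul_assoc, Finset.mul_sum]

theorem cubeBasis_mem_polySpace (j : ℕ) (q : Fin d → ℕ) (M : Fin d → Fin (l + 1)) :
    cubeBasis j q M ∈ polySpace d l := by
  refine Submodule.subset_span ⟨fun s => (interpBasis l (M s)).comp
    (Polynomial.C ((2 : ℝ) ^ j) * Polynomial.X - Polynomial.C (q s : ℝ)), fun s => ?_, ?_⟩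
  · refine Polynomial.natDegree_comp_le.trans ?_
    have : (Polynomial.C ((2 : ℝ) ^ j) * Polynomial.X - Polynomial.C (q s : ℝ)).natDegree ≤ 1 := by
      rw [Polynomial.natDegree_sub_C]
      exact (Polynomial.natDegree_C_mul_le _ _).trans Polynomial.natDegree_X_le
    calc _ ≤ l * 1 := Nat.mul_le_mul (natDegree_interpBasis_le _) this
      _ = l := mul_one l
  · funext t
    simp [cubeBasis, Polynomial.eval_comp]

theorem cubeInterp_mem_polySpace (j : ℕ) (q : Fin d → ℕ) (h : EuclideanSpace ℝ (Fin d) → ℝ) :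
    cubeInterp l j q h ∈ polySpace d l := by
  have : cubeInterp l j q h =
      ∑ M : Fin d → Fin (l + 1), h (cubeNode j q M) • cubeBasis j q M := by
    funext t
    simp [cubeInterp, Finset.sum_apply]
  rw [this]
  exact Submodule.sum_mem _ fun M _ => Submodule.smul_mem _ _ (cubeBasis_mem_polySpace j q M)

/-- The interpolation polynomial of the parent cube is reproduced by interpolation on the cube, which
leaves the details. -/
theorem cubeInterp_succ (j : ℕ) (q : Fin d → ℕ) (h : EuclideanSpace ℝ (Fin d) → ℝ)
    (t : EuclideanSpace ℝ (Fin d)) : cubeInterp l (j + 1) q h t =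
      cubeInterp l j (fun s => q s / 2) h t +
        ∑ M : Fin d → Fin (l + 1), detailCoeff l h (j + 1) q M * cubeBasis (j + 1) q M t := by
  rw [← cubeInterp_eq_self (cubeInterp_mem_polySpace j (fun s => q s / 2) h) (j + 1) q t]
  simp only [cubeInterp, detailCoeff, ← Finset.sum_add_distrib]
  exact Finset.sum_congr rfl fun M _ => by ring

/-- The interpolation polynomial on the dyadic cube that contains `x`, expanded along the chain of
larger dyadic cubes that contain `x`. -/
theorem cubeInterp_eq_sum_detailCoeff (h : EuclideanSpace ℝ (Fin d) → ℝ) (x : unitCube d) (k : ℕ)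
    (t : EuclideanSpace ℝ (Fin d)) : cubeInterp l k (cubeIndex k x) h t =
      ∑ j ∈ Finset.range (k + 1), ∑ M : Fin d → Fin (l + 1),
        detailCoeff l h j (cubeIndex j x) M * cubeBasis j (cubeIndex j x) M t := by
  induction k with
  | zero => simp [cubeInterp, detailCoeff]
  | succ k ih =>
    rw [Finset.sum_range_succ, ← ih, cubeInterp_succ]
    -- the parent of the cube that contains `x` is the cube of the next larger side that contains `x`
    congr 2
    funext s
    exact cellIndex_succ_div_two k _

theorem continuous_cubeBasis (j : ℕ) (q : Fin d → ℕ) (M : Fin d → Fin (l + 1)) :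
    Continuous (cubeBasis j q M) := by
  unfold cubeBasis
  fun_prop

theorem continuous_cubeInterp (j : ℕ) (q : Fin d → ℕ) (h : EuclideanSpace ℝ (Fin d) → ℝ) :
    Continuous (cubeInterp l j q h) := by
  unfold cubeInterp
  exact continuous_finsetSum _ fun M _ => continuous_const.mul (continuous_cubeBasis j q M)

/-- The reference basis functions are bounded and Lipschitz on a bounded set. -/
theorem exists_interpBasis_bound (d l : ℕ) : ∃ A : ℝ, 0 < A ∧
    (∀ (M : Fin d → Fin (l + 1)) (z : Fin d → ℝ), (∀ s, |z s| ≤ 2) →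
      |∏ s, (interpBasis l (M s)).eval (z s)| ≤ A) ∧
    (∀ (M : Fin d → Fin (l + 1)) (z w : Fin d → ℝ) (r : ℝ), 0 ≤ r → (∀ s, |z s| ≤ 2) →
      (∀ s, |w s| ≤ 2) → (∀ s, |z s - w s| ≤ r) →
      |∏ s, (interpBasis l (M s)).eval (z s) - ∏ s, (interpBasis l (M s)).eval (w s)| ≤ A * r) := by
  set Φ : (Fin d → Fin (l + 1)) → (Fin d → ℝ) → ℝ :=
    fun M z => ∏ s, (interpBasis l (M s)).eval (z s) with hΦ
  have hsmooth : ∀ M, ContDiff ℝ 1 (Φ M) := fun M => by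
    simp only [hΦ, Polynomial.eval_eq_sum_range]
    fun_prop
  set K : Set (Fin d → ℝ) := Metric.closedBall 0 2
  have hmem : ∀ {z : Fin d → ℝ}, (∀ s, |z s| ≤ 2) → z ∈ K := fun {z} hz => by
    rw [mem_closedBall_zero_iff, pi_norm_le_iff_of_nonneg zero_le_two]
    exact hz
  have h1 : ∀ M, ∃ B : NNReal, LipschitzOnWith B (Φ M) K := fun M =>
    (hsmooth M).contDiffOn.exists_lipschitzOnWith one_ne_zero (convex_closedBall _ _)
      (isCompact_closedBall _ _)
  have h2 : ∀ M, ∃ B, ∀ z ∈ K, ‖Φ M z‖ ≤ B := fun M =>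
    (isCompact_closedBall _ _).exists_bound_of_continuousOn (hsmooth M).continuous.continuousOn
  choose B₁ hB₁ using h1
  choose B₂ hB₂ using h2
  have h3 : ∀ M, (B₁ M : ℝ) ≤ ∑ M, (B₁ M : ℝ) := fun M =>
    Finset.single_le_sum (f := fun M => (B₁ M : ℝ)) (fun _ _ => NNReal.coe_nonneg _)
      (Finset.mem_univ M)
  have h4 : ∀ M, B₂ M ≤ ∑ M, |B₂ M| := fun M =>
    (le_abs_self _).trans (Finset.single_le_sum (f := fun M => |B₂ M|) (fun _ _ => abs_nonneg _)
      (Finset.mem_univ M))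
  have h5 : 0 ≤ ∑ M, (B₁ M : ℝ) := Finset.sum_nonneg fun _ _ => NNReal.coe_nonneg _
  have h6 : 0 ≤ ∑ M, |B₂ M| := Finset.sum_nonneg fun _ _ => abs_nonneg _
  refine ⟨∑ M, (B₁ M : ℝ) + ∑ M, |B₂ M| + 1, by positivity, fun M z hz => ?_,
    fun M z w r hr hz hw hzw => ?_⟩
  · have := hB₂ M z (hmem hz)
    rw [Real.norm_eq_abs] at this
    linarith [h4 M]
  · have h7 := (hB₁ M).dist_le_mul z (hmem hz) w (hmem hw)
    have h8 : dist z w ≤ r := (dist_pi_le_iff hr).2 fun s => by rw [Real.dist_eq]; exact hzw s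
    rw [Real.dist_eq] at h7
    refine h7.trans ?_
    calc (B₁ M : ℝ) * dist z w ≤ B₁ M * r := by gcongr
      _ ≤ _ := mul_le_mul_of_nonneg_right (by linarith [h3 M]) hr

end interpolation

/-! ### Taylor's formula on the cube and the interpolation error -/

/-- Taylor's formula with a bound on the oscillation of the highest derivative, for a chain of
functions on `[0,1]` each of which is the derivative of the preceding one. -/
theorem abs_sub_taylor_sum_le {l : ℕ} {ψ : ℕ → ℝ → ℝ} {K : ℝ}
    (hψ : ∀ r < l, ∀ τ ∈ Set.Icc (0 : ℝ) 1,
      HasDerivWithinAt (ψ r) (ψ (r + 1) τ) (Set.Icc 0 1) τ)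
    (hK : ∀ τ ∈ Set.Icc (0 : ℝ) 1, |ψ l τ - ψ l 0| ≤ K) :
    ∀ τ ∈ Set.Icc (0 : ℝ) 1,
      |ψ 0 τ - ∑ r ∈ Finset.range (l + 1), ψ r 0 * (τ ^ r / r.factorial)| ≤ K := by
  induction l generalizing ψ with
  | zero => simpa using hK
  | succ l ih =>
    intro τ hτ
    have ih' := ih (ψ := fun r => ψ (r + 1)) (fun r hr => hψ (r + 1) (by omega)) hK
    set F : ℝ → ℝ := fun τ => ψ 0 τ - ∑ r ∈ Finset.range (l + 2), ψ r 0 * (τ ^ r / r.factorial) with hF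
    have hpow : ∀ (r : ℕ) (τ : ℝ), HasDerivAt (fun τ : ℝ => ψ (r + 1) 0 * (τ ^ (r + 1) /
        (r + 1).factorial)) (ψ (r + 1) 0 * (τ ^ r / r.factorial)) τ := by
      intro r τ
      have := ((hasDerivAt_pow (r + 1) τ).div_const ((r + 1).factorial : ℝ)).const_mul (ψ (r + 1) 0)
      refine this.congr_deriv ?_
      rw [Nat.factorial_succ]
      push_cast
      have : (r.factorial : ℝ) ≠ 0 := by positivity
      field_simp
    have hderiv : ∀ τ ∈ Set.Icc (0 : ℝ) 1, HasDerivWithinAt F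
        (ψ 1 τ - ∑ r ∈ Finset.range (l + 1), ψ (r + 1) 0 * (τ ^ r / r.factorial))
        (Set.Icc 0 1) τ := by
      intro τ hτ
      have h1 : HasDerivWithinAt (fun τ : ℝ => ∑ r ∈ Finset.range (l + 1), ψ (r + 1) 0 * (τ ^ (r + 1) /
          (r + 1).factorial)) (∑ r ∈ Finset.range (l + 1), ψ (r + 1) 0 * (τ ^ r / r.factorial))
          (Set.Icc 0 1) τ :=
        HasDerivWithinAt.fun_sum fun r _ => (hpow r τ).hasDerivWithinAt
      have h2 := ((hψ 0 (by omega) τ hτ).sub h1).sub_const (ψ 0 0)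
      refine h2.congr (fun u _ => ?_) ?_ <;>
      · simp only [hF, Pi.sub_apply]
        rw [Finset.sum_range_succ']
        simp
        ring
    have hmv := (convex_Icc (0 : ℝ) 1).norm_image_sub_le_of_norm_hasDerivWithin_le hderiv
      (fun τ hτ => by rw [Real.norm_eq_abs]; exact ih' τ hτ) (Set.left_mem_Icc.2 zero_le_one) hτ
    have hF0 : F 0 = 0 := by
      simp only [hF]
      rw [Finset.sum_range_succ']
      simp
    rw [hF0, sub_zero, sub_zero, Real.norm_eq_abs, Real.norm_eq_abs, abs_of_nonneg hτ.1] at hmv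
    have hK0 : 0 ≤ K := (abs_nonneg _).trans (hK 0 (Set.left_mem_Icc.2 zero_le_one))
    exact hmv.trans (mul_le_of_le_one_right hK0 hτ.2)

section taylor

variable {d l : ℕ}

/-- The Taylor polynomial of degree `l` of a function on the cube. -/
noncomputable def cubeTaylor (l : ℕ) (g : EuclideanSpace ℝ (Fin d) → ℝ)
    (y t : EuclideanSpace ℝ (Fin d)) : ℝ :=
  ∑ r ∈ Finset.range (l + 1), (r.factorial : ℝ)⁻¹ *
    ∑ s : Fin r → Fin d, cubePartial g s y * ∏ i, (t (s i) - y (s i))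

/-- The functions of class `C^l` on the cube whose partial derivatives of order at most `l` are
bounded by `C`, those of order `l` being Hölder continuous with exponent `α` and constant `C`. -/
structure IsHolderSmooth (l : ℕ) (α C : ℝ) (g : EuclideanSpace ℝ (Fin d) → ℝ) : Prop where
  contDiffOn : ContDiffOn ℝ l g (unitCube d)
  abs_cubePartial_le : ∀ r ≤ l, ∀ s : Fin r → Fin d, ∀ x ∈ unitCube d, |cubePartial g s x| ≤ C
  abs_cubePartial_sub_le : ∀ s : Fin l → Fin d, ∀ x ∈ unitCube d, ∀ y ∈ unitCube d,
    |cubePartial g s x - cubePartial g s y| ≤ C * ‖x - y‖ ^ α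

theorem cubeTaylor_mem_polySpace (g : EuclideanSpace ℝ (Fin d) → ℝ)
    (y : EuclideanSpace ℝ (Fin d)) : cubeTaylor l g y ∈ polySpace d l := by
  classical
  have h : cubeTaylor l g y = ∑ r ∈ Finset.range (l + 1), (r.factorial : ℝ)⁻¹ •
      ∑ s : Fin r → Fin d, cubePartial g s y •
        fun t : EuclideanSpace ℝ (Fin d) => ∏ i, (t (s i) - y (s i)) := by
    funext t
    simp [cubeTaylor, Finset.sum_apply]
  rw [h]
  refine Submodule.sum_mem _ fun r hr => Submodule.smul_mem _ _ (Submodule.sum_mem _ fun s _ =>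
    Submodule.smul_mem _ _ (Submodule.subset_span ?_))
  refine ⟨fun a => (Polynomial.X - Polynomial.C (y a)) ^ (Finset.univ.filter fun i => s i = a).card,
    fun a => ?_, ?_⟩
  · refine Polynomial.natDegree_pow_le.trans ?_
    rw [Polynomial.natDegree_X_sub_C, mul_one]
    refine (Finset.card_le_univ _).trans ?_
    rw [Fintype.card_fin]
    exact Nat.le_of_lt_succ (Finset.mem_range.1 hr)
  · funext t
    rw [← Finset.prod_fiberwise Finset.univ s]
    refine Finset.prod_congr rfl fun a _ => ?_
    rw [Polynomial.eval_pow, Polynomial.eval_sub, Polynomial.eval_X, Polynomial.eval_C]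
    refine Finset.prod_eq_pow_card fun i hi => ?_
    rw [(Finset.mem_filter.1 hi).2]

theorem iteratedFDerivWithin_apply_const (g : EuclideanSpace ℝ (Fin d) → ℝ) (r : ℕ)
    (x v : EuclideanSpace ℝ (Fin d)) : iteratedFDerivWithin ℝ r g (unitCube d) x (fun _ => v) =
      ∑ s : Fin r → Fin d, (∏ i, v (s i)) * cubePartial g s x := by
  have hv : v = ∑ a, v a • EuclideanSpace.single a (1 : ℝ) := by
    ext b
    simp [Finset.sum_apply, Pi.single_apply]
  conv_lhs => rw [hv]
  rw [ContinuousMultilinearMap.map_sum]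
  refine Finset.sum_congr rfl fun s _ => ?_
  rw [ContinuousMultilinearMap.map_smul_univ, smul_eq_mul, cubePartial]

theorem norm_le_of_forall_abs_le {v : EuclideanSpace ℝ (Fin d)} {r : ℝ} (h : ∀ s, |v s| ≤ r) :
    ‖v‖ ≤ d * r := by
  have hv : v = ∑ a, v a • EuclideanSpace.single a (1 : ℝ) := by
    ext b
    simp [Finset.sum_apply, Pi.single_apply]
  rw [hv]
  refine (norm_sum_le _ _).trans ?_
  calc _ ≤ ∑ _a : Fin d, r := Finset.sum_le_sum fun a _ => by
          rw [norm_smul, PiLp.norm_single, norm_one, mul_one]; exact h a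
    _ = d * r := by simp

/-- The remainder of Taylor's formula, along the segment from `y` to `t`. -/
theorem IsHolderSmooth.abs_sub_cubeTaylor_le {α C : ℝ} (hα : 0 ≤ α) (hC : 0 ≤ C)
    {g : EuclideanSpace ℝ (Fin d) → ℝ} (hg : IsHolderSmooth l α C g)
    {y t : EuclideanSpace ℝ (Fin d)} (hy : y ∈ unitCube d) (ht : t ∈ unitCube d) {r : ℝ}
    (h : ∀ s, |t s - y s| ≤ r) (hr : 0 ≤ r) :
    |g t - cubeTaylor l g y t| ≤ C * ((d * r) ^ l * (d * r) ^ α) := by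
  set v : EuclideanSpace ℝ (Fin d) := t - y with hv
  set p : ℝ → EuclideanSpace ℝ (Fin d) := fun τ => y + τ • v with hp
  have hmem : ∀ τ ∈ Set.Icc (0 : ℝ) 1, p τ ∈ unitCube d := fun τ hτ =>
    convex_unitCube.add_smul_sub_mem hy ht hτ
  have hp0 : p 0 = y := by simp [hp]
  have hp1 : p 1 = t := by simp [hp, hv]
  set ψ : ℕ → ℝ → ℝ := fun i τ =>
    iteratedFDerivWithin ℝ i g (unitCube d) (p τ) (fun _ => v) with hψ
  have hderiv : ∀ i < l, ∀ τ ∈ Set.Icc (0 : ℝ) 1,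
      HasDerivWithinAt (ψ i) (ψ (i + 1) τ) (Set.Icc 0 1) τ := by
    intro i hi τ hτ
    have h1 := ((hg.contDiffOn.differentiableOn_iteratedFDerivWithin (m := i)
      (by exact_mod_cast hi) uniqueDiffOn_unitCube) (p τ) (hmem τ hτ)).hasFDerivWithinAt
    have h2 : HasDerivWithinAt p v (Set.Icc 0 1) τ := by
      have := ((hasDerivAt_id τ).smul_const v).const_add y
      simpa [hp] using this.hasDerivWithinAt
    have h3 := h1.comp_hasDerivWithinAt τ h2 (fun u hu => hmem u hu)
    exact (ContinuousMultilinearMap.apply ℝ (fun _ : Fin i => EuclideanSpace ℝ (Fin d)) ℝ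
      (fun _ => v)).hasFDerivAt.comp_hasDerivWithinAt τ h3
  have hK : ∀ τ ∈ Set.Icc (0 : ℝ) 1, |ψ l τ - ψ l 0| ≤ C * ((d * r) ^ l * (d * r) ^ α) := by
    intro τ hτ
    simp only [hψ, iteratedFDerivWithin_apply_const, ← Finset.sum_sub_distrib, ← mul_sub]
    have hdist : ‖p τ - p 0‖ ≤ d * r := by
      have : p τ - p 0 = τ • v := by simp [hp]
      rw [this, norm_smul, Real.norm_eq_abs, abs_of_nonneg hτ.1]
      exact (mul_le_of_le_one_left (norm_nonneg _) hτ.2).trans (norm_le_of_forall_abs_le h)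
    refine (Finset.abs_sum_le_sum_abs _ _).trans ?_
    calc _ ≤ ∑ _s : Fin l → Fin d, r ^ l * (C * (d * r) ^ α) := by
          refine Finset.sum_le_sum fun s _ => ?_
          rw [abs_mul, Finset.abs_prod]
          refine mul_le_mul ?_ ?_ (abs_nonneg _) (by positivity)
          · calc _ ≤ ∏ _i : Fin l, r :=
                  Finset.prod_le_prod (fun _ _ => abs_nonneg _) fun i _ => h (s i)
              _ = r ^ l := by simp
          · refine (hg.abs_cubePartial_sub_le s _ (hmem τ hτ) _
              (hmem 0 (Set.left_mem_Icc.2 zero_le_one))).trans ?_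
            exact mul_le_mul_of_nonneg_left (Real.rpow_le_rpow (norm_nonneg _) hdist hα) hC
      _ = C * ((d * r) ^ l * (d * r) ^ α) := by
          simp [Finset.sum_const, mul_pow]
          ring
  have key := abs_sub_taylor_sum_le hderiv hK 1 (Set.right_mem_Icc.2 zero_le_one)
  have e0 : ψ 0 1 = g t := by
    simp only [hψ, iteratedFDerivWithin_zero_apply, hp1]
  have e1 : ∑ i ∈ Finset.range (l + 1), ψ i 0 * (1 ^ i / i.factorial) = cubeTaylor l g y t := by
    refine Finset.sum_congr rfl fun i _ => ?_
    simp only [hψ, iteratedFDerivWithin_apply_const, hp0, one_pow, one_div]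
    rw [mul_comm]
    congr 1
    exact Finset.sum_congr rfl fun s _ => mul_comm _ _
  rwa [e0, e1] at key

theorem cubeNode_mem {j : ℕ} {q : Fin d → ℕ} (hq : ∀ s, q s < 2 ^ j)
    (M : Fin d → Fin (l + 1)) : cubeNode j q M ∈ unitCube d := by
  intro s
  have h1 := interpNode_mem (M s)
  have h2 : (q s : ℝ) + 1 ≤ 2 ^ j := by exact_mod_cast hq s
  show (q s + interpNode l (M s)) / 2 ^ j ∈ Set.Icc (0 : ℝ) 1
  refine ⟨by have := h1.1; positivity, (div_le_one (by positivity)).2 (by linarith [h1.2])⟩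

/-- Interpolation on a dyadic cube approximates a function of smoothness `l + α` to the order
`l + α` in a neighbourhood of that cube; consequently the detail coefficients decay at this rate. -/
theorem exists_detailCoeff_bound (d l : ℕ) {α C : ℝ} (hα : 0 ≤ α) (hC : 0 ≤ C) {ρ : ℝ}
    (hρ : ρ = (1 / 2) ^ l * (1 / 2 : ℝ) ^ α) : ∃ A : ℝ, 0 < A ∧
      ∀ g : EuclideanSpace ℝ (Fin d) → ℝ, IsHolderSmooth l α C g →
        (∀ (j : ℕ) (q : Fin d → ℕ), (∀ s, q s < 2 ^ j) → ∀ t ∈ unitCube d,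
          (∀ s, |2 ^ j * t s - q s| ≤ 2) → |g t - cubeInterp l j q g t| ≤ A * ρ ^ j) ∧
        (∀ (j : ℕ) (q : Fin d → ℕ), (∀ s, q s < 2 ^ j) → ∀ M : Fin d → Fin (l + 1),
          |detailCoeff l g j q M| ≤ A * ρ ^ j) := by
  obtain ⟨A₀, hA₀, hbd, -⟩ := exists_interpBasis_bound d l
  have hρ0 : 0 < ρ := by rw [hρ]; positivity
  set E : ℝ := C * ((d * 2) ^ l * (d * 2 : ℝ) ^ α) with hE
  have hE0 : 0 ≤ E := by positivity
  set A₁ : ℝ := E * (1 + (l + 1) ^ d * A₀) with hA₁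
  have hA₁0 : 0 ≤ A₁ := by positivity
  refine ⟨A₁ + A₁ / ρ + C + 1, by positivity, fun g hg => ?_⟩
  have happrox : ∀ (j : ℕ) (q : Fin d → ℕ), (∀ s, q s < 2 ^ j) → ∀ t ∈ unitCube d,
      (∀ s, |2 ^ j * t s - q s| ≤ 2) → |g t - cubeInterp l j q g t| ≤ A₁ * ρ ^ j := by
    intro j q hq t ht htq
    have h2 : (0 : ℝ) < 2 ^ j := by positivity
    set y : EuclideanSpace ℝ (Fin d) := WithLp.toLp 2 fun s => q s / 2 ^ j with hy
    have hyc : y ∈ unitCube d := fun s => by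
      show (q s : ℝ) / 2 ^ j ∈ Set.Icc (0 : ℝ) 1
      refine ⟨by positivity, (div_le_one h2).2 ?_⟩
      exact_mod_cast (hq s).le
    have hEj : C * ((d * (2 / 2 ^ j)) ^ l * (d * (2 / 2 ^ j) : ℝ) ^ α) = E * ρ ^ j := by
      have e : (d * (2 / 2 ^ j) : ℝ) = d * 2 * (1 / 2) ^ j := by rw [one_div_pow]; ring
      have e2 : ((1 / 2 : ℝ) ^ j) ^ α = ((1 / 2 : ℝ) ^ α) ^ j := by
        rw [← Real.rpow_natCast_mul (by norm_num), ← Real.rpow_mul_natCast (by norm_num), mul_comm]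
      rw [e, mul_pow _ ((1 / 2 : ℝ) ^ j), Real.mul_rpow (by positivity) (by positivity), e2, hE, hρ,
        mul_pow ((1 / 2 : ℝ) ^ l), ← pow_mul, ← pow_mul, mul_comm j l]
      ring
    have hT : ∀ z ∈ unitCube d, (∀ s, |2 ^ j * z s - q s| ≤ 2) →
        |g z - cubeTaylor l g y z| ≤ E * ρ ^ j := by
      intro z hz hzq
      rw [← hEj]
      refine hg.abs_sub_cubeTaylor_le hα hC hyc hz (fun s => ?_) (by positivity)
      have : z s - y s = (2 ^ j * z s - q s) / 2 ^ j := by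
        show z s - (q s : ℝ) / 2 ^ j = _
        field_simp
      rw [this, abs_div, abs_of_pos h2]
      gcongr
      exact hzq s
    have hnode : ∀ M : Fin d → Fin (l + 1),
        |g (cubeNode j q M) - cubeTaylor l g y (cubeNode j q M)| ≤ E * ρ ^ j := fun M => by
      refine hT _ (cubeNode_mem hq M) fun s => ?_
      have h1 := interpNode_mem (M s)
      have : 2 ^ j * cubeNode j q M s - q s = interpNode l (M s) := by
        show 2 ^ j * ((q s + interpNode l (M s)) / 2 ^ j) - q s = _
        field_simp
        ring
      rw [this, abs_of_nonneg h1.1]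
      linarith [h1.2]
    -- interpolation reproduces the Taylor polynomial at the corner of the cube, so that only the
    -- remainder is interpolated
    have hsplit : g t - cubeInterp l j q g t = (g t - cubeTaylor l g y t) -
        ∑ M : Fin d → Fin (l + 1), (g (cubeNode j q M) - cubeTaylor l g y (cubeNode j q M)) *
          cubeBasis j q M t := by
      have := cubeInterp_eq_self (cubeTaylor_mem_polySpace (l := l) g y) j q t
      simp only [sub_mul, Finset.sum_sub_distrib]
      rw [cubeInterp] at this ⊢
      rw [this]
      ring
    have hsum : |∑ M : Fin d → Fin (l + 1), (g (cubeNode j q M) -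
        cubeTaylor l g y (cubeNode j q M)) * cubeBasis j q M t| ≤
          (l + 1) ^ d * (E * ρ ^ j * A₀) := by
      refine (Finset.abs_sum_le_sum_abs _ _).trans ?_
      calc _ ≤ ∑ _M : Fin d → Fin (l + 1), E * ρ ^ j * A₀ := Finset.sum_le_sum fun M _ => by
              rw [abs_mul]
              exact mul_le_mul (hnode M) (hbd M _ htq) (abs_nonneg _) (by positivity)
        _ = _ := by simp
    rw [hsplit]
    refine (abs_sub _ _).trans ?_
    have := hT t ht htq
    rw [hA₁]
    linarith
  refine ⟨fun j q hq t ht htq => (happrox j q hq t ht htq).trans ?_, fun j q hq M => ?_⟩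
  · refine mul_le_mul_of_nonneg_right ?_ (by positivity)
    have : 0 ≤ A₁ / ρ := by positivity
    linarith
  · cases j with
    | zero =>
      have h1 := hg.abs_cubePartial_le 0 (Nat.zero_le l) Fin.elim0 _ (cubeNode_mem hq M)
      rw [cubePartial, iteratedFDerivWithin_zero_apply] at h1
      rw [pow_zero, mul_one, detailCoeff]
      have : 0 ≤ A₁ / ρ := by positivity
      linarith
    | succ j =>
      -- the detail is the interpolation error of the parent cube at a node of the cube
      have h1 : |detailCoeff l g (j + 1) q M| ≤ A₁ * ρ ^ j := by
        rw [detailCoeff]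
        refine happrox j _ (fun s => ?_) _ (cubeNode_mem hq M) fun s => ?_
        · have := hq s
          rw [pow_succ] at this
          omega
        · have h2 := interpNode_mem (M s)
          have e : (2 : ℝ) ^ j * cubeNode (j + 1) q M s = (q s + interpNode l (M s)) / 2 := by
            show (2 : ℝ) ^ j * ((q s + interpNode l (M s)) / 2 ^ (j + 1)) = _
            rw [pow_succ]
            field_simp
          have h3 : 2 * (q s / 2) ≤ q s := Nat.mul_div_le _ _
          have h4 : q s ≤ 2 * (q s / 2) + 1 := by omega
          have h3' : 2 * ((q s / 2 : ℕ) : ℝ) ≤ q s := by exact_mod_cast h3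
          have h4' : (q s : ℝ) ≤ 2 * ((q s / 2 : ℕ) : ℝ) + 1 := by exact_mod_cast h4
          rw [e, abs_le]
          constructor <;> linarith [h2.1, h2.2]
      refine h1.trans ?_
      have e : A₁ * ρ ^ j = A₁ / ρ * ρ ^ (j + 1) := by rw [pow_succ]; field_simp
      rw [e]
      refine mul_le_mul_of_nonneg_right ?_ (by positivity)
      linarith

end taylor

/-! ### Uniform bound for the terms of the Fourier–Haar series -/

section increments

variable {d : ℕ}

/-- The dyadic increment `S_{2^(k+1)}(g, ·) - S_{2^k}(g, ·)` of the Fourier–Haar sums. -/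
noncomputable def haarIncr (k : ℕ) (g : EuclideanSpace ℝ (Fin d) → ℝ) : SimpleFunc (unitCube d) ℝ :=
  haarSum (k + 1) g - haarSum k g

theorem haarIncr_apply (k : ℕ) (g : EuclideanSpace ℝ (Fin d) → ℝ) (x : unitCube d) :
    haarIncr k g x = haarSum (k + 1) g x - haarSum k g x := rfl

theorem haarIncr_sub {g h : EuclideanSpace ℝ (Fin d) → ℝ} (hg : ContinuousOn g (unitCube d))
    (hh : ContinuousOn h (unitCube d)) (k : ℕ) (x : unitCube d) :
    haarIncr k (fun t => g t - h t) x = haarIncr k g x - haarIncr k h x := by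
  simp only [haarIncr_apply, haarSum_sub hg hh]
  ring

theorem haarIncr_sum {ι : Type*} (S : Finset ι) (c : ι → ℝ)
    {g : ι → EuclideanSpace ℝ (Fin d) → ℝ} (hg : ∀ i, ContinuousOn (g i) (unitCube d)) (k : ℕ)
    (x : unitCube d) :
    haarIncr k (fun t => ∑ i ∈ S, c i * g i t) x = ∑ i ∈ S, c i * haarIncr k (g i) x := by
  simp only [haarIncr_apply, haarSum_sum S c hg, mul_sub, Finset.sum_sub_distrib]

theorem abs_haarIncr_le {g : EuclideanSpace ℝ (Fin d) → ℝ} (hg : ContinuousOn g (unitCube d))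
    {k : ℕ} {x : unitCube d} {c B : ℝ}
    (h : ∀ t ∈ unitCube d, (∀ s, |t s - x.1 s| ≤ 1 / 2 ^ k) → |g t - c| ≤ B) :
    |haarIncr k g x| ≤ 2 * B := by
  have h1 : |haarSum (k + 1) g x - c| ≤ B := abs_haarSum_sub_le hg fun t ht hs =>
    h t ht fun s => (hs s).trans (one_div_pow_le_one_div_pow_of_le one_le_two k.le_succ)
  have h2 : |haarSum k g x - c| ≤ B := abs_haarSum_sub_le hg h
  rw [haarIncr_apply, ← sub_sub_sub_cancel_right _ _ c]
  exact (abs_sub _ _).trans (by linarith)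

theorem haarIncr_eq_of_gridMap_eq (k : ℕ) (g : EuclideanSpace ℝ (Fin d) → ℝ) {x y : unitCube d}
    (h : gridMap d (k + 1) x = gridMap d (k + 1) y) : haarIncr k g x = haarIncr k g y := by
  rw [haarIncr_apply, haarIncr_apply, haarSum_eq_of_gridMap_eq le_rfl g h,
    haarSum_eq_of_gridMap_eq k.le_succ g h]

theorem measurable_cubeIndex (j : ℕ) : Measurable (cubeIndex (d := d) j) := by
  refine measurable_pi_lambda _ fun s => ?_
  have h1 : Measurable (fun y : EuclideanSpace ℝ (Fin d) => 2 ^ j * y s) := by fun_prop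
  have h2 := h1.comp (measurable_subtype_coe (p := (· ∈ unitCube d)))
  exact (Nat.measurable_floor.comp h2).min measurable_const

theorem two_pow_mul_sub_cubeIndex_mem (j : ℕ) (x : unitCube d) (s : Fin d) :
    2 ^ j * x.1 s - cubeIndex j x s ∈ Set.Icc (0 : ℝ) 1 :=
  two_pow_mul_sub_cellIndex_mem j (x.2 s)

/-- The dyadic increment of level `k` of a basis function of the dyadic cube of side `2^{-j}` and
index `q`, restricted to that cube. -/
noncomputable def basisIncr {l : ℕ} (k j : ℕ) (M : Fin d → Fin (l + 1)) (q : Fin d → ℕ) :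
    SimpleFunc (unitCube d) ℝ :=
  (haarIncr k (cubeBasis j q M)).restrict (cubeIndex j ⁻¹' {q})

theorem basisIncr_apply {l : ℕ} (k j : ℕ) (M : Fin d → Fin (l + 1)) (q : Fin d → ℕ)
    (x : unitCube d) : basisIncr k j M q x =
      if cubeIndex j x = q then haarIncr k (cubeBasis j q M) x else 0 := by
  classical
  rw [basisIncr, SimpleFunc.restrict_apply _ (measurable_cubeIndex j (measurableSet_singleton q)),
    Set.indicator_apply]
  exact if_congr Iff.rfl rfl rfl

/-- The indices of the dyadic cubes of side `2^{-j}`. -/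
def cubeIndices (d j : ℕ) : Finset (Fin d → ℕ) :=
  Fintype.piFinset fun _ => Finset.range (2 ^ j)

theorem cubeIndex_mem_cubeIndices (j : ℕ) (x : unitCube d) : cubeIndex j x ∈ cubeIndices d j :=
  Fintype.mem_piFinset.2 fun _ => Finset.mem_range.2 (cellIndex_lt j _)

theorem card_cubeIndices (d j : ℕ) : (cubeIndices d j).card = (2 ^ d) ^ j := by
  simp [cubeIndices, Fintype.card_piFinset, ← pow_mul, mul_comm]

theorem sum_mul_basisIncr {l : ℕ} (k j : ℕ) (M : Fin d → Fin (l + 1)) (b : (Fin d → ℕ) → ℝ)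
    (x : unitCube d) : ∑ q ∈ cubeIndices d j, b q * basisIncr k j M q x =
      b (cubeIndex j x) * haarIncr k (cubeBasis j (cubeIndex j x) M) x := by
  simp only [basisIncr_apply, mul_ite, mul_zero]
  rw [Finset.sum_ite_eq, if_pos (cubeIndex_mem_cubeIndices j x)]

/-- A basis function of a dyadic cube of side `2^{-j}` varies by `O(2^{-i})` at the scale
`2^{-(j+i)}`, and so do its dyadic increments of that level on the cube. -/
theorem exists_sum_abs_basisIncr_le (d l : ℕ) : ∃ A : ℝ, 0 < A ∧
    ∀ (j i : ℕ) (M : Fin d → Fin (l + 1)) (x : unitCube d),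
      ∑ q ∈ cubeIndices d j, |basisIncr (j + i) j M q x| ≤ A * (1 / 2) ^ i := by
  obtain ⟨A, hA, -, hlip⟩ := exists_interpBasis_bound d l
  refine ⟨2 * A, by positivity, fun j i M x => ?_⟩
  have h1 : ∑ q ∈ cubeIndices d j, |basisIncr (j + i) j M q x| =
      |haarIncr (j + i) (cubeBasis j (cubeIndex j x) M) x| := by
    rw [Finset.sum_eq_single (cubeIndex j x)]
    · rw [basisIncr_apply, if_pos rfl]
    · intro q _ hq
      rw [basisIncr_apply, if_neg hq.symm, abs_zero]
    · exact fun h => absurd (cubeIndex_mem_cubeIndices j x) h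
  rw [h1, mul_assoc]
  refine abs_haarIncr_le (c := cubeBasis j (cubeIndex j x) M x.1)
    (continuous_cubeBasis _ _ _).continuousOn fun t _ hs => ?_
  have hle : (1 / 2 : ℝ) ^ i ≤ 1 := pow_le_one₀ (by norm_num) (by norm_num)
  have hd : ∀ s, |(2 ^ j * t s - cubeIndex j x s) - (2 ^ j * x.1 s - cubeIndex j x s)| ≤
      (1 / 2) ^ i := fun s => by
    rw [sub_sub_sub_cancel_right, ← mul_sub, abs_mul, abs_of_pos (by positivity)]
    calc _ ≤ (2 : ℝ) ^ j * (1 / 2 ^ (j + i)) := by gcongr; exact hs s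
      _ = (1 / 2) ^ i := by rw [pow_add, one_div_pow]; field_simp
  have hx : ∀ s, |2 ^ j * x.1 s - (cubeIndex j x s : ℝ)| ≤ 1 := fun s => by
    have := two_pow_mul_sub_cubeIndex_mem j x s
    rw [abs_of_nonneg this.1]
    exact this.2
  refine hlip M _ _ _ (by positivity) (fun s => ?_) (fun s => (hx s).trans one_le_two) hd
  have h2 := abs_le.1 (hd s)
  have h3 := abs_le.1 (hx s)
  rw [abs_le]
  constructor <;> linarith [h2.1, h2.2, h3.1, h3.2]

/-- The dyadic increment of `g` at `x` is that of the interpolation error on the dyadic cube of side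
`2^{-k}` that contains `x`, plus the increments of the details of all coarser levels. -/
theorem haarIncr_eq_add_sum {g : EuclideanSpace ℝ (Fin d) → ℝ} (hg : ContinuousOn g (unitCube d))
    (l k : ℕ) (x : unitCube d) : haarIncr k g x =
      haarIncr k (fun t => g t - cubeInterp l k (cubeIndex k x) g t) x +
        ∑ j ∈ Finset.range (k + 1), ∑ M : Fin d → Fin (l + 1), ∑ q ∈ cubeIndices d j,
          detailCoeff l g j q M * basisIncr k j M q x := by
  rw [haarIncr_sub hg (continuous_cubeInterp k _ g).continuousOn]
  have h1 : haarIncr k (cubeInterp l k (cubeIndex k x) g) x =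
      ∑ j ∈ Finset.range (k + 1), ∑ M : Fin d → Fin (l + 1), ∑ q ∈ cubeIndices d j,
        detailCoeff l g j q M * basisIncr k j M q x := by
    have h2 : cubeInterp l k (cubeIndex k x) g = fun t =>
        ∑ p ∈ Finset.range (k + 1) ×ˢ (Finset.univ : Finset (Fin d → Fin (l + 1))),
          detailCoeff l g p.1 (cubeIndex p.1 x) p.2 * cubeBasis p.1 (cubeIndex p.1 x) p.2 t := by
      funext t
      rw [cubeInterp_eq_sum_detailCoeff, Finset.sum_product]
    rw [h2, haarIncr_sum _ _ fun p => (continuous_cubeBasis _ _ _).continuousOn, Finset.sum_product]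
    refine Finset.sum_congr rfl fun j _ => Finset.sum_congr rfl fun M _ => ?_
    exact (sum_mul_basisIncr k j M (fun q => detailCoeff l g j q M) x).symm
  rw [← h1]
  ring

end increments

theorem sqrt_pow_nat {a : ℝ} (ha : 0 ≤ a) (n : ℕ) : √(a ^ n) = √a ^ n := by
  rw [Real.sqrt_eq_iff_mul_self_eq (by positivity) (by positivity), ← mul_pow, Real.mul_self_sqrt ha]

/-- The Cauchy–Schwarz inequality, for coefficients bounded by `b` and at most `N` summands. -/
theorem abs_sum_mul_mul_le {ι : Type*} (S : Finset ι) {a ξ : ι → ℝ} {b N B w : ℝ}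
    (ha : ∀ e ∈ S, |a e| ≤ b) (hb : 0 ≤ b) (hN : (S.card : ℝ) ≤ N) (hw : 0 ≤ w)
    (hB : w ^ 2 * ∑ e ∈ S, ξ e ^ 2 ≤ B) : |∑ e ∈ S, a e * ξ e| * w ≤ b * (√N * √B) := by
  have hN0 : 0 ≤ N := (Nat.cast_nonneg _).trans hN
  have hB0 : 0 ≤ B := le_trans (by positivity) hB
  have h1 : ∑ e ∈ S, a e ^ 2 ≤ N * b ^ 2 := by
    calc _ ≤ ∑ _e ∈ S, b ^ 2 := Finset.sum_le_sum fun e he => by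
            rw [← sq_abs]; exact pow_le_pow_left₀ (abs_nonneg _) (ha e he) 2
      _ = S.card * b ^ 2 := by rw [Finset.sum_const, nsmul_eq_mul]
      _ ≤ _ := by gcongr
  refine (sq_le_sq₀ (by positivity) (by positivity)).1 ?_
  rw [mul_pow, sq_abs, mul_pow, mul_pow, Real.sq_sqrt hN0, Real.sq_sqrt hB0]
  calc _ ≤ ((∑ e ∈ S, a e ^ 2) * ∑ e ∈ S, ξ e ^ 2) * w ^ 2 := by
        gcongr; exact Finset.sum_mul_sq_le_sq_mul_sq S a ξ
    _ = (∑ e ∈ S, a e ^ 2) * (w ^ 2 * ∑ e ∈ S, ξ e ^ 2) := by ring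
    _ ≤ (N * b ^ 2) * B := mul_le_mul h1 hB (by positivity) (by positivity)
    _ = _ := by ring

namespace StochasticMeasure

variable {d : ℕ} {Ω : Type*} [MeasurableSpace Ω] {P : Measure Ω}

/-- A choice of a point of the cube in each position relative to the grid of level `k`. -/
noncomputable def gridPoint (d k : ℕ) (e : Fin d → ℕ) : unitCube d :=
  haveI : Nonempty (unitCube d) := ⟨0, fun _ => ⟨le_rfl, zero_le_one⟩⟩
  Function.invFun (gridMap d k) e

theorem gridMap_gridPoint (k : ℕ) (x : unitCube d) :
    gridMap d k (gridPoint d k (gridMap d k x)) = gridMap d k x :=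
  haveI : Nonempty (unitCube d) := ⟨x⟩
  Function.invFun_eq ⟨x, rfl⟩

/-- Outside one null set, the integrals of all functions that are constant on the pieces of the grid
are given by the values at the chosen points. -/
theorem simpleIntegral_eq_sum_gridPoint (μ : StochasticMeasure (unitCube d) P) :
    ∀ᵐ ω ∂P, ∀ (k : ℕ) (g : SimpleFunc (unitCube d) ℝ),
      (∀ x y, gridMap d k x = gridMap d k y → g x = g y) →
        μ.simpleIntegral Set.univ g ω = ∑ e ∈ (gridMap d k).range,
          g (gridPoint d k e) * μ.val (gridMap d k ⁻¹' {e}) ω := by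
  refine ae_all_iff.2 fun k => ?_
  filter_upwards [μ.simpleIntegral_eq_sum .univ (gridMap d k)] with ω hω g hg
  rw [hω g (fun e => g (gridPoint d k e)) fun x => hg _ _ (gridMap_gridPoint k x).symm]
  simp only [Set.univ_inter]

variable [IsProbabilityMeasure P]

/-- Almost surely, the sums of the squares of the measure over the pieces of the grids grow at
most geometrically, at an arbitrarily small rate. -/
theorem ae_exists_sum_sq_val_le (μ : StochasticMeasure (unitCube d) P) {θ : ℝ} (hθ : 0 < θ)
    (hθ1 : θ < 1) : ∀ᵐ ω ∂P, ∃ B, ∀ k : ℕ,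
      (θ ^ k) ^ 2 * ∑ e ∈ (gridMap d (k + 1)).range, μ.val (gridMap d (k + 1) ⁻¹' {e}) ω ^ 2 ≤ B := by
  classical
  set φ : ℕ → (Fin d → ℕ) → SimpleFunc (unitCube d) ℝ := fun k e =>
    (SimpleFunc.const _ 1).restrict (gridMap d (k + 1) ⁻¹' {e}) with hφ
  have hφa : ∀ k e x, φ k e x = if gridMap d (k + 1) x = e then 1 else 0 := fun k e x => by
    simp only [hφ]
    rw [SimpleFunc.restrict_apply _ ((gridMap d (k + 1)).measurableSet_fiber e), Set.indicator_apply]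
    exact if_congr Iff.rfl rfl rfl
  have h1 : ∀ k x, ∑ e ∈ (gridMap d (k + 1)).range, |φ k e x| ≤ 1 := fun k x => by
    rw [Finset.sum_eq_single (gridMap d (k + 1) x)]
    · simp [hφa]
    · intro e _ he
      rw [hφa, if_neg he.symm, abs_zero]
    · exact fun h => absurd (SimpleFunc.mem_range_self _ x) h
  filter_upwards [μ.exists_layer_bound (fun k => (gridMap d (k + 1)).range) φ
    (w := fun k => θ ^ k) (c := fun _ => 1) (fun k => by positivity) h1
    (by simpa using summable_geometric_of_lt_one hθ.le hθ1), μ.simpleIntegral_eq_sum_gridPoint]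
    with ω ⟨B, hB⟩ hω
  refine ⟨B, fun k => (le_of_eq ?_).trans (hB k)⟩
  congr 1
  refine Finset.sum_congr rfl fun e he => ?_
  congr 1
  obtain ⟨x, rfl⟩ := SimpleFunc.mem_range.1 he
  rw [hω (k + 1) (φ k _) fun y z h => by rw [hφa, hφa, h]]
  rw [Finset.sum_eq_single (gridMap d (k + 1) x)]
  · rw [hφa, if_pos (gridMap_gridPoint _ x), one_mul]
  · intro e' he' hne
    obtain ⟨x', rfl⟩ := SimpleFunc.mem_range.1 he'
    rw [hφa, gridMap_gridPoint, if_neg hne, zero_mul]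
  · exact fun h => absurd he h

/-- Square summability of the integrals of the increments of the basis functions. The weight `2 ^ i`
matches their size, and `θ ^ (j + i)` makes the sum over all layers converge. -/
theorem ae_exists_sum_sq_basisIncr_le (μ : StochasticMeasure (unitCube d) P) {l : ℕ} {θ : ℝ}
    (hθ : 0 < θ) (hθ1 : θ < 1) (M : Fin d → Fin (l + 1)) : ∀ᵐ ω ∂P, ∃ B, ∀ j i : ℕ,
      (2 ^ i * θ ^ (j + i)) ^ 2 * ∑ q ∈ cubeIndices d j,
        μ.simpleIntegral Set.univ (basisIncr (j + i) j M q) ω ^ 2 ≤ B := by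
  obtain ⟨A, hA, hbd⟩ := exists_sum_abs_basisIncr_le d l
  have hsum : Summable fun p : ℕ × ℕ => 2 ^ p.2 * θ ^ (p.1 + p.2) * (A * (1 / 2) ^ p.2) := by
    have hg := summable_geometric_of_lt_one hθ.le hθ1
    have := (hg.mul_of_nonneg hg (fun _ => by positivity) (fun _ => by positivity)).mul_left A
    refine this.congr fun p => ?_
    rw [pow_add, one_div_pow]
    field_simp
  filter_upwards [μ.exists_layer_bound (fun p : ℕ × ℕ => cubeIndices d p.1)
    (fun p q => basisIncr (p.1 + p.2) p.1 M q) (w := fun p => 2 ^ p.2 * θ ^ (p.1 + p.2))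
    (c := fun p => A * (1 / 2) ^ p.2) (fun p => by positivity) (fun p x => hbd p.1 p.2 M x) hsum]
    with ω ⟨B, hB⟩
  exact ⟨B, fun j i => hB (j, i)⟩

/-- The terms of the Fourier–Haar series decay geometrically, uniformly over all functions of the
given smoothness, outside one null set. -/
theorem ae_exists_haarSeriesTerm_bound (μ : StochasticMeasure (unitCube d) P) {l : ℕ} {α C ρ θ : ℝ}
    (hα : 0 ≤ α) (hC : 0 ≤ C) (hρ : ρ = (1 / 2) ^ l * (1 / 2 : ℝ) ^ α) (hθ : 0 < θ) (hθ1 : θ < 1)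
    (hρθ : ρ * √(2 ^ d) ≤ θ ^ 2) (hθ2 : 1 / 2 ≤ θ ^ 2) :
    ∀ᵐ ω ∂P, ∃ D, ∀ g : EuclideanSpace ℝ (Fin d) → ℝ, IsHolderSmooth l α C g → ∀ k : ℕ,
      |haarSeriesTerm μ g k ω| ≤ D * ((k + 1) * θ ^ k) := by
  obtain ⟨A, hA, hAg⟩ := exists_detailCoeff_bound d l hα hC hρ
  have hρ0 : 0 ≤ ρ := by rw [hρ]; positivity
  have hlayers := ae_all_iff.2 fun M : Fin d → Fin (l + 1) =>
    μ.ae_exists_sum_sq_basisIncr_le hθ hθ1 M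
  filter_upwards [μ.ae_exists_sum_sq_val_le hθ hθ1, hlayers, μ.simpleIntegral_eq_sum_gridPoint]
    with ω ⟨B₀, hB₀⟩ hBM hsum
  choose B hB using hBM
  refine ⟨2 * A * (√(8 ^ d) * √B₀) + ∑ M, A * √(B M), fun g hg k => ?_⟩
  obtain ⟨happrox, hdetail⟩ := hAg g hg
  have hgc : ContinuousOn g (unitCube d) := hg.contDiffOn.continuousOn
  have hθk : 0 < θ ^ k := by positivity
  set G := gridMap d (k + 1) with hG
  set ξ : (Fin d → ℕ) → ℝ := fun e => μ.val (G ⁻¹' {e}) ω with hξ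
  -- the increment at `x` of the interpolation error on the cube that contains `x`
  set R : unitCube d → ℝ := fun x =>
    haarIncr k (fun t => g t - cubeInterp l k (cubeIndex k x) g t) x with hR
  have hT : haarSeriesTerm μ g k ω = ∑ e ∈ G.range, R (gridPoint d (k + 1) e) * ξ e +
      ∑ j ∈ Finset.range (k + 1), ∑ M : Fin d → Fin (l + 1), ∑ q ∈ cubeIndices d j,
        detailCoeff l g j q M * μ.simpleIntegral Set.univ (basisIncr k j M q) ω := by
    have h1 : haarSeriesTerm μ g k ω = ∑ e ∈ G.range, haarIncr k g (gridPoint d (k + 1) e) * ξ e :=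
      hsum (k + 1) (haarIncr k g) fun x y h => haarIncr_eq_of_gridMap_eq k g h
    have h2 : ∀ j ∈ Finset.range (k + 1), ∀ (M : Fin d → Fin (l + 1)) (q : Fin d → ℕ),
        μ.simpleIntegral Set.univ (basisIncr k j M q) ω =
          ∑ e ∈ G.range, basisIncr k j M q (gridPoint d (k + 1) e) * ξ e := by
      intro j hj M q
      refine hsum (k + 1) _ fun x y h => ?_
      rw [basisIncr_apply, basisIncr_apply, haarIncr_eq_of_gridMap_eq k _ h,
        cubeIndex_eq_of_gridMap_eq (Finset.mem_range.1 hj).le h]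
    rw [h1]
    have h3 : ∑ j ∈ Finset.range (k + 1), ∑ M : Fin d → Fin (l + 1), ∑ q ∈ cubeIndices d j,
        detailCoeff l g j q M * μ.simpleIntegral Set.univ (basisIncr k j M q) ω =
        ∑ e ∈ G.range, (∑ j ∈ Finset.range (k + 1), ∑ M : Fin d → Fin (l + 1),
          ∑ q ∈ cubeIndices d j, detailCoeff l g j q M *
            basisIncr k j M q (gridPoint d (k + 1) e)) * ξ e := by
      simp only [Finset.sum_mul]
      symm
      rw [Finset.sum_comm]
      refine Finset.sum_congr rfl fun j hj => ?_
      rw [Finset.sum_comm]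
      refine Finset.sum_congr rfl fun M _ => ?_
      rw [Finset.sum_comm]
      refine Finset.sum_congr rfl fun q _ => ?_
      rw [h2 j hj, Finset.mul_sum]
      exact Finset.sum_congr rfl fun e _ => by ring
    rw [h3, ← Finset.sum_add_distrib]
    refine Finset.sum_congr rfl fun e _ => ?_
    rw [haarIncr_eq_add_sum hgc l k, add_mul]
  -- the interpolation error on the finest cubes
  have hfine : |∑ e ∈ G.range, R (gridPoint d (k + 1) e) * ξ e| ≤
      2 * A * (√(8 ^ d) * √B₀) * θ ^ k := by
    -- the grid has `O(2 ^ (k * d))` pieces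
    have hcard : (G.range.card : ℝ) ≤ (2 ^ d) ^ k * 8 ^ d := by
      have h1 : 2 ^ (k + 1 + 1) + 1 ≤ 2 ^ k * 8 := by
        have : 1 ≤ 2 ^ k := Nat.one_le_two_pow
        rw [pow_succ, pow_succ]
        omega
      have h2 := (card_range_gridMap_le d (k + 1)).trans (Nat.pow_le_pow_left h1 d)
      rw [mul_pow, ← pow_mul, mul_comm k d, pow_mul] at h2
      exact_mod_cast h2
    have hRle : ∀ e ∈ G.range, |R (gridPoint d (k + 1) e)| ≤ 2 * (A * ρ ^ k) := by
      intro e _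
      set x := gridPoint d (k + 1) e
      refine abs_haarIncr_le (c := 0)
        (hgc.sub (continuous_cubeInterp k (cubeIndex k x) g).continuousOn) fun t ht hs => ?_
      rw [sub_zero]
      refine happrox k _ (fun s => cellIndex_lt k _) t ht fun s => ?_
      have h1 := two_pow_mul_sub_cubeIndex_mem k x s
      have h2 : |2 ^ k * (t s - x.1 s)| ≤ 1 := by
        rw [abs_mul, abs_of_pos (by positivity)]
        calc _ ≤ (2 : ℝ) ^ k * (1 / 2 ^ k) := by gcongr; exact hs s
          _ = 1 := by field_simp
      show |2 ^ k * t s - (cubeIndex k x s : ℝ)| ≤ 2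
      rw [abs_le] at h2 ⊢
      constructor <;> linarith [h1.1, h1.2, h2.1, h2.2]
    have h := abs_sum_mul_mul_le G.range hRle (by positivity) hcard hθk.le (hB₀ k)
    rw [Real.sqrt_mul (by positivity), sqrt_pow_nat (by positivity)] at h
    refine le_of_mul_le_mul_right (h.trans ?_) hθk
    calc _ = 2 * A * (√(8 ^ d) * √B₀) * (ρ * √(2 ^ d)) ^ k := by rw [mul_pow]; ring
      _ ≤ 2 * A * (√(8 ^ d) * √B₀) * (θ ^ 2) ^ k := by gcongr
      _ = _ := by rw [pow_right_comm]; ring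
  -- the details of level `j`
  have hcoarse : ∀ j ∈ Finset.range (k + 1), ∀ M : Fin d → Fin (l + 1),
      |∑ q ∈ cubeIndices d j, detailCoeff l g j q M *
        μ.simpleIntegral Set.univ (basisIncr k j M q) ω| ≤ A * √(B M) * θ ^ k := by
    intro j hj M
    obtain ⟨i, rfl⟩ := Nat.exists_eq_add_of_le (Nat.le_of_lt_succ (Finset.mem_range.1 hj))
    have h := abs_sum_mul_mul_le (cubeIndices d j) (b := A * ρ ^ j) (N := (2 ^ d) ^ j)
      (a := fun q => detailCoeff l g j q M)
      (fun q hq => hdetail j q (fun s => Finset.mem_range.1 (Fintype.mem_piFinset.1 hq s)) M)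
      (by positivity) (by rw [card_cubeIndices]; push_cast; rfl) (by positivity) (hB M j i)
    rw [sqrt_pow_nat (by positivity)] at h
    refine le_of_mul_le_mul_right (h.trans ?_) (show 0 < 2 ^ i * θ ^ (j + i) by positivity)
    have h1 : 1 ≤ 2 ^ i * (θ ^ 2) ^ i := by
      rw [← mul_pow]
      exact one_le_pow₀ (by linarith)
    calc _ = A * √(B M) * (ρ * √(2 ^ d)) ^ j := by rw [mul_pow]; ring
      _ ≤ A * √(B M) * (θ ^ 2) ^ j := by gcongr
      _ ≤ A * √(B M) * (θ ^ 2) ^ j * (2 ^ i * (θ ^ 2) ^ i) :=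
        le_mul_of_one_le_right (by positivity) h1
      _ = _ := by rw [pow_right_comm, pow_right_comm θ 2 i, pow_add]; ring
  have hk1 : (1 : ℝ) ≤ k + 1 := by linarith [k.cast_nonneg (α := ℝ)]
  rw [hT]
  calc _ ≤ 2 * A * (√(8 ^ d) * √B₀) * θ ^ k +
        ∑ _j ∈ Finset.range (k + 1), ∑ M : Fin d → Fin (l + 1), A * √(B M) * θ ^ k := by
        refine (abs_add_le _ _).trans (add_le_add hfine ?_)
        refine (Finset.abs_sum_le_sum_abs _ _).trans (Finset.sum_le_sum fun j hj => ?_)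
        exact (Finset.abs_sum_le_sum_abs _ _).trans (Finset.sum_le_sum fun M _ => hcoarse j hj M)
    _ = 2 * A * (√(8 ^ d) * √B₀) * (1 * θ ^ k) +
        (∑ M, A * √(B M)) * ((k + 1) * θ ^ k) := by
        rw [Finset.sum_const, Finset.card_range, nsmul_eq_mul, ← Finset.sum_mul]
        push_cast
        ring
    _ ≤ 2 * A * (√(8 ^ d) * √B₀) * ((k + 1) * θ ^ k) +
        (∑ M, A * √(B M)) * ((k + 1) * θ ^ k) := by gcongr
    _ = _ := by ring

end StochasticMeasure

/-! ### Integrability and continuity in the parameter -/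

section approximation

variable {d : ℕ}

theorem tendsto_haarSum {g : EuclideanSpace ℝ (Fin d) → ℝ} (hg : ContinuousOn g (unitCube d))
    (x : unitCube d) : Tendsto (fun k => haarSum k g x) atTop (𝓝 (g x)) := by
  rw [Metric.tendsto_atTop]
  intro ε hε
  obtain ⟨δ, hδ, hclose⟩ := Metric.continuousWithinAt_iff.1 (hg x x.2) (ε / 2) (half_pos hε)
  have h0 : Tendsto (fun k : ℕ => (d : ℝ) * (1 / 2) ^ k) atTop (𝓝 0) := by
    have := tendsto_pow_atTop_nhds_zero_of_lt_one (r := (1 / 2 : ℝ)) (by norm_num) (by norm_num)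
    simpa using this.const_mul (d : ℝ)
  obtain ⟨K, hK⟩ := eventually_atTop.1 (h0.eventually_lt_const hδ)
  refine ⟨K, fun k hk => ?_⟩
  rw [Real.dist_eq]
  refine lt_of_le_of_lt (abs_haarSum_sub_le hg fun t ht hs => ?_) (half_lt_self hε)
  rw [← Real.dist_eq]
  refine (hclose ht ?_).le
  rw [dist_eq_norm]
  refine (norm_le_of_forall_abs_le hs).trans_lt ?_
  rw [← one_div_pow]
  exact hK k hk

theorem continuous_haarCoeff {Z : Type*} [TopologicalSpace Z] [FirstCountableTopology Z]
    {f : Z → EuclideanSpace ℝ (Fin d) → ℝ} {C : ℝ}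
    (hf : ∀ z, ContinuousOn (f z) (unitCube d)) (hbound : ∀ z, ∀ x ∈ unitCube d, |f z x| ≤ C)
    (hcont : ∀ x ∈ unitCube d, Continuous fun z => f z x) (n : Fin d → ℕ) :
    Continuous fun z => haarCoeff (f z) n := by
  unfold haarCoeff
  have hint : IntegrableOn (fun t : EuclideanSpace ℝ (Fin d) => ∏ s, haar (n s) (t s))
      (unitCube d) := integrableOn_unitCube_prod fun s => integrableOn_haar (n s)
  refine continuous_of_dominated (bound := fun t => C * ‖∏ s, haar (n s) (t s)‖)
    (fun z => (integrableOn_mul_prod_haar (hf z) n).aestronglyMeasurable) (fun z => ?_)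
    (hint.norm.const_mul C) ?_
  · filter_upwards [ae_restrict_mem measurableSet_unitCube] with t ht
    rw [norm_mul]
    exact mul_le_mul_of_nonneg_right (hbound z t ht) (norm_nonneg _)
  · filter_upwards [ae_restrict_mem measurableSet_unitCube] with t ht
    exact (hcont t ht).mul continuous_const

theorem continuous_haarSum {Z : Type*} [TopologicalSpace Z] [FirstCountableTopology Z]
    {f : Z → EuclideanSpace ℝ (Fin d) → ℝ} {C : ℝ}
    (hf : ∀ z, ContinuousOn (f z) (unitCube d)) (hbound : ∀ z, ∀ x ∈ unitCube d, |f z x| ≤ C)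
    (hcont : ∀ x ∈ unitCube d, Continuous fun z => f z x) (k : ℕ) (x : unitCube d) :
    Continuous fun z => haarSum k (f z) x := by
  simp only [haarSum_apply]
  exact continuous_finsetSum _ fun n _ =>
    (continuous_haarCoeff hf hbound hcont n).mul continuous_const

theorem summable_succ_mul_geometric {θ : ℝ} (hθ : 0 < θ) (hθ1 : θ < 1) :
    Summable fun k : ℕ => (k + 1) * θ ^ k := by
  have h1 := summable_pow_mul_geometric_of_norm_lt_one 1 (r := θ)
    (by rwa [Real.norm_eq_abs, abs_of_pos hθ])
  refine (h1.add (summable_geometric_of_lt_one hθ.le hθ1)).congr fun k => ?_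
  ring

/-- The condition `l + α > d / 2` provides a rate `θ < 1` of decay of the series. -/
theorem exists_decay_rate {d l : ℕ} {α : ℝ} (h : (d : ℝ) / 2 < l + α) :
    ∃ θ : ℝ, 0 < θ ∧ θ < 1 ∧ (1 / 2) ^ l * (1 / 2 : ℝ) ^ α * √(2 ^ d) ≤ θ ^ 2 ∧ 1 / 2 ≤ θ ^ 2 := by
  set σ : ℝ := (1 / 2) ^ l * (1 / 2 : ℝ) ^ α * √(2 ^ d) with hσ
  have hσ1 : σ < 1 := by
    have h1 : σ = (2 : ℝ) ^ ((d : ℝ) / 2 - (l + α)) := by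
      rw [hσ, Real.sqrt_eq_rpow, ← Real.rpow_natCast 2 d, ← Real.rpow_mul two_pos.le,
        ← Real.rpow_natCast (1 / 2) l, one_div, Real.inv_rpow two_pos.le, Real.inv_rpow two_pos.le,
        ← Real.rpow_neg two_pos.le, ← Real.rpow_neg two_pos.le, ← Real.rpow_add two_pos,
        ← Real.rpow_add two_pos]
      congr 1
      ring
    rw [h1]
    exact Real.rpow_lt_one_of_one_lt_of_neg one_lt_two (by linarith)
  have hmax : 0 < max σ (1 / 2) := lt_max_of_lt_right (by norm_num)
  refine ⟨√(max σ (1 / 2)), Real.sqrt_pos.2 hmax, ?_, ?_, ?_⟩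
  · rw [Real.sqrt_lt' one_pos, one_pow]
    exact max_lt hσ1 (by norm_num)
  · rw [Real.sq_sqrt hmax.le]
    exact le_max_left _ _
  · rw [Real.sq_sqrt hmax.le]
    exact le_max_right _ _

end approximation

namespace StochasticMeasure

/-- The stochastic measure `B ↦ μ (A ∩ B)`. -/
def restrict {X Ω : Type*} [MeasurableSpace X] [MeasurableSpace Ω] {P : Measure Ω}
    (μ : StochasticMeasure X P) {A : Set X} (hA : MeasurableSet A) : StochasticMeasure X P where
  val B := μ.val (A ∩ B)
  aemeasurable B hB := μ.aemeasurable _ (hA.inter hB)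
  add B B' hB hB' hd := by
    rw [Set.inter_union_distrib_left]
    exact μ.add _ _ (hA.inter hB) (hA.inter hB')
      (hd.mono Set.inter_subset_right Set.inter_subset_right)
  tendsto_zero B hB hanti hemp := by
    refine μ.tendsto_zero _ (fun n => hA.inter (hB n))
      (fun m n hmn => Set.inter_subset_inter_right _ (hanti hmn)) ?_
    rw [← Set.inter_iInter, hemp, Set.inter_empty]

theorem simpleIntegral_restrict {X Ω : Type*} [MeasurableSpace X] [MeasurableSpace Ω]
    {P : Measure Ω} (μ : StochasticMeasure X P) {A : Set X} (hA : MeasurableSet A)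
    (g : SimpleFunc X ℝ) :
    (μ.restrict hA).simpleIntegral Set.univ g = μ.simpleIntegral A g := by
  funext ω
  simp [simpleIntegral, restrict]

variable {d : ℕ} {Ω : Type*} [MeasurableSpace Ω] {P : Measure Ω}

theorem simpleIntegral_haarSum (μ : StochasticMeasure (unitCube d) P)
    (g : EuclideanSpace ℝ (Fin d) → ℝ) : ∀ᵐ ω ∂P, ∀ k,
      μ.simpleIntegral Set.univ (haarSum k g) ω =
        μ.simpleIntegral Set.univ (haarSum 0 g) ω +
          ∑ i ∈ Finset.range k, haarSeriesTerm μ g i ω := by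
  filter_upwards [ae_all_iff.2 fun i =>
    μ.simpleIntegral_sub .univ (haarSum (i + 1) g) (haarSum i g)] with ω hω k
  induction k with
  | zero => simp
  | succ k ih =>
    have h : haarSeriesTerm μ g k ω = _ := hω k
    rw [Finset.sum_range_succ, h, ← add_assoc, ← ih]
    ring

/-- The partial sums of the series are the integrals of the Fourier–Haar sums. -/
theorem tendstoInMeasure_haarSum [IsFiniteMeasure P] (μ : StochasticMeasure (unitCube d) P)
    {g : EuclideanSpace ℝ (Fin d) → ℝ}
    (h : ∀ᵐ ω ∂P, Summable fun k => haarSeriesTerm μ g k ω) :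
    TendstoInMeasure P (fun k => μ.simpleIntegral Set.univ (haarSum k g)) atTop
      (haarSeries μ g) := by
  refine tendstoInMeasure_of_tendsto_ae
    (fun k => (μ.aemeasurable_simpleIntegral .univ _).aestronglyMeasurable) ?_
  filter_upwards [h, μ.simpleIntegral_haarSum g] with ω hω hsum
  refine Tendsto.congr (fun k => (hsum k).symm) ?_
  exact hω.hasSum.tendsto_sum_nat.const_add _

/-- A function whose Fourier–Haar series converges almost surely with respect to every restriction
of the stochastic measure is integrable, and the sum of the series is its integral. -/
theorem hasIntegral_haarSeries [IsFiniteMeasure P] (μ : StochasticMeasure (unitCube d) P)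
    {g : EuclideanSpace ℝ (Fin d) → ℝ} (hg : ContinuousOn g (unitCube d))
    (h : ∀ ν : StochasticMeasure (unitCube d) P,
      ∀ᵐ ω ∂P, Summable fun k => haarSeriesTerm ν g k ω) :
    μ.HasIntegral (fun x => g x) (haarSeries μ g) := by
  refine ⟨fun k => haarSum k g, fun x => tendsto_haarSum hg x, fun A hA => ?_,
    μ.tendstoInMeasure_haarSum (h μ)⟩
  have := (μ.restrict hA).tendstoInMeasure_haarSum (h (μ.restrict hA))
  simp only [simpleIntegral_restrict] at this
  exact ⟨_, this⟩

/-- Outside one null set, each term is a finite combination of values of `μ` with coefficients that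
are continuous in the parameter, so a summable bound for the terms gives a continuous sum. -/
theorem continuous_haarSeries (μ : StochasticMeasure (unitCube d) P) {Z : Type*}
    [TopologicalSpace Z] [FirstCountableTopology Z] {f : Z → EuclideanSpace ℝ (Fin d) → ℝ} {C : ℝ}
    (hf : ∀ z, ContinuousOn (f z) (unitCube d)) (hbound : ∀ z, ∀ x ∈ unitCube d, |f z x| ≤ C)
    (hcont : ∀ x ∈ unitCube d, Continuous fun z => f z x) :
    ∀ᵐ ω ∂P, ∀ u : ℕ → ℝ, Summable u → (∀ k z, |haarSeriesTerm μ (f z) k ω| ≤ u k) →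
      Continuous fun z => haarSeries μ (f z) ω := by
  filter_upwards [μ.simpleIntegral_eq_sum_gridPoint] with ω hω u hu hle
  have hsum := continuous_haarSum hf hbound hcont
  have h0 : Continuous fun z => μ.simpleIntegral Set.univ (haarSum 0 (f z)) ω := by
    have : ∀ z, μ.simpleIntegral Set.univ (haarSum 0 (f z)) ω = _ := fun z =>
      hω 0 (haarSum 0 (f z)) fun x y h => haarSum_eq_of_gridMap_eq le_rfl (f z) h
    simp only [this]
    exact continuous_finsetSum _ fun e _ => (hsum 0 _).mul continuous_const
  have hterm : ∀ k, Continuous fun z => haarSeriesTerm μ (f z) k ω := fun k => by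
    have : ∀ z, haarSeriesTerm μ (f z) k ω = _ := fun z =>
      hω (k + 1) (haarIncr k (f z)) fun x y h => haarIncr_eq_of_gridMap_eq k (f z) h
    simp only [this, haarIncr_apply]
    exact continuous_finsetSum _ fun e _ => ((hsum (k + 1) _).sub (hsum k _)).mul continuous_const
  exact h0.add (continuous_tsum hterm hu hle)

end StochasticMeasure

theorem mainTheorem1 {Ω : Type*} [MeasurableSpace Ω] (P : Measure Ω) [IsProbabilityMeasure P]
    {Z : Type*} [MetricSpace Z] (d l : ℕ) (α C : ℝ) (hα : 0 < α) (hC : 0 < C)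
    (hlα : (d : ℝ) / 2 < l + α)
    (μ : StochasticMeasure (unitCube d) P)
    (f : Z → EuclideanSpace ℝ (Fin d) → ℝ)
    (hcont : ∀ x ∈ unitCube d, Continuous fun z => f z x)
    (hdiff : ∀ z, ContDiffOn ℝ l (f z) (unitCube d))
    (hbound : ∀ z, ∀ r ≤ l, ∀ s : Fin r → Fin d, ∀ x ∈ unitCube d,
      |cubePartial (f z) s x| ≤ C)
    (hholder : ∀ z, ∀ s : Fin l → Fin d, ∀ x ∈ unitCube d, ∀ y ∈ unitCube d,
      |cubePartial (f z) s x - cubePartial (f z) s y| ≤ C * ‖x - y‖ ^ α) :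
    (∀ z, μ.Integrable fun x => f z x) ∧
    (∀ η : Z → Ω → ℝ, (∀ z, μ.HasIntegral (fun x => f z x) (η z)) →
      ∀ z, ∀ᵐ ω ∂P, haarSeries μ (f z) ω = η z ω) ∧
    (∀ᵐ ω ∂P, (∀ z, Summable fun k => haarSeriesTerm μ (f z) k ω) ∧
      Continuous fun z => haarSeries μ (f z) ω) := by
  obtain ⟨θ, hθ, hθ1, hρθ, hθ2⟩ := exists_decay_rate hlα
  have hsmooth : ∀ z, IsHolderSmooth l α C (f z) := fun z => ⟨hdiff z, hbound z, hholder z⟩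
  have hfc : ∀ z, ContinuousOn (f z) (unitCube d) := fun z => (hdiff z).continuousOn
  have habs : ∀ z, ∀ x ∈ unitCube d, |f z x| ≤ C := fun z x hx => by
    have := hbound z 0 (Nat.zero_le l) Fin.elim0 x hx
    rwa [cubePartial, iteratedFDerivWithin_zero_apply] at this
  have hu := summable_succ_mul_geometric hθ hθ1
  have hterm := fun ν : StochasticMeasure (unitCube d) P =>
    ν.ae_exists_haarSeriesTerm_bound hα.le hC.le rfl hθ hθ1 hρθ hθ2
  have hint : ∀ z, μ.HasIntegral (fun x => f z x) (haarSeries μ (f z)) := fun z =>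
    μ.hasIntegral_haarSeries (hfc z) fun ν => by
      filter_upwards [hterm ν] with ω ⟨D, hD⟩
      exact .of_norm_bounded (hu.mul_left D) (hD _ (hsmooth z))
  refine ⟨fun z => ⟨_, hint z⟩, fun η hη z => (hint z).unique (hη z), ?_⟩
  filter_upwards [hterm μ, μ.continuous_haarSeries hfc habs hcont] with ω ⟨D, hD⟩ hω
  exact ⟨fun z => .of_norm_bounded (hu.mul_left D) (hD _ (hsmooth z)),
    hω _ (hu.mul_left D) fun k z => hD _ (hsmooth z) k⟩
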